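/- **Setting.** Let $d\ge 2$, $\Omega=(0,1)^d$, $0<p\le 2$, $0<q\le\infty$ and $s>d/p$. Let $r=r(s)$ be the smallest integer strictly larger than $\max\{s,1\}$. For $f\in L_p(\Omega)$ and $t>0$ put $$\omega_r(f,t)_p:=\sup_{|h|\le t}\|\Delta_h^r f\|_{L_p(\Omega_{rh})},\qquad \Delta_h^r f(x):=\sum_{j=0}^r(-1)^{r-j}\binom rj f(x+jh),\qquad \Omega_{h}:=\{x\in\Omega:[x,x+h]\subset\Omega\},$$ where $|h|$ is the Euclidean norm of $h\in\mathbb R^d$, and $$|f|_{B^s_q(L_p(\Omega))}:=\Big(\int_0^1\big[t^{-s}\omega_r(f,t)_p\big]^q\,\frac{dt}{t}\Big)^{1/q}\quad(q<\infty),\qquad |f|_{B^s_\infty(L_p(\Omega))}:=\sup_{0<t<1}t^{-s}\omega_r(f,t)_p .$$ The space $B^s_q(L_p(\Omega))$ consists of the real-valued $f\in L_p(\Omega)$ with $|f|_{B^s_q(L_p(\Omega))}<\infty$. The norm of $H^1(\Omega)$ is $\|u\|_{H^1(\Omega)}=\big(\|u\|_{L_2(\Omega)}^2+\sum_{i=1}^d\|\partial_iu\|_{L_2(\Omega)}^2\big)^{1/2}$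 with weak derivatives $\partial_i u$. For an integer $k\ge0$ divide $[0,1]^d$ into the dyadic cubes of side length $2^{-k}$, and divide each cube $\prod_i[a_i2^{-k},(a_i+1)2^{-k}]$ into the $d!$ closed Kuhn simplices $$T_\sigma=\{x:\ 1\ge y_{\sigma(1)}\ge\dots\ge y_{\sigma(d)}\ge0,\ \ y_i=2^kx_i-a_i\},$$ one for each permutation $\sigma$ of $\{1,\dots,d\}$. Let $G_{k,r}$ be the set of the points of $[0,1]^d$ all of whose coordinates are integer multiples of $2^{-k}(r-1)^{-1}$. For a real-valued function $g$ on $[0,1]^d$ and each simplex $T$ of this decomposition let $L_T(g)$ be the unique polynomial of total degree less than $r$ that agrees with $g$ at the points of $G_{k,r}\cap T$, and let $S_k^*(g)$ be the function on $[0,1]^d$ that equals $L_T(g)$ on each $T$. For $f\in B^s_q(L_p(\Omega))$ let $S_k^*(f):=S_k^*(\tilde f)$, where $\tilde f$ is the continuous function on $[0,1]^d$ that equals $f$ a.e. on $\Omega$. **Theorem.** There is a constant $C>0$, depending only on $d$, $s$ and $p$, such that every $f\in B_q^s(L_p(\Omega))$ has a continuous representative $\tilde f$ on $[0,1]^d$,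 and for every integer $k\ge0$ the function $f-S_k^*(f)$ belongs to $H^1(\Omega)$ and $$\|f-S_k^*(f)\|_{H^1(\Omega)}\le C\,|f|_{B_q^s(L_p(\Omega))}\,2^{-k(s-1-d/p+d/2)} .$$ -/

import Mathlib

open MeasureTheory Set
open scoped ENNReal ContDiff

noncomputable section

/-! ### The unit cube, differences, moduli of smoothness and Besov (quasi-)seminorms -/

/-- The open unit cube `(0,1)^d`, with the ambient Euclidean norm. -/
def openUnitCube (d : ℕ) : Set (EuclideanSpace ℝ (Fin d)) :=
  {x | ∀ i, 0 < x i ∧ x i < 1}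

/-- The closed unit cube `[0,1]^d`. -/
def closedUnitCube (d : ℕ) : Set (EuclideanSpace ℝ (Fin d)) :=
  {x | ∀ i, 0 ≤ x i ∧ x i ≤ 1}

/-- `Ω_h`: the points `x` of `Ω` such that the segment `[x, x + h]` lies in `Ω`. -/
def shiftDomain {d : ℕ} (Ω : Set (EuclideanSpace ℝ (Fin d))) (h : EuclideanSpace ℝ (Fin d)) :
    Set (EuclideanSpace ℝ (Fin d)) :=
  {x | x ∈ Ω ∧ segment ℝ x (x + h) ⊆ Ω}

/-- The modulus of smoothness of order `r` in `L_p` of the open unit cube: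
`ω_r(f,t)_p = sup_{|h| ≤ t} ‖Δ_h^r f‖_{L_p(Ω_{rh})}`. -/
def modulusOfSmoothness {d : ℕ} (r : ℕ) (p : ℝ≥0∞) (f : EuclideanSpace ℝ (Fin d) → ℝ)
    (t : ℝ) : ℝ≥0∞ :=
  ⨆ (h : EuclideanSpace ℝ (Fin d)) (_ : ‖h‖ ≤ t),
    eLpNorm ((fwdDiff h)^[r] f) p
      (volume.restrict (shiftDomain (openUnitCube d) ((r : ℝ) • h)))

/-- The smallest integer strictly larger than `max (s, 1)`. -/
def smoothnessOrder (s : ℝ) : ℕ := ⌊max s 1⌋₊ + 1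

/-- The (quasi-)seminorm of the Besov space `B_q^s(L_p)` of the open unit cube, with differences of
order `r(s)`:
`(∫_0^1 (t^{-s} ω_r(f,t)_p)^q dt/t)^{1/q}`, and the supremum over `t` if `q = ∞`. -/
def besovSeminorm {d : ℕ} (s : ℝ) (p q : ℝ≥0∞) (f : EuclideanSpace ℝ (Fin d) → ℝ) : ℝ≥0∞ :=
  if q = ⊤ then
    ⨆ t ∈ Ioo (0 : ℝ) 1,
      ENNReal.ofReal (t ^ (-s)) * modulusOfSmoothness (smoothnessOrder s) p f t
  else
    (∫⁻ t in Ioo (0 : ℝ) 1,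
      (ENNReal.ofReal (t ^ (-s)) * modulusOfSmoothness (smoothnessOrder s) p f t) ^ q.toReal *
        ENNReal.ofReal t⁻¹) ^ (1 / q.toReal)

/-- `f` (only its values in the open unit cube `Ω` matter) belongs to `B_q^s(L_p(Ω))`. -/
def MemBesov {d : ℕ} (s : ℝ) (p q : ℝ≥0∞) (f : EuclideanSpace ℝ (Fin d) → ℝ) : Prop :=
  MemLp f p (volume.restrict (openUnitCube d)) ∧ besovSeminorm s p q f < ⊤

/-! ### The Sobolev norm of `H^1` -/

/-- `v` is a weak `i`-th partial derivative of `u` in `Ω`. -/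
def HasWeakPartialDeriv {d : ℕ} (Ω : Set (EuclideanSpace ℝ (Fin d))) (i : Fin d)
    (u v : EuclideanSpace ℝ (Fin d) → ℝ) : Prop :=
  ∀ φ : EuclideanSpace ℝ (Fin d) → ℝ, ContDiff ℝ ∞ φ → HasCompactSupport φ → tsupport φ ⊆ Ω →
    ∫ x in Ω, u x * fderiv ℝ φ x (EuclideanSpace.single i 1) = - ∫ x in Ω, v x * φ x

/-- `v` consists of weak partial derivatives of `u` on `Ω`, and `u` and all `v i` are in `L_2`. -/
def IsH1Gradient {d : ℕ} (Ω : Set (EuclideanSpace ℝ (Fin d)))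
    (u : EuclideanSpace ℝ (Fin d) → ℝ) (v : Fin d → EuclideanSpace ℝ (Fin d) → ℝ) : Prop :=
  MemLp u 2 (volume.restrict Ω) ∧
    ∀ i, MemLp (v i) 2 (volume.restrict Ω) ∧ HasWeakPartialDeriv Ω i u (v i)

/-- The norm of `H^1(Ω)`: `(‖u‖_{L_2}^2 + ∑ i, ‖∂_i u‖_{L_2}^2)^{1/2}` if `u` belongs to `H^1(Ω)`
(the weak gradient is unique up to null sets, so that the infimum is over one value), and `∞`
otherwise. -/
def h1Norm {d : ℕ} (Ω : Set (EuclideanSpace ℝ (Fin d))) (u : EuclideanSpace ℝ (Fin d) → ℝ) :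
    ℝ≥0∞ :=
  ⨅ (v : Fin d → EuclideanSpace ℝ (Fin d) → ℝ) (_ : IsH1Gradient Ω u v),
    (eLpNorm u 2 (volume.restrict Ω) ^ 2 +
      ∑ i, eLpNorm (v i) 2 (volume.restrict Ω) ^ 2) ^ (1 / 2 : ℝ)

/-! ### The simplicial interpolant -/

/-- The grid `G_{k,r}` of `[0,1]^d` with spacing `2^{-k} (r-1)^{-1}` (used for `r ≥ 2`). -/
def interpGrid (d r k : ℕ) : Set (EuclideanSpace ℝ (Fin d)) :=
  {x | ∃ j : Fin d → ℕ, ∀ i, j i ≤ (r - 1) * 2 ^ k ∧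
    x i = (j i : ℝ) / (((r - 1 : ℕ) : ℝ) * 2 ^ k)}

/-- The closed simplex with index `σ` in the Kuhn decomposition of the dyadic cube
`∏ i, [a i 2^{-k}, (a i + 1) 2^{-k}]`: in the coordinates `y i = 2^k x i - a i` of the cube,
`1 ≥ y (σ 0) ≥ y (σ 1) ≥ ⋯ ≥ y (σ (d-1)) ≥ 0`. -/
def kuhnSimplex {d : ℕ} (k : ℕ) (a : Fin d → Fin (2 ^ k)) (σ : Equiv.Perm (Fin d)) :
    Set (EuclideanSpace ℝ (Fin d)) :=
  {x | (∀ i, 0 ≤ 2 ^ k * x i - (a i : ℕ) ∧ 2 ^ k * x i - (a i : ℕ) ≤ (1 : ℝ)) ∧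
    Antitone fun i => (2 : ℝ) ^ k * x (σ i) - (a (σ i) : ℕ)}

/-- `P` has total degree less than `r` and interpolates `f` at the points of the grid `G_{k,r}`
that lie in a closed simplex. -/
def IsLocalInterpolant {d : ℕ} (r k : ℕ) (a : Fin d → Fin (2 ^ k)) (σ : Equiv.Perm (Fin d))
    (f : EuclideanSpace ℝ (Fin d) → ℝ) (P : MvPolynomial (Fin d) ℝ) : Prop :=
  P.totalDegree < r ∧
    ∀ x ∈ interpGrid d r k ∩ kuhnSimplex k a σ, MvPolynomial.eval (fun i => x i) P = f x

section unisolvence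
open MvPolynomial

variable {d : ℕ}

/-- The local coordinate `y (σ i)` of a cube as a polynomial, and `0` for `i ≥ d`. -/
def kuhnCoord (k : ℕ) (a : Fin d → Fin (2 ^ k)) (σ : Equiv.Perm (Fin d)) (i : ℕ) :
    MvPolynomial (Fin d) ℝ :=
  if h : i < d then C ((2 : ℝ) ^ k) * X (σ ⟨i, h⟩) - C ((a (σ ⟨i, h⟩) : ℕ) : ℝ) else 0

lemma kuhnCoord_totalDegree (k : ℕ) (a : Fin d → Fin (2 ^ k)) (σ : Equiv.Perm (Fin d)) (i : ℕ) :
    (kuhnCoord k a σ i).totalDegree ≤ 1 := by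
  unfold kuhnCoord
  split_ifs with h
  · refine (totalDegree_sub _ _).trans (max_le ?_ (by rw [totalDegree_C]; exact Nat.zero_le 1))
    refine (totalDegree_mul _ _).trans ?_
    rw [totalDegree_C, totalDegree_X]
  · simp

/-- A grid point of a Kuhn simplex has natural numbers as local coordinates, in grid units. -/
lemma grid_coords {r k : ℕ} (hr : 2 ≤ r) {a : Fin d → Fin (2 ^ k)} {σ : Equiv.Perm (Fin d)}
    {x : EuclideanSpace ℝ (Fin d)} (hx : x ∈ interpGrid d r k ∩ kuhnSimplex k a σ) :
    ∃ w : ℕ → ℕ, w 0 ≤ r - 1 ∧ Antitone w ∧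
      ∀ i, ((r - 1 : ℕ) : ℝ) * eval (fun i => x i) (kuhnCoord k a σ i) = w i := by
  obtain ⟨⟨j, hj⟩, hx1, hx2⟩ := hx
  have hn : (0 : ℝ) < ((r - 1 : ℕ) : ℝ) := by exact_mod_cast (by omega : 0 < r - 1)
  have hk : (0 : ℝ) < 2 ^ k := by positivity
  have key : ∀ c, ((r - 1 : ℕ) : ℝ) * (2 ^ k * x c - (a c : ℕ)) =
      (j c : ℝ) - ((r - 1 : ℕ) : ℝ) * (a c : ℕ) := by
    intro c
    rw [(hj c).2]; field_simp
  have hle : ∀ c, (r - 1) * (a c : ℕ) ≤ j c := by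
    intro c
    have h1 := mul_nonneg hn.le (hx1 c).1
    rw [key] at h1
    have : ((r - 1 : ℕ) : ℝ) * (a c : ℕ) ≤ j c := by linarith
    exact_mod_cast this
  have key' : ∀ c, ((r - 1 : ℕ) : ℝ) * (2 ^ k * x c - (a c : ℕ)) =
      ((j c - (r - 1) * (a c : ℕ) : ℕ) : ℝ) := by
    intro c
    rw [key, Nat.cast_sub (hle c)]; push_cast; rfl
  have hev : ∀ i (h : i < d), eval (fun i => x i) (kuhnCoord k a σ i) =
      2 ^ k * x (σ ⟨i, h⟩) - (a (σ ⟨i, h⟩) : ℕ) := by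
    intro i h; simp [kuhnCoord, h]
  refine ⟨fun i => if h : i < d then j (σ ⟨i, h⟩) - (r - 1) * (a (σ ⟨i, h⟩) : ℕ) else 0,
    ?_, ?_, ?_⟩
  · dsimp only
    split_ifs with h
    · have := mul_le_mul_of_nonneg_left (hx1 (σ ⟨0, h⟩)).2 hn.le
      rw [key', mul_one] at this
      exact Nat.cast_le.1 this
    · exact Nat.zero_le _
  · intro i i' hii
    dsimp only
    by_cases h' : i' < d
    · have h : i < d := by omega
      rw [dif_pos h', dif_pos h]
      have := mul_le_mul_of_nonneg_left
        (hx2 (show (⟨i, h⟩ : Fin d) ≤ ⟨i', h'⟩ from hii)) hn.le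
      dsimp only at this
      rw [key', key'] at this
      exact_mod_cast this
    · rw [dif_neg h']; exact Nat.zero_le _
  · intro i
    by_cases h : i < d
    · rw [hev i h, key']; simp [h]
    · simp [kuhnCoord, h]

/-- Barycentric coordinates of a Kuhn simplex, multiplied by `r - 1`, as polynomials. -/
def kuhnBary (r k : ℕ) (a : Fin d → Fin (2 ^ k)) (σ : Equiv.Perm (Fin d)) :
    ℕ → MvPolynomial (Fin d) ℝ
  | 0 => C ((r - 1 : ℕ) : ℝ) * (1 - kuhnCoord k a σ 0)
  | m + 1 => C ((r - 1 : ℕ) : ℝ) * (kuhnCoord k a σ m - kuhnCoord k a σ (m + 1))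

lemma kuhnBary_totalDegree (r k : ℕ) (a : Fin d → Fin (2 ^ k)) (σ : Equiv.Perm (Fin d)) (m : ℕ) :
    (kuhnBary r k a σ m).totalDegree ≤ 1 := by
  have h := kuhnCoord_totalDegree k a σ
  cases m with
  | zero =>
    refine (totalDegree_mul _ _).trans ?_
    rw [totalDegree_C, zero_add]
    exact (totalDegree_sub _ _).trans (max_le (by simp) (h 0))
  | succ m =>
    refine (totalDegree_mul _ _).trans ?_
    rw [totalDegree_C, zero_add]
    exact (totalDegree_sub _ _).trans (max_le (h m) (h (m + 1)))

lemma grid_bary {r k : ℕ} (hr : 2 ≤ r) {a : Fin d → Fin (2 ^ k)} {σ : Equiv.Perm (Fin d)}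
    {x : EuclideanSpace ℝ (Fin d)} (hx : x ∈ interpGrid d r k ∩ kuhnSimplex k a σ) :
    ∃ κ : ℕ → ℕ, ∑ m ∈ Finset.range (d + 1), κ m = r - 1 ∧
      ∀ m, eval (fun i => x i) (kuhnBary r k a σ m) = κ m := by
  obtain ⟨w, h0, hw, hev⟩ := grid_coords hr hx
  have hwd : w d = 0 := by
    have := hev d
    simp [kuhnCoord] at this
    exact_mod_cast this.symm
  let κ : ℕ → ℕ := fun m => match m with
    | 0 => r - 1 - w 0
    | m + 1 => w m - w (m + 1)
  refine ⟨κ, ?_, ?_⟩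
  · have : ∀ e, ∑ m ∈ Finset.range (e + 1), κ m + w e = r - 1 := by
      intro e
      induction e with
      | zero => simp [κ]; omega
      | succ e ih =>
        rw [Finset.sum_range_succ]
        have h1 : w (e + 1) ≤ w e := hw (Nat.le_succ e)
        have h2 : κ (e + 1) = w e - w (e + 1) := rfl
        omega
    have := this d
    omega
  · intro m
    cases m with
    | zero =>
      have := hev 0
      simp only [kuhnBary, κ, map_mul, map_sub, eval_C, map_one]
      rw [mul_sub, this, Nat.cast_sub h0]; ring
    | succ m =>
      simp only [kuhnBary, κ, map_mul, map_sub, eval_C]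
      rw [mul_sub, hev, hev, Nat.cast_sub (hw (Nat.le_succ m))]

lemma eq_of_bary {r k : ℕ} (hr : 2 ≤ r) {a : Fin d → Fin (2 ^ k)} {σ : Equiv.Perm (Fin d)}
    {x y : EuclideanSpace ℝ (Fin d)}
    (h : ∀ m ∈ Finset.range (d + 1), eval (fun i => x i) (kuhnBary r k a σ m) =
      eval (fun i => y i) (kuhnBary r k a σ m)) : x = y := by
  have hn : ((r - 1 : ℕ) : ℝ) ≠ 0 := by exact_mod_cast (by omega : r - 1 ≠ 0)
  have hc : ∀ i, i < d → eval (fun i => x i) (kuhnCoord k a σ i) =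
      eval (fun i => y i) (kuhnCoord k a σ i) := by
    intro i
    induction i with
    | zero =>
      intro _
      have := h 0 (by simp)
      simpa [kuhnBary, hn] using this
    | succ i ih =>
      intro hi
      have h1 := h (i + 1) (by simp; omega)
      have h2 := ih (by omega)
      simp only [kuhnBary, map_mul, map_sub, eval_C] at h1
      have := mul_left_cancel₀ hn h1
      linarith
  ext c
  have := hc (σ.symm c) (σ.symm c).2
  simpa [kuhnCoord] using this

lemma exists_localBasis {r k : ℕ} (hr : 2 ≤ r) {a : Fin d → Fin (2 ^ k)}
    {σ : Equiv.Perm (Fin d)} {x : EuclideanSpace ℝ (Fin d)}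
    (hx : x ∈ interpGrid d r k ∩ kuhnSimplex k a σ) :
    ∃ P : MvPolynomial (Fin d) ℝ, P.totalDegree < r ∧ eval (fun i => x i) P = 1 ∧
      ∀ y ∈ interpGrid d r k ∩ kuhnSimplex k a σ, y ≠ x → eval (fun i => y i) P = 0 := by
  obtain ⟨κ, hsum, hκ⟩ := grid_bary hr hx
  let Q : MvPolynomial (Fin d) ℝ := ∏ m ∈ Finset.range (d + 1), ∏ l ∈ Finset.range (κ m),
    (kuhnBary r k a σ m - C (l : ℝ))
  have hQdeg : Q.totalDegree ≤ r - 1 := by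
    refine (totalDegree_finsetProd _ _).trans ?_
    rw [← hsum]
    refine Finset.sum_le_sum fun m _ => ?_
    refine (totalDegree_finsetProd _ _).trans ?_
    refine (Finset.sum_le_card_nsmul _ _ 1 fun l _ => ?_).trans (by simp)
    exact (totalDegree_sub _ _).trans (max_le (kuhnBary_totalDegree r k a σ m)
      (by rw [totalDegree_C]; exact Nat.zero_le 1))
  have hQ : ∀ z : EuclideanSpace ℝ (Fin d), eval (fun i => z i) Q =
      ∏ m ∈ Finset.range (d + 1), ∏ l ∈ Finset.range (κ m),
        (eval (fun i => z i) (kuhnBary r k a σ m) - l) := by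
    intro z; simp [Q, map_prod]
  have hQx : eval (fun i => x i) Q ≠ 0 := by
    rw [hQ]
    refine Finset.prod_ne_zero_iff.2 fun m _ => Finset.prod_ne_zero_iff.2 fun l hl => ?_
    rw [hκ m, sub_ne_zero]
    have := Finset.mem_range.1 hl
    exact_mod_cast (by omega : κ m ≠ l)
  refine ⟨C (eval (fun i => x i) Q)⁻¹ * Q, ?_, ?_, ?_⟩
  · have := totalDegree_mul (C (eval (fun i => x i) Q)⁻¹) Q
    rw [totalDegree_C] at this
    omega
  · rw [map_mul, eval_C, inv_mul_cancel₀ hQx]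
  · intro y hy hyx
    rw [map_mul, eval_C]
    suffices h : eval (fun i => y i) Q = 0 by rw [h, mul_zero]
    by_contra hne
    rw [hQ] at hne
    obtain ⟨κ', hsum', hκ'⟩ := grid_bary hr hy
    have hle : ∀ m ∈ Finset.range (d + 1), κ m ≤ κ' m := by
      intro m hm
      by_contra hlt
      refine Finset.prod_ne_zero_iff.1 (Finset.prod_ne_zero_iff.1 hne m hm) (κ' m)
        (Finset.mem_range.2 (by omega)) ?_
      rw [hκ' m, sub_self]
    have heq := (Finset.sum_eq_sum_iff_of_le hle).1 (by rw [hsum, hsum'])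
    refine hyx (eq_of_bary hr (a := a) (σ := σ) fun m hm => ?_)
    rw [hκ, hκ', heq m hm]

lemma interpGrid_finite (d r k : ℕ) : (interpGrid d r k).Finite := by
  have hf : (Set.range fun j : Fin d → Fin ((r - 1) * 2 ^ k + 1) =>
      (WithLp.toLp 2 fun i => ((j i : ℕ) : ℝ) / (((r - 1 : ℕ) : ℝ) * 2 ^ k) :
        EuclideanSpace ℝ (Fin d))).Finite := Set.finite_range _
  refine hf.subset ?_
  rintro x ⟨j, hj⟩
  refine ⟨fun i => ⟨j i, Nat.lt_succ_of_le (hj i).1⟩, ?_⟩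
  ext i
  simp [(hj i).2]

/-- The grid point with prescribed barycentric coordinates. -/
def gridPoint (r k : ℕ) (a : Fin d → Fin (2 ^ k)) (σ : Equiv.Perm (Fin d)) (κ : Fin d → ℕ) :
    EuclideanSpace ℝ (Fin d) :=
  WithLp.toLp 2 fun c => (((r - 1) * (a c : ℕ) + ∑ m ∈ Finset.Ici (σ.symm c), κ m : ℕ) : ℝ) /
    (((r - 1 : ℕ) : ℝ) * 2 ^ k)

lemma gridPoint_local {r : ℕ} (hr : 2 ≤ r) (k : ℕ) (a : Fin d → Fin (2 ^ k))
    (σ : Equiv.Perm (Fin d)) (κ : Fin d → ℕ) (c : Fin d) :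
    2 ^ k * gridPoint r k a σ κ c - ((a c : ℕ) : ℝ) =
      ((∑ m ∈ Finset.Ici (σ.symm c), κ m : ℕ) : ℝ) / ((r - 1 : ℕ) : ℝ) := by
  have hn : ((r - 1 : ℕ) : ℝ) ≠ 0 := by exact_mod_cast (by omega : r - 1 ≠ 0)
  simp only [gridPoint]
  rw [Nat.cast_add, Nat.cast_mul]
  field_simp
  ring

lemma gridPoint_mem {r : ℕ} (hr : 2 ≤ r) (k : ℕ) (a : Fin d → Fin (2 ^ k))
    (σ : Equiv.Perm (Fin d)) (κ : Fin d → ℕ) (hκ : ∑ m, κ m ≤ r - 1) :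
    gridPoint r k a σ κ ∈ interpGrid d r k ∩ kuhnSimplex k a σ := by
  have hn : (0 : ℝ) < ((r - 1 : ℕ) : ℝ) := by exact_mod_cast (by omega : 0 < r - 1)
  have hs : ∀ c, ∑ m ∈ Finset.Ici c, κ m ≤ r - 1 := fun c =>
    (Finset.sum_le_sum_of_subset (Finset.subset_univ _)).trans hκ
  refine ⟨⟨fun c => (r - 1) * (a c : ℕ) + ∑ m ∈ Finset.Ici (σ.symm c), κ m, fun c => ⟨?_, rfl⟩⟩,
    fun c => ⟨?_, ?_⟩, fun i j hij => ?_⟩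
  · have h1 : (a c : ℕ) + 1 ≤ 2 ^ k := (a c).2
    calc (r - 1) * (a c : ℕ) + ∑ m ∈ Finset.Ici (σ.symm c), κ m
        ≤ (r - 1) * (a c : ℕ) + (r - 1) := Nat.add_le_add_left (hs _) _
      _ = (r - 1) * ((a c : ℕ) + 1) := by ring
      _ ≤ (r - 1) * 2 ^ k := Nat.mul_le_mul_left _ h1
  · rw [gridPoint_local hr]; positivity
  · rw [gridPoint_local hr, div_le_one hn]
    exact_mod_cast hs _
  · dsimp only
    rw [gridPoint_local hr, gridPoint_local hr]
    simp only [Equiv.symm_apply_apply]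
    have : ∑ m ∈ Finset.Ici j, κ m ≤ ∑ m ∈ Finset.Ici i, κ m :=
      Finset.sum_le_sum_of_subset (Finset.Ici_subset_Ici.2 hij)
    gcongr

lemma gridPoint_injective {r : ℕ} (hr : 2 ≤ r) (k : ℕ) (a : Fin d → Fin (2 ^ k))
    (σ : Equiv.Perm (Fin d)) : Function.Injective (gridPoint r k a σ) := by
  intro κ κ' h
  have hn : ((r - 1 : ℕ) : ℝ) ≠ 0 := by exact_mod_cast (by omega : r - 1 ≠ 0)
  have hs : ∀ i, ∑ m ∈ Finset.Ici i, κ m = ∑ m ∈ Finset.Ici i, κ' m := by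
    intro i
    have h1 := gridPoint_local hr k a σ κ (σ i)
    have h2 := gridPoint_local hr k a σ κ' (σ i)
    rw [h, h2, div_left_inj' hn] at h1
    simp only [Equiv.symm_apply_apply] at h1
    exact_mod_cast h1.symm
  have ht : ∀ i, ∑ m ∈ Finset.Ioi i, κ m = ∑ m ∈ Finset.Ioi i, κ' m := by
    intro i
    by_cases hi : (i : ℕ) + 1 < d
    · have : Finset.Ioi i = Finset.Ici (⟨i + 1, hi⟩ : Fin d) := by
        ext m
        rw [Finset.mem_Ioi, Finset.mem_Ici, Fin.lt_def, Fin.le_def]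
        exact Nat.succ_le_iff.symm
      rw [this, hs]
    · have : Finset.Ioi i = ∅ := by
        ext m
        simp only [Finset.mem_Ioi, Finset.notMem_empty, iff_false, Fin.lt_def]
        have := m.2
        omega
      rw [this]; simp
  ext i
  have h1 := hs i
  rw [← Finset.Ioi_insert, Finset.sum_insert (by simp), Finset.sum_insert (by simp), ht i] at h1
  omega

/-- Interpolation by polynomials of total degree less than `r` at the points of the grid in a Kuhn
simplex is well posed. -/
theorem existsUnique_localInterpolant {r : ℕ} (hr : 2 ≤ r) (k : ℕ) (a : Fin d → Fin (2 ^ k))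
    (σ : Equiv.Perm (Fin d)) (f : EuclideanSpace ℝ (Fin d) → ℝ) :
    ∃! P, IsLocalInterpolant r k a σ f P := by
  classical
  have hfin : (interpGrid d r k ∩ kuhnSimplex k a σ).Finite :=
    (interpGrid_finite d r k).inter_of_left _
  have : Fintype ↥(interpGrid d r k ∩ kuhnSimplex k a σ) := hfin.fintype
  set S := interpGrid d r k ∩ kuhnSimplex k a σ with hS
  let V := restrictTotalDegree (Fin d) ℝ (r - 1)
  have hV : ∀ P : MvPolynomial (Fin d) ℝ, P ∈ V ↔ P.totalDegree < r := by
    intro P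
    rw [mem_restrictTotalDegree]
    omega
  let ev : V →ₗ[ℝ] (S → ℝ) :=
    { toFun := fun P x => eval (fun i => x.1 i) P.1
      map_add' := by intro P Q; ext x; simp
      map_smul' := by intro c P; ext x; simp [smul_eval] }
  have hsurj : Function.Surjective ev := by
    intro g
    choose φ h1 h2 h3 using fun x : S => exists_localBasis hr x.2
    refine ⟨∑ x : S, g x • ⟨φ x, (hV _).2 (h1 x)⟩, ?_⟩
    ext y
    rw [map_sum, Finset.sum_apply, Finset.sum_eq_single y]
    · simp [ev, h2, smul_eval]
    · intro x _ hxy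
      have : eval (fun i => y.1 i) (φ x) = 0 :=
        h3 x y.1 y.2 fun h => hxy (Subtype.ext h.symm)
      simp [ev, this, smul_eval]
    · simp
  let I : Set (Fin d →₀ ℕ) := {n | (n.sum fun _ e => e) ≤ r - 1}
  have hIinj : Function.Injective (fun n : I => (⟨gridPoint r k a σ n.1,
      gridPoint_mem hr k a σ n.1 (by
        have := n.2
        simpa [I, Finsupp.sum_fintype] using this)⟩ : S)) := by
    intro n n' h
    have := gridPoint_injective hr k a σ (congrArg Subtype.val h)
    exact Subtype.ext (DFunLike.coe_injective this)
  have : Finite I := Finite.of_injective _ hIinj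
  have : Fintype I := Fintype.ofFinite I
  have hb : Module.Basis I ℝ V := basisRestrictSupport ℝ I
  have : Module.Finite ℝ V := Module.Finite.of_basis hb
  have hcard : Module.finrank ℝ V = Module.finrank ℝ (S → ℝ) := by
    apply le_antisymm
    · rw [Module.finrank_eq_card_basis hb, Module.finrank_fintype_fun_eq_card]
      exact Fintype.card_le_of_injective _ hIinj
    · exact LinearMap.finrank_le_finrank_of_surjective hsurj
  have hinj : Function.Injective ev :=
    (LinearMap.injective_iff_surjective_of_finrank_eq_finrank hcard).2 hsurj
  obtain ⟨P, hP⟩ := hsurj fun x => f x.1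
  refine ⟨P.1, ⟨(hV _).1 P.2, fun x hx => congrFun hP ⟨x, hx⟩⟩, ?_⟩
  rintro Q ⟨hQ1, hQ2⟩
  have : (⟨Q, (hV _).2 hQ1⟩ : V) = P := by
    apply hinj
    rw [hP]
    ext x
    exact hQ2 x.1 x.2
  exact congrArg Subtype.val this

end unisolvence

open Classical in
/-- `L_T(f)`: the polynomial of total degree less than `r` that interpolates `f` at the grid points
in the closed simplex `T` (it exists and is unique for `r ≥ 2`). -/
def localInterpolant {d : ℕ} (r k : ℕ) (a : Fin d → Fin (2 ^ k)) (σ : Equiv.Perm (Fin d))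
    (f : EuclideanSpace ℝ (Fin d) → ℝ) : MvPolynomial (Fin d) ℝ :=
  if h : ∃ P, IsLocalInterpolant r k a σ f P then h.choose else 0

open Classical in
/-- `S_{k,r}^*(f)`: the piecewise polynomial that equals `L_T(f)` on every closed simplex `T` of the
Kuhn decompositions of the dyadic cubes of side length `2^{-k}`. At a point that several closed
simplices share one of them is chosen; their polynomials have the same value there. The value
outside the closed unit cube is `0`. -/
def simplicialInterpolant {d : ℕ} (r k : ℕ) (f : EuclideanSpace ℝ (Fin d) → ℝ)
    (x : EuclideanSpace ℝ (Fin d)) : ℝ :=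
  if h : ∃ T : (Fin d → Fin (2 ^ k)) × Equiv.Perm (Fin d), x ∈ kuhnSimplex k T.1 T.2 then
    MvPolynomial.eval (fun i => x i) (localInterpolant r k h.choose.1 h.choose.2 f)
  else 0

end

/-! ### Finite differences on integer windows -/

/-! Write `r = N + 1`. The Besov seminorm enters only through the bound `ω_r(f,t)_p ≤ C t^s |f|`
(`exists_modulus_le_besovSeminorm`), which follows from monotonicity and doubling of the modulus,
with `C` independent of `q`.

Sampling: since `f` is only an `L_p` function, it is sampled on a random lattice, namely on all
refinements `u + 2^{-l} ℤ^d` with `u` uniformly distributed in the cube. The expected sum of `|Δ^r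
f|^p` over the points of level `l` is of order at most `2^{ld} ω_r(f, c 2^{-l})^p`, hence
`2^{-l(sp-d)}`. As `s > d/p`, this stays geometrically summable with a weight `ρ^{-lp}`, for a
suitable `ρ < 1` (`exists_lintegral_sampleEnergy_le`).

Local polynomials: a grid function without `r`-th differences is a polynomial of total degree less
than `r` (`exists_mvPolynomial_of_fwdDiff_iter_eq_zero`). Finite-dimensional linear algebra turns
this into a stable statement for small differences (`exists_polyFun_near_of_fwdDiff_small`). A chain
of shrinking cubes sums the errors of all levels: if the differences of level `l` are at most `M
ρ^l` in a cube of side `2^{-j}`, then one polynomial is within `C M ρ^j` of `f` at all lattice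
points of the cube (`exists_polyFun_near_on_lattices`). Hence `f` restricted to almost every lattice
extends to a continuous function `g`, which is a representative of `f`. Moreover each dyadic cube
`a` of level `j` carries a polynomial `P_a` with `|g - P_a| ≤ e_a` and `(∑ e_a²)^{1/2} ≤ C θ^j |f|`,
where `θ = 2^{-(s-d/p)}` (`exists_continuousOn_and_polynomial_approximation`). The condition `p ≤ 2`
permits the passage from a sum of energies to the sum of their powers `2/p`.

Interpolation: the nodal polynomials of a Kuhn simplex vanish on the faces that miss their node, so
the local interpolants agree on overlaps (`eval_localInterpolant_eq`) and the interpolant is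
Lipschitz. On a cube of level `j` its distance to `P_a` is at most `Λ e_a`, and that of the
gradients at most `Λ 2^j e_a`. Comparing two consecutive interpolants with the same `P_a`, the `L_2`
norm of the increment of the gradients is at most a constant times `λ^j |f|`, where `λ = 2 ·
2^{-d/2} θ = 2^{-(s-1-d/p+d/2)} < 1`. So the gradients converge in `L_2`. The interpolants converge
to `g`, hence the limit is the weak gradient of `g`, and the tail of the geometric series is the
claimed error (`exists_h1Norm_sub_simplicialInterpolant_le`). -/

lemma fwdDiff_iter_line {M : Type*} [AddCommMonoid M] (r : ℕ) (F : M → ℝ) (n h : M) (i : ℕ) :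
    (fwdDiff (1 : ℕ))^[r] (fun t : ℕ => F (n + t • h)) i = (fwdDiff h)^[r] F (n + i • h) := by
  rw [fwdDiff_iter_eq_sum_shift, fwdDiff_iter_eq_sum_shift]
  refine Finset.sum_congr rfl fun k _ => ?_
  simp only [smul_eq_mul, mul_one, add_smul, add_assoc]

/-- The value at `i + r` has coefficient one in the `r`-th difference at `i`, so a vanishing
difference determines it from the `r` preceding values. -/
lemma eq_zero_of_fwdDiff_iter_eq_zero {r m : ℕ} {q : ℕ → ℝ} (h0 : ∀ n < r, q n = 0)
    (hd : ∀ i, i + r < m → (fwdDiff 1)^[r] q i = 0) : ∀ n < m, q n = 0 := by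
  intro n
  induction n using Nat.strong_induction_on with
  | _ n ih =>
    intro hn
    by_cases hnr : n < r
    · exact h0 n hnr
    obtain ⟨i, rfl⟩ : ∃ i, n = i + r := ⟨n - r, by omega⟩
    have h1 := hd i hn
    rw [fwdDiff_iter_eq_sum_shift, Finset.sum_range_succ, Finset.sum_eq_zero] at h1
    · simpa using h1
    · intro k hk
      have := Finset.mem_range.1 hk
      rw [ih _ (by simp; omega) (by simp; omega), smul_zero]

lemma fwdDiff_iter_nat_eval_eq_zero {r : ℕ} {R : Polynomial ℝ} (hR : R.natDegree < r) (i : ℕ) :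
    (fwdDiff 1)^[r] (fun t : ℕ => R.eval (t : ℝ)) i = 0 := by
  have := congrFun (Polynomial.fwdDiff_iter_eq_zero_of_degree_lt hR) (i : ℝ)
  rw [fwdDiff_iter_eq_sum_shift] at this ⊢
  simpa using this

lemma fwdDiff_iter_sub {M : Type*} [AddCommMonoid M] (r : ℕ) (F G : M → ℝ) (h n : M) :
    (fwdDiff h)^[r] (fun x => F x - G x) n = (fwdDiff h)^[r] F n - (fwdDiff h)^[r] G n := by
  simp only [fwdDiff_iter_eq_sum_shift, smul_sub, Finset.sum_sub_distrib]

/-- Interpolation at the first `r` integers gives the polynomial; the remainder vanishes there and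
has no `r`-th differences, so it vanishes on the whole window. -/
lemma exists_polynomial_of_fwdDiff_iter_eq_zero {r m : ℕ} (hr : 0 < r) {q : ℕ → ℝ}
    (hd : ∀ i, i + r < m → (fwdDiff 1)^[r] q i = 0) :
    ∃ R : Polynomial ℝ, R.natDegree < r ∧ ∀ n < m, q n = R.eval (n : ℝ) := by
  have hinj : Set.InjOn (fun k : ℕ => (k : ℝ)) (Finset.range r : Set ℕ) :=
    fun _ _ _ _ h => Nat.cast_injective h
  set R := Lagrange.interpolate (Finset.range r) (fun k : ℕ => (k : ℝ)) q
  have hdeg : R.natDegree < r := by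
    have := Lagrange.degree_interpolate_lt (r := q) hinj
    rw [Finset.card_range] at this
    by_cases h0 : R = 0
    · rw [h0]; simpa using hr
    · exact (Polynomial.natDegree_lt_iff_degree_lt h0).2 this
  refine ⟨R, hdeg, fun n hn => sub_eq_zero.1 ?_⟩
  refine eq_zero_of_fwdDiff_iter_eq_zero (r := r) (m := m) (q := fun n => q n - R.eval (n : ℝ))
    (fun k hk => ?_) (fun i hi => ?_) n hn
  · have := Lagrange.eval_interpolate_at_node q hinj (Finset.mem_range.2 hk)
    exact sub_eq_zero.2 this.symm
  · rw [fwdDiff_iter_sub, hd i hi, fwdDiff_iter_nat_eval_eq_zero hdeg, sub_zero]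

/-! ### Functions on a grid without differences of order `r` -/

section kernel
open MvPolynomial
variable {d : ℕ}

/-- Tensor products of Lagrange polynomials. Only the degree in each variable is below `r`; the
total degree is reduced later by looking along rays. -/
lemma exists_tensor_interpolant {r : ℕ} (hr : 0 < r) (F : (Fin d → ℕ) → ℝ) :
    ∃ P : MvPolynomial (Fin d) ℝ, (∀ c, P.degreeOf c < r) ∧
      ∀ n : Fin d → ℕ, (∀ c, n c < r) → eval (fun c => (n c : ℝ)) P = F n := by
  classical
  let L : (Fin d → ℕ) → MvPolynomial (Fin d) ℝ := fun n =>
    ∏ c, ∏ k ∈ (Finset.range r).erase (n c), (X c - C (k : ℝ))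
  have hLn : ∀ n, eval (fun c => (n c : ℝ)) (L n) ≠ 0 := by
    intro n
    simp only [L, map_prod, map_sub, eval_X, eval_C]
    refine Finset.prod_ne_zero_iff.2 fun c _ => Finset.prod_ne_zero_iff.2 fun k hk => ?_
    rw [sub_ne_zero]
    exact_mod_cast (Finset.ne_of_mem_erase hk).symm
  have hL0 : ∀ n n' : Fin d → ℕ, (∀ c, n' c < r) → n' ≠ n →
      eval (fun c => (n' c : ℝ)) (L n) = 0 := by
    intro n n' h hne
    obtain ⟨c, hc⟩ := Function.ne_iff.1 hne
    simp only [L, map_prod, map_sub, eval_X, eval_C]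
    refine Finset.prod_eq_zero (Finset.mem_univ c) (Finset.prod_eq_zero
      (Finset.mem_erase.2 ⟨hc, Finset.mem_range.2 (h c)⟩) (sub_self _))
  have hdeg : ∀ n, (∀ c, n c < r) → ∀ c, (L n).degreeOf c ≤ r - 1 := by
    intro n hn c
    refine (degreeOf_prod_le _ _ _).trans ?_
    rw [Finset.sum_eq_single c]
    · refine (degreeOf_prod_le _ _ _).trans ?_
      refine (Finset.sum_le_card_nsmul _ _ 1 fun k _ => ?_).trans ?_
      · refine (degreeOf_sub_le _ _ _).trans ?_
        rw [degreeOf_X_self, degreeOf_C]; simp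
      · rw [Finset.card_erase_of_mem (Finset.mem_range.2 (hn c))]; simp
    · intro b _ hb
      refine Nat.le_zero.1 ((degreeOf_prod_le _ _ _).trans ?_)
      refine (Finset.sum_le_card_nsmul _ _ 0 fun k _ => ?_).trans (by simp)
      refine (degreeOf_sub_le _ _ _).trans ?_
      rw [degreeOf_X_of_ne hb.symm, degreeOf_C]; simp
    · simp
  refine ⟨∑ n ∈ Fintype.piFinset fun _ : Fin d => Finset.range r,
    C (F n / eval (fun c => (n c : ℝ)) (L n)) * L n, ?_, ?_⟩
  · intro c
    have : ∀ n ∈ (Fintype.piFinset fun _ : Fin d => Finset.range r),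
        (C (F n / eval (fun c => (n c : ℝ)) (L n)) * L n).degreeOf c ≤ r - 1 := by
      intro n hn
      refine (degreeOf_C_mul_le _ _ _).trans (hdeg n (fun c => ?_) c)
      exact Finset.mem_range.1 (Fintype.mem_piFinset.1 hn c)
    have := (degreeOf_sum_le c (Fintype.piFinset fun _ : Fin d => Finset.range r)
      fun n => C (F n / eval (fun c => (n c : ℝ)) (L n)) * L n).trans (Finset.sup_le this)
    omega
  · intro n hn
    rw [map_sum, Finset.sum_eq_single n]
    · rw [map_mul, eval_C, div_mul_cancel₀ _ (hLn n)]
    · intro b _ hb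
      rw [map_mul, hL0 b n hn hb.symm, mul_zero]
    · intro h
      exact absurd (Fintype.mem_piFinset.2 fun c => Finset.mem_range.2 (hn c)) h

lemma exists_polynomial_along_coord {r : ℕ} (hr : 0 < r) (P : MvPolynomial (Fin d) ℝ) (a : Fin d)
    (hP : P.degreeOf a < r) (x : Fin d → ℝ) :
    ∃ R : Polynomial ℝ, R.natDegree < r ∧ ∀ t, R.eval t = eval (Function.update x a t) P := by
  refine ⟨∑ s ∈ P.support, Polynomial.C (coeff s P * ∏ c ∈ Finset.univ.erase a, x c ^ s c) *
    Polynomial.X ^ s a, ?_, ?_⟩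
  · have : (∑ s ∈ P.support, Polynomial.C (coeff s P * ∏ c ∈ Finset.univ.erase a, x c ^ s c) *
        Polynomial.X ^ s a).natDegree ≤ r - 1 := by
      refine Polynomial.natDegree_sum_le_of_forall_le _ _ fun s hs => ?_
      refine (Polynomial.natDegree_C_mul_X_pow_le _ _).trans ?_
      have := (degreeOf_le_iff (n := a) (f := P) (d := P.degreeOf a)).1 le_rfl s hs
      omega
    omega
  · intro t
    rw [eval_eq', Polynomial.eval_finsetSum]
    refine Finset.sum_congr rfl fun s _ => ?_
    rw [← Finset.mul_prod_erase _ _ (Finset.mem_univ a)]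
    have : ∏ c ∈ Finset.univ.erase a, Function.update x a t c ^ s c =
        ∏ c ∈ Finset.univ.erase a, x c ^ s c := Finset.prod_congr rfl fun c hc => by
      rw [Function.update_of_ne (Finset.ne_of_mem_erase hc)]
    rw [this, Function.update_self, Polynomial.eval_mul, Polynomial.eval_C, Polynomial.eval_pow,
      Polynomial.eval_X]
    ring

/-- On a ray through the origin the homogeneous components are the coefficients of a univariate
polynomial, so a degree bound along rays is a bound on the total degree. -/
lemma eval_smul_eq_sum_homogeneousComponent (P : MvPolynomial (Fin d) ℝ) (t : ℝ)
    (x : Fin d → ℝ) :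
    eval (fun c => t * x c) P =
      ∑ k ∈ Finset.range (P.totalDegree + 1), eval x (homogeneousComponent k P) * t ^ k := by
  conv_lhs => rw [← sum_homogeneousComponent P]
  rw [map_sum]
  refine Finset.sum_congr rfl fun k _ => ?_
  have h := homogeneousComponent_isHomogeneous k P
  rw [eval_eq', eval_eq', Finset.sum_mul]
  refine Finset.sum_congr rfl fun s hs => ?_
  have hs' : ∑ c, s c = k := by
    have := h (mem_support_iff.1 hs)
    rw [Finsupp.weight_apply, Finsupp.sum_fintype _ _ (by simp)] at this
    simpa using this
  simp only [mul_pow, Finset.prod_mul_distrib, Finset.prod_pow_eq_pow_sum, hs']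
  ring

/-- A function on a large window of `ℕ^d` whose `r`-th differences vanish in all directions is a
polynomial of total degree less than `r`. -/
theorem exists_mvPolynomial_of_fwdDiff_iter_eq_zero {r m : ℕ} (hr : 0 < r)
    (hm : r * (d * r + r + 1) ≤ m) {F : (Fin d → ℕ) → ℝ}
    (hF : ∀ n h : Fin d → ℕ, (∀ c, n c + r * h c < m) → (fwdDiff h)^[r] F n = 0) :
    ∃ P : MvPolynomial (Fin d) ℝ, P.totalDegree < r ∧
      ∀ n : Fin d → ℕ, (∀ c, n c < m) → F n = eval (fun c => (n c : ℝ)) P := by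
  classical
  obtain ⟨P, hPdeg, hP⟩ := exists_tensor_interpolant hr F
  have hrm : r ≤ m := le_trans (Nat.le_mul_of_pos_right r (by omega)) hm
  -- The identity is extended from the box of side `r` to the window one coordinate at a time. On a
  -- line in the new direction, `F - P` has no `r`-th differences and vanishes at the first `r`
  -- points.
  have hA : ∀ A : Finset (Fin d), ∀ n : Fin d → ℕ, (∀ c, n c < m) → (∀ c, c ∉ A → n c < r) →
      F n = eval (fun c => (n c : ℝ)) P := by
    intro A
    induction A using Finset.induction_on with
    | empty => intro n _ h; exact (hP n fun c => h c (by simp)).symm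
    | insert a A ha ih =>
      intro n hn hnr
      obtain ⟨R, hR, hRe⟩ := exists_polynomial_along_coord hr P a (hPdeg a) (fun c => (n c : ℝ))
      have hcast : ∀ t : ℕ, (fun c => ((Function.update n a t c : ℕ) : ℝ)) =
          Function.update (fun c => (n c : ℝ)) a (t : ℝ) := by
        intro t; ext c
        by_cases hc : c = a
        · subst hc; simp
        · simp [hc]
      have hline : ∀ t : ℕ, Function.update n a 0 + t • Pi.single a 1 = Function.update n a t := by
        intro t; ext c
        by_cases hc : c = a
        · subst hc; simp
        · simp [hc]
      have key := eq_zero_of_fwdDiff_iter_eq_zero (r := r) (m := m)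
        (q := fun t => F (Function.update n a t) - R.eval (t : ℝ)) (fun t ht => ?_)
        (fun i hi => ?_) (n a) (hn a)
      · rw [hRe, ← hcast, Function.update_eq_self, sub_eq_zero] at key
        exact key
      · rw [hRe, ← hcast, sub_eq_zero]
        refine ih _ (fun c => ?_) (fun c hc => ?_)
        · by_cases hca : c = a
          · subst hca; simp; omega
          · simp [hca, hn c]
        · by_cases hca : c = a
          · subst hca; simpa using ht
          · rw [Function.update_of_ne hca]
            exact hnr c (by simp [hca, hc])
      · rw [fwdDiff_iter_sub, fwdDiff_iter_nat_eval_eq_zero hR, sub_zero]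
        have := fwdDiff_iter_line r F (Function.update n a 0) (Pi.single a 1) i
        simp only [hline] at this
        rw [this]
        refine hF _ _ fun c => ?_
        by_cases hca : c = a
        · subst hca; simpa using hi
        · simp [hca, hn c]
  have hall : ∀ n : Fin d → ℕ, (∀ c, n c < m) → F n = eval (fun c => (n c : ℝ)) P :=
    fun n hn => hA Finset.univ n hn (by simp)
  refine ⟨P, ?_, hall⟩
  have htd : P.totalDegree ≤ d * r := by
    refine Finset.sup_le fun s hs => ?_
    have h1 : ∀ c ∈ Finset.univ, s c ≤ r := fun c _ =>
      ((degreeOf_le_iff (n := c) (f := P) (d := P.degreeOf c)).1 le_rfl s hs).trans (hPdeg c).le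
    rw [Finsupp.sum_fintype _ _ (by simp)]
    simpa using Finset.sum_le_card_nsmul _ _ _ h1
  -- A component of degree `k ≥ r` has degree below `r` in each variable, so it suffices that it
  -- vanishes at the integer points `h` with entries below `r`. Its value at `h` is the coefficient
  -- of `t^k` in `P(t h)`, and along this ray `F` is a polynomial in `t` of degree below `r`.
  have hhom : ∀ k, r ≤ k → homogeneousComponent k P = 0 := by
    intro k hk
    by_cases hkd : P.totalDegree < k
    · exact homogeneousComponent_eq_zero _ _ hkd
    refine eq_zero_of_eval_zero_at_prod_finset _
      (fun _ => (Finset.range r).image fun k : ℕ => (k : ℝ)) (fun c => ?_) (fun x hx => ?_)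
    · rw [Finset.card_image_of_injective _ Nat.cast_injective, Finset.card_range]
      refine lt_of_le_of_lt ?_ (hPdeg c)
      rw [degreeOf_le_iff]
      intro s hs
      refine (degreeOf_le_iff (n := c) (f := P) (d := P.degreeOf c)).1 le_rfl s ?_
      rw [mem_support_iff] at hs ⊢
      rw [coeff_homogeneousComponent] at hs
      intro h0; apply hs; simp [h0]
    · choose h hh using fun c => Finset.mem_image.1 (hx c)
      have hhr : ∀ c, h c < r := fun c => Finset.mem_range.1 (hh c).1
      have hxh : x = fun c => (h c : ℝ) := by ext c; exact (hh c).2.symm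
      -- The size of the window is dictated here: it contains `t h` for `t ≤ d r + r`, which are
      -- more points than needed to identify two univariate polynomials of degrees at most `d r` and
      -- below `r`.
      obtain ⟨R, hR, hRe⟩ := exists_polynomial_of_fwdDiff_iter_eq_zero (m := d * r + r + 1) hr
        (q := fun t : ℕ => F (0 + t • h)) (fun i hi => by
          rw [fwdDiff_iter_line]
          refine hF _ _ fun c => ?_
          have h1 := hhr c
          have h2 : i * h c + r * h c ≤ (i + r) * r := by
            rw [← add_mul]; exact Nat.mul_le_mul_left _ h1.le
          have h3 : (i + r) * r < r * (d * r + r + 1) := by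
            rw [mul_comm]; exact Nat.mul_lt_mul_of_pos_left hi hr
          simp; omega)
      let R' : Polynomial ℝ := ∑ k ∈ Finset.range (P.totalDegree + 1),
        Polynomial.C (eval x (homogeneousComponent k P)) * Polynomial.X ^ k
      have hR'e : ∀ t, R'.eval t = eval (fun c => t * x c) P := by
        intro t
        rw [eval_smul_eq_sum_homogeneousComponent, Polynomial.eval_finsetSum]
        simp
      have hR'd : R'.natDegree ≤ d * r := by
        refine Polynomial.natDegree_sum_le_of_forall_le _ _ fun k hk => ?_
        refine (Polynomial.natDegree_C_mul_X_pow_le _ _).trans ?_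
        have := Finset.mem_range.1 hk
        omega
      have hRR : R' = R := by
        refine Polynomial.eq_of_natDegree_lt_card_of_eval_eq' _ _
          ((Finset.range (d * r + r + 1)).image fun k : ℕ => (k : ℝ)) ?_ ?_
        · intro y hy
          obtain ⟨t, ht, rfl⟩ := Finset.mem_image.1 hy
          rw [← hRe t (Finset.mem_range.1 ht), hR'e, hall]
          · simp [hxh]
          · intro c
            have h1 := hhr c
            have h2 : t * h c ≤ t * r := Nat.mul_le_mul_left _ h1.le
            have h3 : t * r < r * (d * r + r + 1) := by
              rw [mul_comm]; exact Nat.mul_lt_mul_of_pos_left (Finset.mem_range.1 ht) hr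
            simp; omega
        · rw [Finset.card_image_of_injective _ Nat.cast_injective, Finset.card_range]
          exact max_lt (by omega) (by omega)
      have hco : R'.coeff k = eval x (homogeneousComponent k P) := by
        simp only [R', Polynomial.finsetSum_coeff, Polynomial.coeff_C_mul_X_pow]
        rw [Finset.sum_ite_eq, if_pos (Finset.mem_range.2 (by omega))]
      rw [← hco, hRR]
      exact Polynomial.coeff_eq_zero_of_natDegree_lt (by omega)
  by_contra hlt
  have hne : P ≠ 0 := by
    rintro rfl; simp at hlt; omega
  have h0 := hhom P.totalDegree (not_lt.1 hlt)
  obtain ⟨s, hs, hsd⟩ := Finset.exists_mem_eq_sup P.support (support_nonempty.2 hne)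
    (fun s => s.sum fun _ e => e)
  have : coeff s (homogeneousComponent P.totalDegree P) = coeff s P := by
    rw [coeff_homogeneousComponent, if_pos]
    rw [totalDegree, hsd, Finsupp.degree_eq_sum, Finsupp.sum_fintype _ _ (by simp)]
  rw [h0, coeff_zero] at this
  exact mem_support_iff.1 hs this.symm

end kernel

/-! ### Polynomial functions of bounded degree on Euclidean space -/

section polyFun
open MvPolynomial
variable {d : ℕ}

/-- The space of polynomial functions of total degree at most `N`. -/
def polyFun (d N : ℕ) : Submodule ℝ (EuclideanSpace ℝ (Fin d) → ℝ) where
  carrier := {F | ∃ P : MvPolynomial (Fin d) ℝ, P.totalDegree ≤ N ∧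
    ∀ x, F x = eval (fun i => x i) P}
  add_mem' := by
    rintro F G ⟨P, hP, hF⟩ ⟨Q, hQ, hG⟩
    exact ⟨P + Q, (totalDegree_add _ _).trans (max_le hP hQ), fun x => by simp [hF, hG]⟩
  zero_mem' := ⟨0, by simp, by simp⟩
  smul_mem' := by
    rintro c F ⟨P, hP, hF⟩
    exact ⟨c • P, (totalDegree_smul_le _ _).trans hP, fun x => by simp [hF, smul_eval]⟩

lemma eval_mem_polyFun {N : ℕ} {P : MvPolynomial (Fin d) ℝ} (hP : P.totalDegree ≤ N) :
    (fun x : EuclideanSpace ℝ (Fin d) => eval (fun i => x i) P) ∈ polyFun d N :=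
  ⟨P, hP, fun _ => rfl⟩

lemma contDiff_of_mem_polyFun {N : ℕ} {F : EuclideanSpace ℝ (Fin d) → ℝ}
    (hF : F ∈ polyFun d N) : ContDiff ℝ ∞ F := by
  obtain ⟨P, -, hP⟩ := hF
  rw [funext hP]
  have h := AnalyticOnNhd.eval_continuousLinearMap' (𝕜 := ℝ)
    (fun i : Fin d => (EuclideanSpace.proj i : EuclideanSpace ℝ (Fin d) →L[ℝ] ℝ)) P
  exact contDiffOn_univ.1 (h.contDiffOn uniqueDiffOn_univ)

lemma comp_affine_mem_polyFun {N : ℕ} {F : EuclideanSpace ℝ (Fin d) → ℝ}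
    (hF : F ∈ polyFun d N) (b : EuclideanSpace ℝ (Fin d)) (δ : ℝ) :
    (fun x => F (b + δ • x)) ∈ polyFun d N := by
  obtain ⟨P, hPN, hP⟩ := hF
  refine ⟨∑ s ∈ P.support, C (coeff s P) * ∏ c, (C (b c) + C δ * X c) ^ s c, ?_, fun x => ?_⟩
  · refine (totalDegree_finsetSum _ _).trans (Finset.sup_le fun s hs => ?_)
    refine (totalDegree_mul _ _).trans ?_
    rw [totalDegree_C, zero_add]
    refine (totalDegree_finsetProd _ _).trans (le_trans ?_ ((le_totalDegree hs).trans hPN))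
    rw [Finsupp.sum_fintype _ _ (by simp)]
    refine Finset.sum_le_sum fun c _ => (totalDegree_pow _ _).trans ?_
    have : (C (b c) + C δ * X c : MvPolynomial (Fin d) ℝ).totalDegree ≤ 1 := by
      refine (totalDegree_add _ _).trans (max_le (by simp) ?_)
      exact (totalDegree_mul _ _).trans (by rw [totalDegree_C, totalDegree_X])
    exact (Nat.mul_le_mul_left _ this).trans (by simp)
  · dsimp only
    rw [hP, map_sum, eval_eq']
    refine Finset.sum_congr rfl fun s _ => ?_
    simp [map_prod]

/-- Polynomial functions are controlled on compact sets, together with their derivatives, by their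
values on a finite unisolvent set. -/
lemma exists_bound_of_unisolvent {N : ℕ} {S : Set (EuclideanSpace ℝ (Fin d))} (hfin : S.Finite)
    (hS : ∀ F ∈ polyFun d N, (∀ s ∈ S, F s = 0) → F = 0)
    {K : Set (EuclideanSpace ℝ (Fin d))} (hK : IsCompact K) :
    ∃ C : ℝ, 0 ≤ C ∧ ∀ F ∈ polyFun d N, ∀ e : ℝ, 0 ≤ e → (∀ s ∈ S, |F s| ≤ e) → ∀ x ∈ K,
      |F x| ≤ C * e ∧ ‖fderiv ℝ F x‖ ≤ C * e := by
  classical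
  have : Fintype S := hfin.fintype
  let ev : polyFun d N →ₗ[ℝ] (S → ℝ) :=
    { toFun := fun F s => F.1 s.1
      map_add' := fun _ _ => rfl
      map_smul' := fun _ _ => rfl }
  have hinj : LinearMap.ker ev = ⊥ := by
    rw [LinearMap.ker_eq_bot']
    intro F hF
    exact Subtype.ext (hS F.1 F.2 fun s hs => congrFun hF ⟨s, hs⟩)
  -- A left inverse of the evaluation map yields polynomials `B s` with `F = ∑ F(s) B s` for all `F`
  -- of the space. The constant is the sum of bounds for the `B s` and their derivatives on `K`.
  obtain ⟨g, hg⟩ := ev.exists_leftInverse_of_injective hinj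
  let B : S → EuclideanSpace ℝ (Fin d) → ℝ := fun s => (g (Pi.single s 1)).1
  have hB : ∀ s, ContDiff ℝ ∞ (B s) := fun s => contDiff_of_mem_polyFun (g (Pi.single s 1)).2
  have hrep : ∀ F ∈ polyFun d N, F = fun x => ∑ s : S, F s.1 * B s x := by
    intro F hF
    have h1 : g (ev ⟨F, hF⟩) = ⟨F, hF⟩ := LinearMap.congr_fun hg ⟨F, hF⟩
    have h2 : ev ⟨F, hF⟩ = ∑ s : S, F s.1 • Pi.single s (1 : ℝ) := by
      ext t
      simp [ev, Finset.sum_apply, Pi.single_apply]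
    rw [h2, map_sum] at h1
    have h3 := congrArg Subtype.val h1
    funext x
    have h4 := congrFun h3 x
    dsimp only at h4
    rw [← h4]
    simp [B, Finset.sum_apply]
  have hb : ∀ s : S, ∃ c : ℝ, 0 ≤ c ∧ ∀ x ∈ K, |B s x| ≤ c ∧ ‖fderiv ℝ (B s) x‖ ≤ c := by
    intro s
    obtain ⟨c1, h1⟩ := hK.exists_bound_of_continuousOn (hB s).continuous.continuousOn
    obtain ⟨c2, h2⟩ := hK.exists_bound_of_continuousOn
      ((hB s).continuous_fderiv (by simp)).continuousOn
    exact ⟨max 0 (max c1 c2), le_max_left _ _, fun x hx =>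
      ⟨(h1 x hx).trans ((le_max_left _ _).trans (le_max_right _ _)),
        (h2 x hx).trans ((le_max_right _ _).trans (le_max_right _ _))⟩⟩
  choose c hc0 hc using hb
  refine ⟨∑ s, c s, Finset.sum_nonneg fun s _ => hc0 s, fun F hF e he hFe x hx => ⟨?_, ?_⟩⟩
  · rw [congrFun (hrep F hF) x, Finset.sum_mul]
    refine (Finset.abs_sum_le_sum_abs _ _).trans (Finset.sum_le_sum fun s _ => ?_)
    rw [abs_mul, mul_comm]
    exact mul_le_mul (hc s x hx).1 (hFe s.1 s.2) (abs_nonneg _) (hc0 s)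
  · have hd : HasFDerivAt F (∑ s : S, F s.1 • fderiv ℝ (B s) x) x := by
      conv => arg 1; rw [hrep F hF]
      refine HasFDerivAt.fun_sum fun s _ => ?_
      exact (((hB s).differentiable (by simp)).differentiableAt.hasFDerivAt).const_mul _
    rw [hd.fderiv, Finset.sum_mul]
    refine (norm_sum_le _ _).trans (Finset.sum_le_sum fun s _ => ?_)
    rw [norm_smul, mul_comm]
    exact mul_le_mul (hc s x hx).2 (hFe s.1 s.2) (norm_nonneg _) (hc0 s)

/-- The point `b + δ n` of a lattice with integer coordinates `n`. -/
def latticePoint (b : EuclideanSpace ℝ (Fin d)) (δ : ℝ) (n : Fin d → ℤ) :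
    EuclideanSpace ℝ (Fin d) :=
  b + δ • WithLp.toLp 2 (fun c => (n c : ℝ))

@[simp] lemma latticePoint_apply (b : EuclideanSpace ℝ (Fin d)) (δ : ℝ) (n : Fin d → ℤ)
    (c : Fin d) : latticePoint b δ n c = b c + δ * n c := rfl

lemma latticePoint_add (b : EuclideanSpace ℝ (Fin d)) (δ : ℝ) (n m : Fin d → ℤ) :
    latticePoint (latticePoint b δ n) δ m = latticePoint b δ (n + m) := by
  ext c; simp; ring

lemma latticeCube_finite (m : ℕ) :
    {x : EuclideanSpace ℝ (Fin d) | ∃ n : Fin d → ℕ, (∀ c, n c < m) ∧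
      x = latticePoint 0 1 (fun c => (n c : ℤ))}.Finite := by
  have : (Set.range fun n : Fin d → Fin m =>
      (latticePoint 0 1 (fun c => ((n c : ℕ) : ℤ)) : EuclideanSpace ℝ (Fin d))).Finite :=
    Set.finite_range _
  refine this.subset ?_
  rintro x ⟨n, hn, rfl⟩
  exact ⟨fun c => ⟨n c, hn c⟩, rfl⟩

/-- A tensor grid with more points per direction than the degree in each variable determines a
polynomial; the total degree bounds these degrees. -/
lemma eq_zero_of_latticeCube {N : ℕ} {F : EuclideanSpace ℝ (Fin d) → ℝ} (hF : F ∈ polyFun d N)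
    (h : ∀ n : Fin d → ℕ, (∀ c, n c < N + 1) → F (latticePoint 0 1 (fun c => (n c : ℤ))) = 0) :
    F = 0 := by
  classical
  obtain ⟨P, hP, hFP⟩ := hF
  have : P = 0 := by
    refine eq_zero_of_eval_zero_at_prod_finset P
      (fun _ => (Finset.range (N + 1)).image fun k : ℕ => (k : ℝ)) (fun c => ?_) (fun x hx => ?_)
    · rw [Finset.card_image_of_injective _ Nat.cast_injective, Finset.card_range]
      exact Nat.lt_succ_of_le ((degreeOf_le_totalDegree P c).trans hP)
    · choose n hn using fun c => Finset.mem_image.1 (hx c)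
      have := h n fun c => Finset.mem_range.1 (hn c).1
      rw [hFP] at this
      rw [← this, ← funext fun c => (hn c).2]
      simp
  funext x
  simp [hFP, this]

/-- Values of a polynomial on a lattice cube with at least `N + 1` points in each direction control
it on neighbouring cubes. -/
lemma exists_latticeCube_bound (d N : ℕ) (κ : ℝ) :
    ∃ C : ℝ, 0 ≤ C ∧ ∀ F ∈ polyFun d N, ∀ (b : EuclideanSpace ℝ (Fin d)) (δ : ℝ), 0 < δ →
      ∀ e : ℝ, 0 ≤ e →
      (∀ n : Fin d → ℕ, (∀ c, n c < N + 1) → |F (latticePoint b δ (fun c => (n c : ℤ)))| ≤ e) →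
      ∀ x, (∀ c, |x c - b c| ≤ κ * δ) → |F x| ≤ C * e := by
  have hK : IsCompact {x : EuclideanSpace ℝ (Fin d) | ∀ c, |x c| ≤ κ} := by
    refine Metric.isCompact_of_isClosed_isBounded ?_ ?_
    · simp only [Set.ofPred_forall]
      exact isClosed_iInter fun c => isClosed_le (by fun_prop) continuous_const
    · refine (Metric.isBounded_iff_subset_closedBall 0).2 ⟨√(∑ _c : Fin d, κ ^ 2), fun x hx => ?_⟩
      rw [mem_closedBall_zero_iff, EuclideanSpace.norm_eq]
      refine Real.sqrt_le_sqrt (Finset.sum_le_sum fun c _ => ?_)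
      exact pow_le_pow_left₀ (norm_nonneg _) (hx c) 2
  obtain ⟨C, hC0, hC⟩ := exists_bound_of_unisolvent (d := d) (N := N) (latticeCube_finite (N + 1))
    (fun F hF h => eq_zero_of_latticeCube hF fun n hn => h _ ⟨n, hn, rfl⟩) hK
  refine ⟨C, hC0, fun F hF b δ hδ e he h x hx => ?_⟩
  -- The affine map to `b = 0`, `δ = 1` preserves the polynomial space, so the constant depends
  -- neither on the position nor on the scale.
  have hx' : x = b + δ • (δ⁻¹ • (x - b)) := by
    rw [smul_smul, mul_inv_cancel₀ hδ.ne']; simp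
  have := (hC _ (comp_affine_mem_polyFun hF b δ) e he ?_ (δ⁻¹ • (x - b)) ?_).1
  · rwa [← hx'] at this
  · rintro s ⟨n, hn, rfl⟩
    have := h n hn
    simpa [latticePoint] using this
  · intro c
    simp only [PiLp.smul_apply, PiLp.sub_apply, smul_eq_mul, abs_mul, abs_inv, abs_of_pos hδ]
    rw [inv_mul_le_iff₀ hδ, mul_comm]
    exact hx c

/-- A function on a large lattice cube is close to a polynomial if its differences are small. -/
lemma exists_polyFun_near_of_fwdDiff_small (d N m : ℕ)
    (hm : (N + 1) * (d * (N + 1) + (N + 1) + 1) ≤ m) :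
    ∃ C : ℝ, 0 ≤ C ∧ ∀ (f : EuclideanSpace ℝ (Fin d) → ℝ) (b : EuclideanSpace ℝ (Fin d)) (δ : ℝ),
      0 < δ → ∀ e : ℝ, 0 ≤ e →
      (∀ n h : Fin d → ℕ, (∀ c, n c + (N + 1) * h c < m) →
        |(fwdDiff (δ • WithLp.toLp 2 fun c => (h c : ℝ)))^[N + 1] f
          (latticePoint b δ fun c => (n c : ℤ))| ≤ e) →
      ∃ F ∈ polyFun d N, ∀ n : Fin d → ℕ, (∀ c, n c < m) →
        |f (latticePoint b δ fun c => (n c : ℤ)) - F (latticePoint b δ fun c => (n c : ℤ))| ≤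
          C * e := by
  classical
  have hN : 0 < N + 1 := Nat.succ_pos N
  have hm0 : 0 < m := lt_of_lt_of_le (by positivity) hm
  let J := {w : (Fin d → Fin m) × (Fin d → Fin m) // ∀ c, (w.1 c : ℕ) + (N + 1) * (w.2 c : ℕ) < m}
  -- The value zero outside the window is harmless, because the differences under consideration use
  -- points of the window only.
  let ext : (((Fin d → Fin m)) → ℝ) →ₗ[ℝ] ((Fin d → ℕ) → ℝ) :=
    { toFun := fun q n => if h : ∀ c, n c < m then q fun c => ⟨n c, h c⟩ else 0
      map_add' := by intro p q; funext n; by_cases h : ∀ c, n c < m <;> simp [h]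
      map_smul' := by intro a q; funext n; by_cases h : ∀ c, n c < m <;> simp [h] }
  let T : (((Fin d → Fin m)) → ℝ) →ₗ[ℝ] (J → ℝ) :=
    { toFun := fun q w =>
        (fwdDiff (fun c => ((w.1.2 c : ℕ))))^[N + 1] (ext q) (fun c => ((w.1.1 c : ℕ)))
      map_add' := by intro p q; funext w; simp [map_add, fwdDiff_iter_add]
      map_smul' := by intro a q; funext w; simp [map_smul, fwdDiff_iter_const_smul] }
  -- A linear right inverse of the difference operator on its range is bounded, since all spaces are
  -- finite-dimensional; its norm is the constant. Subtracting `σ (T q)` from `q` removes all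
  -- differences and leaves a polynomial.
  obtain ⟨σ, hσ⟩ := T.rangeRestrict.exists_rightInverse_of_surjective
    (LinearMap.range_eq_top.2 T.surjective_rangeRestrict)
  let σc := LinearMap.toContinuousLinearMap σ
  refine ⟨‖σc‖, by positivity, fun f b δ hδ e he hf => ?_⟩
  let q : (Fin d → Fin m) → ℝ := fun n => f (latticePoint b δ fun c => ((n c : ℕ) : ℤ))
  have hTq : ‖T.rangeRestrict q‖ ≤ e := by
    change ‖(T.rangeRestrict q : J → ℝ)‖ ≤ e
    refine (pi_norm_le_iff_of_nonneg he).2 fun w => ?_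
    have h1 := hf (fun c => (w.1.1 c : ℕ)) (fun c => (w.1.2 c : ℕ)) w.2
    rw [Real.norm_eq_abs]
    convert h1 using 2
    change (fwdDiff (fun c => ((w.1.2 c : ℕ))))^[N + 1] (ext q) (fun c => ((w.1.1 c : ℕ))) = _
    rw [fwdDiff_iter_eq_sum_shift, fwdDiff_iter_eq_sum_shift]
    refine Finset.sum_congr rfl fun k hk => ?_
    have hk' : k ≤ N + 1 := Nat.lt_succ_iff.1 (Finset.mem_range.1 hk)
    have hlt : ∀ c, ((fun c => (w.1.1 c : ℕ)) + k • fun c => (w.1.2 c : ℕ)) c < m := by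
      intro c
      refine lt_of_le_of_lt ?_ (w.2 c)
      simpa using Nat.mul_le_mul_right _ hk'
    simp only [ext, LinearMap.coe_mk, AddHom.coe_mk, dif_pos hlt, q]
    congr 2
    ext c
    simp
    ring
  have hker : T (q - σ (T.rangeRestrict q)) = 0 := by
    have h1 : T.rangeRestrict (σ (T.rangeRestrict q)) = T.rangeRestrict q :=
      LinearMap.congr_fun hσ _
    have h2 := congrArg Subtype.val h1
    rw [map_sub, sub_eq_zero]
    exact h2.symm
  obtain ⟨P, hP, hPe⟩ := exists_mvPolynomial_of_fwdDiff_iter_eq_zero hN hm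
    (F := ext (q - σ (T.rangeRestrict q))) (fun n h hnh => by
      have hn : ∀ c, n c < m := fun c => lt_of_le_of_lt (Nat.le_add_right _ _) (hnh c)
      have hh : ∀ c, h c < m := fun c => by
        have := hnh c
        have : h c ≤ (N + 1) * h c := Nat.le_mul_of_pos_left _ hN
        omega
      exact congrFun hker ⟨(fun c => ⟨n c, hn c⟩, fun c => ⟨h c, hh c⟩), hnh⟩)
  refine ⟨fun x => eval (fun i => (-(δ⁻¹ • b) + δ⁻¹ • x) i) P,
    comp_affine_mem_polyFun (eval_mem_polyFun (Nat.lt_succ_iff.1 hP)) _ _, fun n hn => ?_⟩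
  have h1 := hPe n hn
  have h2 : (fun i => (-(δ⁻¹ • b) + δ⁻¹ • latticePoint b δ fun c => (n c : ℤ)) i) =
      fun c => (n c : ℝ) := by
    ext c
    simp
    field_simp
    ring
  dsimp only
  rw [h2, ← h1]
  simp only [ext, LinearMap.coe_mk, AddHom.coe_mk, dif_pos hn, Pi.sub_apply, q, sub_sub_cancel]
  refine (norm_le_pi_norm (σ (T.rangeRestrict q)) _).trans ?_
  exact (σc.le_opNorm _).trans (mul_le_mul_of_nonneg_left hTq (norm_nonneg _))

end polyFun

/-! ### Polynomial approximation on the union of the dyadic refinements of a lattice -/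

section chain
variable {d : ℕ}

/-- The half-open cube with lower corner `b` and side `ℓ`. -/
def halfOpenCube (b : EuclideanSpace ℝ (Fin d)) (ℓ : ℝ) : Set (EuclideanSpace ℝ (Fin d)) :=
  {x | ∀ c, b c ≤ x c ∧ x c < b c + ℓ}

/-- Differences of order `N + 1` of `f` at the points of the dyadic refinements of the lattice
through `u` that lie in `Q` decay geometrically with the level. -/
def DyadicDiffBound (N m : ℕ) (f : EuclideanSpace ℝ (Fin d) → ℝ) (u : EuclideanSpace ℝ (Fin d))
    (Q : Set (EuclideanSpace ℝ (Fin d))) (j : ℕ) (M ρ : ℝ) : Prop :=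
  ∀ l, j ≤ l → ∀ (n : Fin d → ℤ) (h : Fin d → ℕ), (∀ c, h c < m) →
    latticePoint u ((2⁻¹ : ℝ) ^ l) n ∈ Q →
    latticePoint u ((2⁻¹ : ℝ) ^ l) n +
      ((N + 1 : ℕ) : ℝ) • ((2⁻¹ : ℝ) ^ l • WithLp.toLp 2 fun c => (h c : ℝ)) ∈ Q →
    |(fwdDiff ((2⁻¹ : ℝ) ^ l • WithLp.toLp 2 fun c => (h c : ℝ)))^[N + 1] f
      (latticePoint u ((2⁻¹ : ℝ) ^ l) n)| ≤ M * ρ ^ l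

lemma DyadicDiffBound.mono {N m : ℕ} {f : EuclideanSpace ℝ (Fin d) → ℝ}
    {u : EuclideanSpace ℝ (Fin d)} {Q Q' : Set (EuclideanSpace ℝ (Fin d))} {j j' : ℕ} {M ρ : ℝ}
    (h : DyadicDiffBound N m f u Q j M ρ) (hQ : Q' ⊆ Q) (hj : j ≤ j') :
    DyadicDiffBound N m f u Q' j' M ρ :=
  fun l hl n k hk h1 h2 => h l (hj.trans hl) n k hk (hQ h1) (hQ h2)

/-- The integer coordinates of the first point of the lattice `u + δ ℤ^d` in a half-open cube with
lower corner `b`. -/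
noncomputable def firstIndex (u b : EuclideanSpace ℝ (Fin d)) (δ : ℝ) : Fin d → ℤ := fun c => ⌈(b c - u c) / δ⌉

lemma firstIndex_le {u b : EuclideanSpace ℝ (Fin d)} {δ : ℝ} (hδ : 0 < δ) (c : Fin d) :
    b c ≤ u c + δ * firstIndex u b δ c ∧ u c + δ * firstIndex u b δ c < b c + δ := by
  have h1 : (b c - u c) / δ ≤ firstIndex u b δ c := Int.le_ceil _
  have h2 : (firstIndex u b δ c : ℝ) < (b c - u c) / δ + 1 := Int.ceil_lt_add_one _
  rw [div_le_iff₀ hδ] at h1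
  rw [div_add_one hδ.ne', lt_div_iff₀ hδ] at h2
  constructor <;> nlinarith

/-- Because the cube is half-open, it contains exactly `m` lattice coordinates per direction for
every offset `u`. This lemma and the next one are the two inclusions. -/
lemma latticePoint_firstIndex_add_mem {u b : EuclideanSpace ℝ (Fin d)} {δ : ℝ} (hδ : 0 < δ)
    {m : ℕ} {n : Fin d → ℕ} (hn : ∀ c, n c < m) :
    latticePoint u δ (firstIndex u b δ + fun c => (n c : ℤ)) ∈ halfOpenCube b (m * δ) := by
  intro c
  obtain ⟨h1, h2⟩ := firstIndex_le (u := u) (b := b) hδ c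
  have h3 : (n c : ℝ) + 1 ≤ m := by exact_mod_cast hn c
  simp only [latticePoint_apply, Pi.add_apply, Int.cast_add, Int.cast_natCast]
  constructor
  · have : 0 ≤ δ * n c := by positivity
    linarith
  · nlinarith

lemma exists_eq_firstIndex_add {u b : EuclideanSpace ℝ (Fin d)} {δ : ℝ} (hδ : 0 < δ)
    {m : ℕ} {n : Fin d → ℤ} (hn : latticePoint u δ n ∈ halfOpenCube b (m * δ)) :
    ∃ k : Fin d → ℕ, (∀ c, k c < m) ∧ n = firstIndex u b δ + fun c => (k c : ℤ) := by
  have h : ∀ c, firstIndex u b δ c ≤ n c ∧ n c < firstIndex u b δ c + m := by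
    intro c
    obtain ⟨h1, h2⟩ := hn c
    simp only [latticePoint_apply] at h1 h2
    refine ⟨Int.ceil_le.2 ?_, ?_⟩
    · rw [div_le_iff₀ hδ]; linarith
    · obtain ⟨h3, -⟩ := firstIndex_le (u := u) (b := b) hδ c
      have : δ * n c < δ * (firstIndex u b δ c + m) := by linarith
      have := lt_of_mul_lt_mul_left this hδ.le
      exact_mod_cast this
  refine ⟨fun c => (n c - firstIndex u b δ c).toNat, fun c => ?_, ?_⟩
  · have := h c; dsimp only; omega
  · ext c
    have := h c
    simp only [Pi.add_apply]
    omega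

/-- A cube of side `2^{-j}` meets the lattice of level `j + μ` in a window of `2^μ` points per
direction, so the result for one window applies. Since `ρ ≤ 1`, the bound for differences of level
`j + μ` may be replaced by that of level `j`. -/
lemma exists_polyFun_near_on_level (d N μ : ℕ)
    (hm : (N + 1) * (d * (N + 1) + (N + 1) + 1) ≤ 2 ^ μ) :
    ∃ C : ℝ, 0 ≤ C ∧ ∀ (f : EuclideanSpace ℝ (Fin d) → ℝ) (u b : EuclideanSpace ℝ (Fin d)) (j : ℕ)
      (M ρ : ℝ), 0 ≤ M → 0 ≤ ρ → ρ ≤ 1 →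
      DyadicDiffBound N (2 ^ μ) f u (halfOpenCube b ((2⁻¹ : ℝ) ^ j)) j M ρ →
      ∃ F ∈ polyFun d N, ∀ n : Fin d → ℤ,
        latticePoint u ((2⁻¹ : ℝ) ^ (j + μ)) n ∈ halfOpenCube b ((2⁻¹ : ℝ) ^ j) →
        |f (latticePoint u ((2⁻¹ : ℝ) ^ (j + μ)) n) - F (latticePoint u ((2⁻¹ : ℝ) ^ (j + μ)) n)| ≤
          C * (M * ρ ^ j) := by
  obtain ⟨C, hC0, hC⟩ := exists_polyFun_near_of_fwdDiff_small d N (2 ^ μ) hm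
  refine ⟨C, hC0, fun f u b j M ρ hM hρ hρ1 hf => ?_⟩
  set δ : ℝ := (2⁻¹ : ℝ) ^ (j + μ) with hδ'
  have hδ : 0 < δ := by positivity
  have hside : (2⁻¹ : ℝ) ^ j = ((2 ^ μ : ℕ) : ℝ) * δ := by
    rw [hδ', pow_add]; push_cast
    rw [mul_comm, mul_assoc, ← mul_pow]; norm_num
  rw [hside] at hf ⊢
  have key : ∀ n h : Fin d → ℕ, (∀ c, n c + (N + 1) * h c < 2 ^ μ) →
      |(fwdDiff (δ • WithLp.toLp 2 fun c => (h c : ℝ)))^[N + 1] f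
        (latticePoint (latticePoint u δ (firstIndex u b δ)) δ fun c => (n c : ℤ))| ≤ M * ρ ^ j := by
    intro n h hnh
    have hn : ∀ c, n c < 2 ^ μ := fun c => lt_of_le_of_lt (Nat.le_add_right _ _) (hnh c)
    have hh : ∀ c, h c < 2 ^ μ := fun c => by
      have := hnh c
      have : h c ≤ (N + 1) * h c := Nat.le_mul_of_pos_left _ (Nat.succ_pos N)
      omega
    rw [latticePoint_add]
    refine (hf (j + μ) (Nat.le_add_right _ _) _ h hh
      (latticePoint_firstIndex_add_mem hδ hn) ?_).trans ?_
    · have h1 := latticePoint_firstIndex_add_mem (u := u) (b := b) hδ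
        (n := fun c => n c + (N + 1) * h c) hnh
      convert h1 using 1
      ext c
      simp [← hδ']
      ring
    · exact mul_le_mul_of_nonneg_left (pow_le_pow_of_le_one hρ hρ1 (Nat.le_add_right _ _)) hM
  obtain ⟨F, hF, hFf⟩ := hC f (latticePoint u δ (firstIndex u b δ)) δ hδ (M * ρ ^ j)
    (by positivity) key
  refine ⟨F, hF, fun n hn => ?_⟩
  obtain ⟨k, hk, rfl⟩ := exists_eq_firstIndex_add hδ hn
  have := hFf k hk
  rwa [latticePoint_add] at this

lemma exists_child {b x : EuclideanSpace ℝ (Fin d)} {ℓ : ℝ} (hx : x ∈ halfOpenCube b ℓ) :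
    ∃ b', x ∈ halfOpenCube b' (2⁻¹ * ℓ) ∧ halfOpenCube b' (2⁻¹ * ℓ) ⊆ halfOpenCube b ℓ := by
  classical
  have hℓ : ∀ c, 0 < ℓ := fun c : Fin d => by have := hx c; linarith
  refine ⟨WithLp.toLp 2 fun c => if x c < b c + 2⁻¹ * ℓ then b c else b c + 2⁻¹ * ℓ,
    fun c => ?_, fun y hy c => ?_⟩
  · have := hx c
    dsimp only
    split_ifs with h
    · exact ⟨this.1, h⟩
    · constructor <;> linarith
  · have h1 := hy c
    have := hℓ c
    dsimp only at h1
    split_ifs at h1 <;> constructor <;> linarith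

/-- If the differences decay, then `f` is uniformly close to a polynomial on all dyadic refinements
of the lattice in a cube. -/
theorem exists_polyFun_near_on_lattices (d N μ : ℕ)
    (hm : (N + 1) * (d * (N + 1) + (N + 1) + 1) ≤ 2 ^ μ) (hm2 : 2 * (N + 1) ≤ 2 ^ μ)
    {ρ : ℝ} (hρ : 0 < ρ) (hρ1 : ρ < 1) :
    ∃ C : ℝ, 0 ≤ C ∧ ∀ (f : EuclideanSpace ℝ (Fin d) → ℝ) (u b : EuclideanSpace ℝ (Fin d)) (j : ℕ)
      (M : ℝ), 0 ≤ M →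
      DyadicDiffBound N (2 ^ μ) f u (halfOpenCube b ((2⁻¹ : ℝ) ^ j)) j M ρ →
      ∃ F ∈ polyFun d N, ∀ (l : ℕ) (n : Fin d → ℤ),
        latticePoint u ((2⁻¹ : ℝ) ^ l) n ∈ halfOpenCube b ((2⁻¹ : ℝ) ^ j) →
        |f (latticePoint u ((2⁻¹ : ℝ) ^ l) n) - F (latticePoint u ((2⁻¹ : ℝ) ^ l) n)| ≤
          C * (M * ρ ^ j) := by
  obtain ⟨C₁, hC₁, h₁⟩ := exists_polyFun_near_on_level d N μ hm
  obtain ⟨C₂, hC₂, h₂⟩ := exists_latticeCube_bound d N (2 ^ μ)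
  -- `C₁` pays for the first level and `C₂ * (2 * C₁)` for replacing the polynomial of a cube by
  -- that of its child.
  set C₃ := C₁ + C₂ * (2 * C₁)
  have hC₃ : 0 ≤ C₃ := by positivity
  have h1ρ : 0 < 1 - ρ := by linarith
  -- Induction on the number `k` of levels below `j + μ`, with the cube variable: a point of the
  -- finer level is treated in the child cube that contains it.
  have claim : ∀ (f : EuclideanSpace ℝ (Fin d) → ℝ) (u : EuclideanSpace ℝ (Fin d)) (M : ℝ), 0 ≤ M →
      ∀ (k j : ℕ) (b : EuclideanSpace ℝ (Fin d)),
      DyadicDiffBound N (2 ^ μ) f u (halfOpenCube b ((2⁻¹ : ℝ) ^ j)) j M ρ →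
      ∀ F ∈ polyFun d N, (∀ n : Fin d → ℤ,
        latticePoint u ((2⁻¹ : ℝ) ^ (j + μ)) n ∈ halfOpenCube b ((2⁻¹ : ℝ) ^ j) →
        |f (latticePoint u ((2⁻¹ : ℝ) ^ (j + μ)) n) - F (latticePoint u ((2⁻¹ : ℝ) ^ (j + μ)) n)| ≤
          C₁ * (M * ρ ^ j)) →
      ∀ n : Fin d → ℤ,
        latticePoint u ((2⁻¹ : ℝ) ^ (j + μ + k)) n ∈ halfOpenCube b ((2⁻¹ : ℝ) ^ j) →
        |f (latticePoint u ((2⁻¹ : ℝ) ^ (j + μ + k)) n) -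
          F (latticePoint u ((2⁻¹ : ℝ) ^ (j + μ + k)) n)| ≤ C₃ / (1 - ρ) * (M * ρ ^ j) := by
    intro f u M hM k
    induction k with
    | zero =>
      intro j b _ F _ hFf n hn
      refine (hFf n hn).trans (mul_le_mul_of_nonneg_right ?_ (by positivity))
      rw [le_div_iff₀ h1ρ]
      nlinarith [mul_nonneg hC₁ hρ.le, mul_nonneg hC₂ hC₁]
    | succ k ih =>
      intro j b hf F hF hFf n hn
      set y := latticePoint u ((2⁻¹ : ℝ) ^ (j + μ + (k + 1))) n
      obtain ⟨b', hy, hsub⟩ := exists_child hn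
      rw [← pow_succ'] at hy hsub
      have hf' := hf.mono hsub (Nat.le_succ j)
      obtain ⟨F', hF', hFf'⟩ := h₁ f u b' (j + 1) M ρ hM hρ.le hρ1.le hf'
      have hpow : (2⁻¹ : ℝ) ^ (j + μ + (k + 1)) = (2⁻¹ : ℝ) ^ (j + 1 + μ + k) := by
        congr 1; omega
      have e1 : |f y - F' y| ≤ C₃ / (1 - ρ) * (M * ρ ^ (j + 1)) := by
        have := ih (j + 1) b' hf' F' hF' hFf' n (by rw [← hpow]; exact hy)
        rwa [← hpow] at this
      have hρj : ρ ^ (j + 1) ≤ ρ ^ j := pow_le_pow_of_le_one hρ.le hρ1.le (Nat.le_succ j)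
      -- Both polynomials are close to `f` on the lattice of level `j + μ` in the child cube, hence
      -- close to each other there, hence on all of the child.
      have e2 : |(F' - F) y| ≤ C₂ * (2 * C₁ * (M * ρ ^ j)) := by
        set δ : ℝ := (2⁻¹ : ℝ) ^ (j + μ) with hδ'
        have hδ : 0 < δ := by positivity
        have hμ : 1 ≤ μ := by
          by_contra h
          have : μ = 0 := by omega
          subst this
          omega
        have hside : (2⁻¹ : ℝ) ^ (j + 1) = ((2 ^ (μ - 1) : ℕ) : ℝ) * δ := by
          obtain ⟨ν, rfl⟩ : ∃ ν, μ = ν + 1 := ⟨μ - 1, by omega⟩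
          rw [hδ', show j + (ν + 1) = (j + 1) + ν by omega, pow_add _ (j + 1) ν]; push_cast
          rw [mul_left_comm, ← mul_pow]; norm_num
        -- The child has half the side of the cube; the condition `2 (N + 1) ≤ 2^μ` still leaves `N
        -- + 1` points of level `j + μ` per direction in it, enough to control a polynomial.
        have hN : N + 1 ≤ 2 ^ (μ - 1) := by
          obtain ⟨ν, rfl⟩ : ∃ ν, μ = ν + 1 := ⟨μ - 1, by omega⟩
          rw [pow_succ] at hm2
          simp; omega
        refine h₂ (F' - F) (Submodule.sub_mem _ hF' hF)
          (latticePoint u δ (firstIndex u b' δ)) δ hδ _ (by positivity) (fun i hi => ?_) y ?_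
        · rw [latticePoint_add]
          have hmem := latticePoint_firstIndex_add_mem (u := u) (b := b') hδ
            (n := i) (fun c => (hi c).trans_le hN)
          rw [← hside] at hmem
          have a1 := hFf _ (hsub hmem)
          have hfine : latticePoint u δ (firstIndex u b' δ + fun c => (i c : ℤ)) =
              latticePoint u ((2⁻¹ : ℝ) ^ (j + 1 + μ))
                (fun c => 2 * (firstIndex u b' δ + fun c => (i c : ℤ)) c) := by
            ext c
            have : (2⁻¹ : ℝ) ^ (j + 1 + μ) = δ / 2 := by
              rw [hδ', show j + 1 + μ = j + μ + 1 by omega, pow_succ]; ring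
            rw [latticePoint_apply, latticePoint_apply, this]
            push_cast; ring
          have a2 : |f (latticePoint u δ (firstIndex u b' δ + fun c => (i c : ℤ))) -
              F' (latticePoint u δ (firstIndex u b' δ + fun c => (i c : ℤ)))| ≤
                C₁ * (M * ρ ^ (j + 1)) := by
            have := hFf' (fun c => 2 * (firstIndex u b' δ + fun c => (i c : ℤ)) c)
              (by rw [← hfine]; exact hmem)
            rwa [← hfine] at this
          have a3 : C₁ * (M * ρ ^ (j + 1)) ≤ C₁ * (M * ρ ^ j) := by gcongr
          rw [abs_le] at a1 a2 ⊢
          simp only [Pi.sub_apply]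
          constructor <;> linarith
        · intro c
          have b1 := hy c
          obtain ⟨b2, b3⟩ := firstIndex_le (u := u) (b := b') hδ c
          have b4 : δ ≤ (2⁻¹ : ℝ) ^ (j + 1) := by
            rw [hδ']
            exact pow_le_pow_of_le_one (by norm_num) (by norm_num) (by omega)
          have b5 : (2⁻¹ : ℝ) ^ (j + 1) ≤ 2 ^ μ * δ := by
            rw [hside]; push_cast
            gcongr
            · norm_num
            · omega
          rw [latticePoint_apply u δ, abs_le]
          constructor <;> linarith
      have e3 : |f y - F y| ≤ |f y - F' y| + |(F' - F) y| := by
        rw [Pi.sub_apply]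
        exact abs_sub_le _ _ _
      have hA : 0 ≤ M * ρ ^ j := by positivity
      -- The constant `C₃ / (1 - ρ)` is the fixed point of the recursion: the error of the child is
      -- smaller by the factor `ρ`, and the change of polynomial adds `C₃`.
      have e4 : C₃ / (1 - ρ) * (M * ρ ^ (j + 1)) + C₃ * (M * ρ ^ j) =
          C₃ / (1 - ρ) * (M * ρ ^ j) := by
        field_simp
        ring
      have e5 : C₂ * (2 * C₁ * (M * ρ ^ j)) ≤ C₃ * (M * ρ ^ j) := by
        rw [← mul_assoc]
        exact mul_le_mul_of_nonneg_right (by simp [C₃, hC₁]) hA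
      linarith
  refine ⟨C₃ / (1 - ρ), by positivity, fun f u b j M hM hf => ?_⟩
  obtain ⟨F, hF, hFf⟩ := h₁ f u b j M ρ hM hρ.le hρ1.le hf
  refine ⟨F, hF, fun l n hn => ?_⟩
  -- A point of any level `l`, also of a level coarser than `j`, is a point of level `j + μ + l`.
  have hfine : latticePoint u ((2⁻¹ : ℝ) ^ l) n =
      latticePoint u ((2⁻¹ : ℝ) ^ (j + μ + l)) (fun c => 2 ^ (j + μ) * n c) := by
    ext c
    rw [latticePoint_apply, latticePoint_apply, pow_add]
    push_cast
    have : (2⁻¹ : ℝ) ^ (j + μ) * 2 ^ (j + μ) = 1 := by rw [← mul_pow]; norm_num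
    linear_combination -(2⁻¹ : ℝ) ^ l * n c * this
  rw [hfine] at hn ⊢
  exact claim f u M hM l j b hf F hF hFf _ hn

end chain

/-! ### The modulus of smoothness -/

section modulus
variable {d : ℕ}

/-- The sum is at most the number of terms times the largest one. No convexity is used, so exponents
below one are covered. -/
lemma ENNReal.sum_rpow_le_card_rpow_mul {ι : Type*} (s : Finset ι) (a : ι → ℝ≥0∞) {p : ℝ}
    (hp : 0 < p) : (∑ i ∈ s, a i) ^ p ≤ (s.card : ℝ≥0∞) ^ p * ∑ i ∈ s, a i ^ p := by
  rcases s.eq_empty_or_nonempty with rfl | hs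
  · simp [hp]
  obtain ⟨i, hi, hmax⟩ := s.exists_max_image a hs
  calc (∑ i ∈ s, a i) ^ p ≤ (s.card * a i) ^ p := by
        refine ENNReal.rpow_le_rpow ?_ hp.le
        rw [← nsmul_eq_mul]
        exact Finset.sum_le_card_nsmul _ _ _ hmax
    _ = (s.card : ℝ≥0∞) ^ p * a i ^ p := ENNReal.mul_rpow_of_nonneg _ _ hp.le
    _ ≤ _ := by
        gcongr
        exact Finset.single_le_sum (f := fun i => a i ^ p) (fun _ _ => zero_le) hi

lemma convex_openUnitCube : Convex ℝ (openUnitCube d) := by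
  intro x hx y hy a b ha hb hab i
  have h1 := hx i
  have h2 := hy i
  simp only [PiLp.add_apply, PiLp.smul_apply, smul_eq_mul]
  rcases ha.eq_or_lt with rfl | ha
  · have : b = 1 := by linarith
    subst this; constructor <;> linarith
  · constructor
    · have := mul_pos ha h1.1
      have := mul_nonneg hb h2.1.le
      linarith
    · have := mul_lt_mul_of_pos_left h1.2 ha
      have := mul_le_mul_of_nonneg_left h2.2.le hb
      linarith

lemma isOpen_openUnitCube : IsOpen (openUnitCube d) := by
  have : openUnitCube d = ⋂ i, {x | 0 < x i ∧ x i < 1} := by ext; simp [openUnitCube]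
  rw [this]
  refine isOpen_iInter_of_finite fun i => ?_
  have hc : Continuous fun x : EuclideanSpace ℝ (Fin d) => x i := by fun_prop
  exact (isOpen_lt continuous_const hc).inter (isOpen_lt hc continuous_const)

lemma mem_shiftDomain_openUnitCube {x h : EuclideanSpace ℝ (Fin d)} :
    x ∈ shiftDomain (openUnitCube d) h ↔ x ∈ openUnitCube d ∧ x + h ∈ openUnitCube d :=
  ⟨fun hx => ⟨hx.1, hx.2 (right_mem_segment _ _ _)⟩,
    fun hx => ⟨hx.1, convex_openUnitCube.segment_subset hx.1 hx.2⟩⟩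

lemma add_nsmul_mem_openUnitCube {r k : ℕ} (hk : k ≤ r) {x h : EuclideanSpace ℝ (Fin d)}
    (hx : x ∈ shiftDomain (openUnitCube d) ((r : ℝ) • h)) : x + k • h ∈ openUnitCube d := by
  refine hx.2 ⟨1 - (k : ℝ) / r, (k : ℝ) / r, ?_, by positivity, by ring, ?_⟩
  · rw [sub_nonneg]
    exact div_le_one_of_le₀ (by exact_mod_cast hk) (Nat.cast_nonneg _)
  · rcases Nat.eq_zero_or_pos r with rfl | hr
    · have : k = 0 := by omega
      subst this; simp
    · have : (r : ℝ) ≠ 0 := by positivity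
      rw [smul_add, ← add_assoc, ← add_smul, sub_add_cancel, one_smul, smul_smul,
        div_mul_cancel₀ _ this, Nat.cast_smul_eq_nsmul]

lemma measurableSet_shiftDomain (h : EuclideanSpace ℝ (Fin d)) :
    MeasurableSet (shiftDomain (openUnitCube d) h) := by
  have : shiftDomain (openUnitCube d) h = openUnitCube d ∩ (· + h) ⁻¹' openUnitCube d := by
    ext x; exact mem_shiftDomain_openUnitCube
  rw [this]
  exact isOpen_openUnitCube.measurableSet.inter
    ((measurable_add_const h) isOpen_openUnitCube.measurableSet)

/-- The `p`-th power of the `L_p` (quasi-)norm of the `r`-th difference with step `h`. -/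
noncomputable def diffInt (r : ℕ) (p : ℝ) (f : EuclideanSpace ℝ (Fin d) → ℝ)
    (h : EuclideanSpace ℝ (Fin d)) : ℝ≥0∞ :=
  ∫⁻ x in shiftDomain (openUnitCube d) ((r : ℝ) • h), ‖(fwdDiff h)^[r] f x‖ₑ ^ p

lemma eLpNorm_eq_diffInt (r : ℕ) {p : ℝ} (hp : 0 < p) (f : EuclideanSpace ℝ (Fin d) → ℝ)
    (h : EuclideanSpace ℝ (Fin d)) :
    eLpNorm ((fwdDiff h)^[r] f) (ENNReal.ofReal p)
      (volume.restrict (shiftDomain (openUnitCube d) ((r : ℝ) • h))) =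
      diffInt r p f h ^ (1 / p) := by
  rw [eLpNorm_eq_lintegral_rpow_enorm_toReal (by simpa using hp) ENNReal.ofReal_ne_top,
    ENNReal.toReal_ofReal hp.le]
  rfl

lemma diffInt_le_modulus {r : ℕ} {p : ℝ} (hp : 0 < p) (f : EuclideanSpace ℝ (Fin d) → ℝ)
    {h : EuclideanSpace ℝ (Fin d)} {t : ℝ} (ht : ‖h‖ ≤ t) :
    diffInt r p f h ≤ modulusOfSmoothness r (ENNReal.ofReal p) f t ^ p := by
  have h1 : diffInt r p f h ^ (1 / p) ≤ modulusOfSmoothness r (ENNReal.ofReal p) f t := by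
    rw [← eLpNorm_eq_diffInt r hp]
    exact le_iSup₂ (f := fun (h : EuclideanSpace ℝ (Fin d)) (_ : ‖h‖ ≤ t) =>
      eLpNorm ((fwdDiff h)^[r] f) (ENNReal.ofReal p)
      (volume.restrict (shiftDomain (openUnitCube d) ((r : ℝ) • h)))) h ht
  have h2 := ENNReal.rpow_le_rpow h1 hp.le
  rwa [← ENNReal.rpow_mul, one_div, inv_mul_cancel₀ hp.ne', ENNReal.rpow_one] at h2

lemma modulusOfSmoothness_mono (r : ℕ) (p : ℝ≥0∞) (f : EuclideanSpace ℝ (Fin d) → ℝ) {t t' : ℝ}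
    (h : t ≤ t') : modulusOfSmoothness r p f t ≤ modulusOfSmoothness r p f t' :=
  iSup₂_le fun k hk => le_iSup₂ (f := fun (h : EuclideanSpace ℝ (Fin d)) (_ : ‖h‖ ≤ t') =>
      eLpNorm ((fwdDiff h)^[r] f) p
      (volume.restrict (shiftDomain (openUnitCube d) ((r : ℝ) • h)))) k (hk.trans h)

/-- Translates of a null set: almost everywhere equality on the cube passes to differences. -/
lemma modulusOfSmoothness_congr {f g : EuclideanSpace ℝ (Fin d) → ℝ}
    (hfg : f =ᵐ[volume.restrict (openUnitCube d)] g) (r : ℕ) (p : ℝ≥0∞) (t : ℝ) :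
    modulusOfSmoothness r p f t = modulusOfSmoothness r p g t := by
  refine iSup_congr fun h => iSup_congr fun _ => eLpNorm_congr_ae ?_
  have h0 : ∀ᵐ x, x ∈ openUnitCube d → f x = g x :=
    (ae_restrict_iff' isOpen_openUnitCube.measurableSet).1 hfg
  have h1 : ∀ k : ℕ, ∀ᵐ x : EuclideanSpace ℝ (Fin d),
      x + k • h ∈ openUnitCube d → f (x + k • h) = g (x + k • h) := fun k =>
    (measurePreserving_add_right volume (k • h)).quasiMeasurePreserving.ae h0
  refine (ae_restrict_iff' (measurableSet_shiftDomain _)).2 ?_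
  filter_upwards [ae_all_iff.2 h1] with x hx hxs
  rw [fwdDiff_iter_eq_sum_shift, fwdDiff_iter_eq_sum_shift]
  refine Finset.sum_congr rfl fun k hk => ?_
  rw [hx k (add_nsmul_mem_openUnitCube (Nat.lt_succ_iff.1 (Finset.mem_range.1 hk)) hxs)]

/-- With the shift `τ` by `h`, the difference with step `2h` factors as `(τ + 1) Δ_h`. The factors
commute, and the binomial theorem expands `(τ + 1)^r`. -/
lemma fwdDiff_two_smul_iter {M : Type*} [AddCommMonoid M] (h : M) (r : ℕ) (f : M → ℝ) (x : M) :
    (fwdDiff (2 • h))^[r] f x =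
      ∑ j ∈ Finset.range (r + 1), (r.choose j : ℝ) * (fwdDiff h)^[r] f (x + j • h) := by
  have h1 : fwdDiff_aux.fwdDiffₗ M ℝ (2 • h) =
      (fwdDiff_aux.shiftₗ M ℝ h + 1) * fwdDiff_aux.fwdDiffₗ M ℝ h := by
    ext f x
    simp [fwdDiff_aux.shiftₗ_apply, fwdDiff, two_smul, add_assoc]
  have hc : Commute (fwdDiff_aux.shiftₗ M ℝ h + 1) (fwdDiff_aux.fwdDiffₗ M ℝ h) := by
    have : Commute (fwdDiff_aux.shiftₗ M ℝ h) (fwdDiff_aux.fwdDiffₗ M ℝ h) :=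
      (Commute.refl _).add_left (Commute.one_left _)
    exact this.add_left (Commute.one_left _)
  rw [← fwdDiff_aux.coe_fwdDiffₗ_pow, h1, hc.mul_pow, (Commute.one_right _).add_pow,
    Module.End.mul_apply, fwdDiff_aux.coe_fwdDiffₗ_pow, LinearMap.sum_apply, Finset.sum_apply]
  refine Finset.sum_congr rfl fun j _ => ?_
  rw [one_pow, mul_one, (Nat.cast_commute _ _).eq.symm, Module.End.mul_apply]
  have : ∀ (c : ℕ) (F : M → ℝ), (c : Module.End ℤ (M → ℝ)) F = c • F := fun c F => by
    rw [Module.End.natCast_apply]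
  rw [this, Pi.smul_apply, fwdDiff_aux.shiftₗ_pow_apply, nsmul_eq_mul]

lemma measurable_fwdDiff_iter {f : EuclideanSpace ℝ (Fin d) → ℝ} (hf : Measurable f)
    (h : EuclideanSpace ℝ (Fin d)) (r : ℕ) : Measurable ((fwdDiff h)^[r] f) := by
  have : (fwdDiff h)^[r] f = fun x => ∑ k ∈ Finset.range (r + 1),
      ((-1 : ℤ) ^ (r - k) * r.choose k) • f (x + k • h) :=
    funext fun x => fwdDiff_iter_eq_sum_shift h f r x
  rw [this]
  refine Finset.measurable_sum _ fun k _ => ?_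
  simp only [zsmul_eq_mul]
  exact (hf.comp (measurable_add_const _)).const_mul _

/-- In the binomial expansion the shift by `j h`, `j ≤ r`, maps the domain of the difference with
step `2h` into that with step `h`, so each term costs at most one integral of the smaller step. -/
lemma diffInt_two_smul_le (r : ℕ) {p : ℝ} (hp : 0 < p) {f : EuclideanSpace ℝ (Fin d) → ℝ}
    (hf : Measurable f) (h : EuclideanSpace ℝ (Fin d)) :
    diffInt r p f (2 • h) ≤
      (((r + 1 : ℕ) : ℝ≥0∞) ^ p * ∑ j ∈ Finset.range (r + 1), ((r.choose j : ℕ) : ℝ≥0∞) ^ p) *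
        diffInt r p f h := by
  set D := shiftDomain (openUnitCube d) ((r : ℝ) • (2 • h))
  have hmeas := measurable_fwdDiff_iter hf h r
  have hterm : ∀ j ∈ Finset.range (r + 1),
      ∫⁻ x in D, ‖(fwdDiff h)^[r] f (x + j • h)‖ₑ ^ p ≤ diffInt r p f h := by
    intro j hj
    have hj' : j ≤ r := Nat.lt_succ_iff.1 (Finset.mem_range.1 hj)
    set D' := shiftDomain (openUnitCube d) ((r : ℝ) • h)
    rw [diffInt, ← lintegral_indicator (measurableSet_shiftDomain _),
      ← lintegral_indicator (measurableSet_shiftDomain _),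
      ← lintegral_add_right_eq_self (D'.indicator fun x => ‖(fwdDiff h)^[r] f x‖ₑ ^ p) (j • h)]
    refine lintegral_mono fun x => ?_
    by_cases hx : x ∈ D
    · have hx2 : x ∈ shiftDomain (openUnitCube d) (((2 * r : ℕ) : ℝ) • h) := by
        have : (r : ℝ) • (2 • h) = ((2 * r : ℕ) : ℝ) • h := by
          rw [← Nat.cast_smul_eq_nsmul ℝ 2 h, smul_smul]; push_cast; ring_nf
        rwa [← this]
      have hx' : x + j • h ∈ D' := by
        rw [mem_shiftDomain_openUnitCube]
        refine ⟨add_nsmul_mem_openUnitCube (by omega) hx2, ?_⟩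
        rw [Nat.cast_smul_eq_nsmul, add_assoc, ← add_nsmul]
        exact add_nsmul_mem_openUnitCube (by omega) hx2
      rw [indicator_of_mem hx, indicator_of_mem hx']
    · rw [indicator_of_notMem hx]
      exact zero_le
  calc diffInt r p f (2 • h)
      = ∫⁻ x in D, ‖∑ j ∈ Finset.range (r + 1),
          (r.choose j : ℝ) * (fwdDiff h)^[r] f (x + j • h)‖ₑ ^ p := by
        simp only [diffInt, fwdDiff_two_smul_iter, D]
    _ ≤ ∫⁻ x in D, ((r + 1 : ℕ) : ℝ≥0∞) ^ p * ∑ j ∈ Finset.range (r + 1),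
          ((r.choose j : ℕ) : ℝ≥0∞) ^ p * ‖(fwdDiff h)^[r] f (x + j • h)‖ₑ ^ p := by
        refine lintegral_mono fun x => ?_
        refine (ENNReal.rpow_le_rpow (enorm_sum_le _ _) hp.le).trans ?_
        refine (ENNReal.sum_rpow_le_card_rpow_mul _ _ hp).trans ?_
        rw [Finset.card_range]
        refine mul_le_mul_right (Finset.sum_le_sum fun j _ => ?_) _
        rw [enorm_mul, ENNReal.mul_rpow_of_nonneg _ _ hp.le]
        simp
    _ = ((r + 1 : ℕ) : ℝ≥0∞) ^ p * ∑ j ∈ Finset.range (r + 1),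
          ((r.choose j : ℕ) : ℝ≥0∞) ^ p * ∫⁻ x in D, ‖(fwdDiff h)^[r] f (x + j • h)‖ₑ ^ p := by
        have hm : ∀ j : ℕ, Measurable fun x => ‖(fwdDiff h)^[r] f (x + j • h)‖ₑ ^ p := fun j =>
          ((hmeas.comp (measurable_add_const _)).enorm).pow_const _
        rw [lintegral_const_mul _ (Finset.measurable_sum _ fun j _ => (hm j).const_mul _),
          lintegral_finsetSum _ fun j _ => (hm j).const_mul _]
        congr 1
        exact Finset.sum_congr rfl fun j _ => lintegral_const_mul _ (hm j)
    _ ≤ _ := by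
        rw [mul_assoc, Finset.sum_mul]
        gcongr with j hj
        exact hterm j hj

lemma exists_modulus_doubling (r : ℕ) {p : ℝ} (hp : 0 < p) :
    ∃ K : ℝ, 1 ≤ K ∧ ∀ f : EuclideanSpace ℝ (Fin d) → ℝ, Measurable f → ∀ t : ℝ,
      modulusOfSmoothness r (ENNReal.ofReal p) f (2 * t) ≤
        ENNReal.ofReal K * modulusOfSmoothness r (ENNReal.ofReal p) f t := by
  set K₀ : ℝ≥0∞ := ((r + 1 : ℕ) : ℝ≥0∞) ^ p *
    ∑ j ∈ Finset.range (r + 1), ((r.choose j : ℕ) : ℝ≥0∞) ^ p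
  have hK₀ : K₀ ≠ ⊤ := by
    refine ENNReal.mul_ne_top (ENNReal.rpow_ne_top_of_nonneg hp.le (ENNReal.natCast_ne_top _)) ?_
    exact ENNReal.sum_ne_top.2 fun j _ =>
      ENNReal.rpow_ne_top_of_nonneg hp.le (ENNReal.natCast_ne_top _)
  have hK₁ : K₀ ^ (1 / p) ≠ ⊤ := ENNReal.rpow_ne_top_of_nonneg (by positivity) hK₀
  refine ⟨max 1 (K₀ ^ (1 / p)).toReal, le_max_left _ _, fun f hf t => ?_⟩
  refine iSup₂_le fun h hh => ?_
  have h2 : h = 2 • ((2⁻¹ : ℝ) • h) := by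
    rw [← Nat.cast_smul_eq_nsmul ℝ, smul_smul]; norm_num
  have hn : ‖(2⁻¹ : ℝ) • h‖ ≤ t := by
    rw [norm_smul]; norm_num; linarith
  rw [eLpNorm_eq_diffInt r hp]
  calc diffInt r p f h ^ (1 / p)
      ≤ (K₀ * diffInt r p f ((2⁻¹ : ℝ) • h)) ^ (1 / p) := by
        refine ENNReal.rpow_le_rpow ?_ (by positivity)
        conv_lhs => rw [h2]
        exact diffInt_two_smul_le r hp hf _
    _ ≤ (K₀ * modulusOfSmoothness r (ENNReal.ofReal p) f t ^ p) ^ (1 / p) := by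
        gcongr
        exact diffInt_le_modulus hp f hn
    _ = K₀ ^ (1 / p) * modulusOfSmoothness r (ENNReal.ofReal p) f t := by
        rw [ENNReal.mul_rpow_of_nonneg _ _ (by positivity), ← ENNReal.rpow_mul, one_div,
          mul_inv_cancel₀ hp.ne', ENNReal.rpow_one]
    _ ≤ _ := by
        gcongr
        refine (ENNReal.ofReal_toReal hK₁).symm.le.trans ?_
        exact ENNReal.ofReal_le_ofReal (le_max_right _ _)

/-- The integral is `log 4 > 1`. A lower bound by one makes the later estimate free of constants
that depend on `q`, after the root of order `q` is taken. -/
lemma one_le_lintegral_inv {T : ℝ} (hT : 0 < T) :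
    1 ≤ ∫⁻ t in Ioc (T / 2) (2 * T), ENNReal.ofReal t⁻¹ := by
  have h1 : ∫ t in (T / 2)..(2 * T), t⁻¹ = Real.log 4 := by
    rw [integral_inv_of_pos (by positivity) (by positivity)]
    congr 1; field_simp; norm_num
  have h2 : IntervalIntegrable (fun t : ℝ => t⁻¹) volume (T / 2) (2 * T) := by
    refine intervalIntegral.intervalIntegrable_inv (fun t ht => ?_) continuousOn_id
    rw [uIcc_of_le (by linarith)] at ht
    exact (by linarith [ht.1] : (0 : ℝ) < t).ne'
  rw [intervalIntegral.integral_of_le (by linarith)] at h1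
  rw [← ofReal_integral_eq_lintegral_ofReal ((intervalIntegrable_iff_integrableOn_Ioc_of_le
    (by linarith)).1 h2), h1]
  · rw [← ENNReal.ofReal_one]
    refine ENNReal.ofReal_le_ofReal ?_
    have : Real.log 4 = 2 * Real.log 2 := by
      rw [show (4 : ℝ) = 2 ^ 2 by norm_num, Real.log_pow]; norm_num
    have := Real.log_two_gt_d9
    linarith
  · refine (ae_restrict_iff' measurableSet_Ioc).2 (Filter.Eventually.of_forall fun t ht => ?_)
    have : 0 < t := by linarith [ht.1]
    simp only [Pi.zero_apply]
    positivity

/-- For `T/2 < t ≤ 2T`, monotonicity and one doubling give `w T ≤ K w t`, while `t^{-s} ≥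
(2T)^{-s}`. So the weighted modulus exceeds the constant `a` on a whole interval of logarithmic
length `log 4`; `2T < 1` keeps this interval inside `(0,1)`. -/
lemma rpow_mul_modulus_le_besovSeminorm {s p K : ℝ} (hs : 0 < s) {q : ℝ≥0∞} (hq : 0 < q)
    (hK : 1 ≤ K) {f : EuclideanSpace ℝ (Fin d) → ℝ}
    (hf : ∀ t : ℝ, modulusOfSmoothness (smoothnessOrder s) (ENNReal.ofReal p) f (2 * t) ≤
        ENNReal.ofReal K * modulusOfSmoothness (smoothnessOrder s) (ENNReal.ofReal p) f t)
    {T : ℝ} (hT : 0 < T) (hT2 : 2 * T < 1) :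
    modulusOfSmoothness (smoothnessOrder s) (ENNReal.ofReal p) f T ≤
      ENNReal.ofReal (K * (2 * T) ^ s) * besovSeminorm s (ENNReal.ofReal p) q f := by
  set w := modulusOfSmoothness (smoothnessOrder s) (ENNReal.ofReal p) f
  have hK0 : 0 < K := by linarith
  set a : ℝ≥0∞ := ENNReal.ofReal ((K * (2 * T) ^ s)⁻¹) * w T with ha
  have hpt : ∀ t, T / 2 < t → t ≤ 2 * T → a ≤ ENNReal.ofReal (t ^ (-s)) * w t := by
    intro t h1 h2
    have ht : 0 < t := by linarith
    have h3 : w T ≤ ENNReal.ofReal K * w t := by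
      refine le_trans ?_ (mul_le_mul_right (modulusOfSmoothness_mono _ _ f h1.le) _)
      have := hf (T / 2)
      rwa [mul_div_cancel₀ _ two_ne_zero] at this
    calc a ≤ ENNReal.ofReal ((K * (2 * T) ^ s)⁻¹) * (ENNReal.ofReal K * w t) :=
          mul_le_mul_right h3 _
      _ = ENNReal.ofReal (((2 * T) ^ s)⁻¹) * w t := by
        rw [← mul_assoc, ← ENNReal.ofReal_mul (by positivity)]
        congr 2
        field_simp
      _ ≤ _ := by
        gcongr
        rw [Real.rpow_neg ht.le]
        gcongr
  have hab : a ≤ besovSeminorm s (ENNReal.ofReal p) q f := by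
    unfold besovSeminorm
    split_ifs with hqt
    · refine (hpt T (by linarith) (by linarith)).trans ?_
      exact le_iSup₂ (f := fun (t : ℝ) (_ : t ∈ Ioo (0 : ℝ) 1) =>
        ENNReal.ofReal (t ^ (-s)) * modulusOfSmoothness (smoothnessOrder s)
          (ENNReal.ofReal p) f t) T ⟨hT, by linarith⟩
    · have hq' : 0 < q.toReal := ENNReal.toReal_pos hq.ne' hqt
      have : a ^ q.toReal ≤ ∫⁻ t in Ioo (0 : ℝ) 1,
          (ENNReal.ofReal (t ^ (-s)) * w t) ^ q.toReal * ENNReal.ofReal t⁻¹ := by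
        calc a ^ q.toReal
            ≤ a ^ q.toReal * ∫⁻ t in Ioc (T / 2) (2 * T), ENNReal.ofReal t⁻¹ :=
              le_mul_of_one_le_right zero_le (one_le_lintegral_inv hT)
          _ = ∫⁻ t in Ioc (T / 2) (2 * T), a ^ q.toReal * ENNReal.ofReal t⁻¹ := by
              rw [lintegral_const_mul]
              exact measurable_inv.ennreal_ofReal
          _ ≤ ∫⁻ t in Ioc (T / 2) (2 * T),
                (ENNReal.ofReal (t ^ (-s)) * w t) ^ q.toReal * ENNReal.ofReal t⁻¹ := by
              refine setLIntegral_mono' measurableSet_Ioc fun t ht => ?_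
              gcongr
              exact hpt t ht.1 ht.2
          _ ≤ _ := by
              refine lintegral_mono_set fun t ht => ⟨?_, ?_⟩
              · linarith [ht.1]
              · linarith [ht.2]
      have h2 := ENNReal.rpow_le_rpow this (by positivity : 0 ≤ 1 / q.toReal)
      rwa [← ENNReal.rpow_mul, mul_one_div, div_self hq'.ne', ENNReal.rpow_one] at h2
  have hpos : 0 < K * (2 * T) ^ s := by positivity
  calc w T = ENNReal.ofReal (K * (2 * T) ^ s) * a := by
        rw [ha, ← mul_assoc, ← ENNReal.ofReal_mul hpos.le, mul_inv_cancel₀ hpos.ne',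
          ENNReal.ofReal_one, one_mul]
    _ ≤ _ := by gcongr

/-- The Besov seminorm controls the modulus of smoothness, with a constant independent of `q`. -/
theorem exists_modulus_le_besovSeminorm (d : ℕ) {s p : ℝ} (hs : 0 < s) (hp : 0 < p) (L : ℕ) :
    ∃ C : ℝ, 0 < C ∧ ∀ q : ℝ≥0∞, 0 < q → ∀ f : EuclideanSpace ℝ (Fin d) → ℝ,
      AEStronglyMeasurable f (volume.restrict (openUnitCube d)) → ∀ t : ℝ, 0 < t → t ≤ 2 ^ L →
      modulusOfSmoothness (smoothnessOrder s) (ENNReal.ofReal p) f t ≤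
        ENNReal.ofReal (C * t ^ s) * besovSeminorm s (ENNReal.ofReal p) q f := by
  obtain ⟨K, hK, hKf⟩ := exists_modulus_doubling (d := d) (smoothnessOrder s) hp
  refine ⟨K ^ (L + 2) * (K * 2 ^ s), by positivity, fun q hq f hf t ht htL => ?_⟩
  have hfg := hf.ae_eq_mk
  set g := hf.mk f
  have hgm : Measurable g := hf.stronglyMeasurable_mk.measurable
  have hcongr := modulusOfSmoothness_congr hfg (smoothnessOrder s) (ENNReal.ofReal p)
  have hdbl : ∀ t : ℝ, modulusOfSmoothness (smoothnessOrder s) (ENNReal.ofReal p) f (2 * t) ≤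
        ENNReal.ofReal K * modulusOfSmoothness (smoothnessOrder s) (ENNReal.ofReal p) f t := by
    intro t
    rw [hcongr, hcongr]
    exact hKf g hgm t
  have hiter : ∀ (n : ℕ) (t : ℝ),
      modulusOfSmoothness (smoothnessOrder s) (ENNReal.ofReal p) f (2 ^ n * t) ≤
        ENNReal.ofReal (K ^ n) *
          modulusOfSmoothness (smoothnessOrder s) (ENNReal.ofReal p) f t := by
    intro n
    induction n with
    | zero => intro t; simp
    | succ n ih =>
      intro t
      rw [pow_succ', mul_assoc, pow_succ', ENNReal.ofReal_mul (by linarith), mul_assoc]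
      exact (hdbl _).trans (mul_le_mul_right (ih t) _)
  -- The seminorm sees only steps below one. Here `2T ≤ 1/2`, and `L + 2` doublings lead back to
  -- `t`.
  set T := t / 2 ^ (L + 2) with hTdef
  have hT : 0 < T := by positivity
  have htT : t = 2 ^ (L + 2) * T := by rw [hTdef]; field_simp
  have hT2 : 2 * T < 1 := by
    rw [hTdef, pow_add]
    have : (0 : ℝ) < 2 ^ L := by positivity
    rw [mul_div_assoc', div_lt_one (by positivity)]
    linarith
  have hmain := rpow_mul_modulus_le_besovSeminorm hs hq hK hdbl hT hT2
  conv_lhs => rw [htT]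
  refine (hiter _ _).trans ((mul_le_mul_right hmain _).trans ?_)
  rw [← mul_assoc, ← ENNReal.ofReal_mul (by positivity)]
  refine mul_le_mul_left (ENNReal.ofReal_le_ofReal ?_) _
  have hTt : T ≤ t := div_le_self ht.le (one_le_pow₀ (by norm_num))
  calc K ^ (L + 2) * (K * (2 * T) ^ s) ≤ K ^ (L + 2) * (K * (2 * t) ^ s) := by gcongr
    _ = K ^ (L + 2) * (K * 2 ^ s) * t ^ s := by
      rw [Real.mul_rpow (by positivity) ht.le]; ring

end modulus

/-! ### Cubes and sampling on random lattices -/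

section sampling
open Filter Topology
variable {d : ℕ}

/-- The open cube with lower corner `b` and side `ℓ`. -/
def openCube (b : EuclideanSpace ℝ (Fin d)) (ℓ : ℝ) : Set (EuclideanSpace ℝ (Fin d)) :=
  {x | ∀ c, b c < x c ∧ x c < b c + ℓ}

/-- The closed cube with lower corner `b` and side `ℓ`. -/
def closedCube (b : EuclideanSpace ℝ (Fin d)) (ℓ : ℝ) : Set (EuclideanSpace ℝ (Fin d)) :=
  {x | ∀ c, b c ≤ x c ∧ x c ≤ b c + ℓ}

lemma openUnitCube_eq : openUnitCube d = openCube 0 1 := by ext; simp [openUnitCube, openCube]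

lemma closedUnitCube_eq : closedUnitCube d = closedCube 0 1 := by
  ext; simp [closedUnitCube, closedCube]

lemma openCube_subset_halfOpenCube (b : EuclideanSpace ℝ (Fin d)) (ℓ : ℝ) :
    openCube b ℓ ⊆ halfOpenCube b ℓ := fun _ hx c => ⟨(hx c).1.le, (hx c).2⟩

lemma halfOpenCube_subset_closedCube (b : EuclideanSpace ℝ (Fin d)) (ℓ : ℝ) :
    halfOpenCube b ℓ ⊆ closedCube b ℓ := fun _ hx c => ⟨(hx c).1, (hx c).2.le⟩

lemma volume_cube_of_pi (S : Fin d → Set ℝ) (ℓ : ℝ) (hS : ∀ c, MeasurableSet (S c))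
    (h : ∀ c, volume (S c) = ENNReal.ofReal ℓ) :
    volume {x : EuclideanSpace ℝ (Fin d) | ∀ c, x c ∈ S c} = ENNReal.ofReal ℓ ^ d := by
  have h1 : {x : EuclideanSpace ℝ (Fin d) | ∀ c, x c ∈ S c} = WithLp.ofLp ⁻¹' (univ.pi S) := by
    ext; simp
  rw [h1, (PiLp.volume_preserving_ofLp (Fin d)).measure_preimage
    (MeasurableSet.univ_pi hS).nullMeasurableSet, volume_pi_pi]
  simp [h]

lemma volume_halfOpenCube (b : EuclideanSpace ℝ (Fin d)) (ℓ : ℝ) :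
    volume (halfOpenCube b ℓ) = ENNReal.ofReal ℓ ^ d :=
  volume_cube_of_pi (fun c => Ico (b c) (b c + ℓ)) ℓ (fun _ => measurableSet_Ico) (by simp)

lemma volume_openCube (b : EuclideanSpace ℝ (Fin d)) (ℓ : ℝ) :
    volume (openCube b ℓ) = ENNReal.ofReal ℓ ^ d :=
  volume_cube_of_pi (fun c => Ioo (b c) (b c + ℓ)) ℓ (fun _ => measurableSet_Ioo) (by simp)

lemma volume_closedCube (b : EuclideanSpace ℝ (Fin d)) (ℓ : ℝ) :
    volume (closedCube b ℓ) = ENNReal.ofReal ℓ ^ d :=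
  volume_cube_of_pi (fun c => Icc (b c) (b c + ℓ)) ℓ (fun _ => measurableSet_Icc) (by simp)

lemma volume_openUnitCube : volume (openUnitCube d) = 1 := by
  rw [openUnitCube_eq, volume_openCube]; simp

/-- The offset `u` of the lattice is uniformly distributed in the cube, so integrals over `u` are
expectations. -/
instance : IsProbabilityMeasure (volume.restrict (openUnitCube d)) :=
  ⟨by rw [Measure.restrict_apply_univ, volume_openUnitCube]⟩

lemma isOpen_openCube (b : EuclideanSpace ℝ (Fin d)) (ℓ : ℝ) : IsOpen (openCube b ℓ) := by
  have : openCube b ℓ = ⋂ i, {x | b i < x i ∧ x i < b i + ℓ} := by ext; simp [openCube]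
  rw [this]
  refine isOpen_iInter_of_finite fun i => ?_
  have hc : Continuous fun x : EuclideanSpace ℝ (Fin d) => x i := by fun_prop
  exact (isOpen_lt continuous_const hc).inter (isOpen_lt hc continuous_const)

lemma isClosed_closedCube (b : EuclideanSpace ℝ (Fin d)) (ℓ : ℝ) : IsClosed (closedCube b ℓ) := by
  have : closedCube b ℓ = ⋂ i, {x | b i ≤ x i ∧ x i ≤ b i + ℓ} := by ext; simp [closedCube]
  rw [this]
  refine isClosed_iInter fun i => ?_
  have hc : Continuous fun x : EuclideanSpace ℝ (Fin d) => x i := by fun_prop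
  exact (isClosed_le continuous_const hc).inter (isClosed_le hc continuous_const)

lemma measurableSet_halfOpenCube (b : EuclideanSpace ℝ (Fin d)) (ℓ : ℝ) :
    MeasurableSet (halfOpenCube b ℓ) := by
  have : halfOpenCube b ℓ = ⋂ i, {x | b i ≤ x i ∧ x i < b i + ℓ} := by ext; simp [halfOpenCube]
  rw [this]
  refine MeasurableSet.iInter fun i => ?_
  have hc : Measurable fun x : EuclideanSpace ℝ (Fin d) => x i := by fun_prop
  exact (measurableSet_le measurable_const hc).inter (measurableSet_lt hc measurable_const)

lemma isCompact_closedCube (b : EuclideanSpace ℝ (Fin d)) (ℓ : ℝ) : IsCompact (closedCube b ℓ) := by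
  refine Metric.isCompact_of_isClosed_isBounded (isClosed_closedCube b ℓ) ?_
  refine (Metric.isBounded_iff_subset_closedBall b).2 ⟨√(∑ _c : Fin d, ℓ ^ 2), fun x hx => ?_⟩
  rw [Metric.mem_closedBall, EuclideanSpace.dist_eq]
  refine Real.sqrt_le_sqrt (Finset.sum_le_sum fun c _ => ?_)
  have := hx c
  refine pow_le_pow_left₀ dist_nonneg ?_ 2
  rw [Real.dist_eq, abs_le]
  constructor <;> linarith

lemma closedCube_subset_closure (b : EuclideanSpace ℝ (Fin d)) {ℓ : ℝ} (hℓ : 0 < ℓ) :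
    closedCube b ℓ ⊆ closure (openCube b ℓ) := by
  intro x hx
  let z : EuclideanSpace ℝ (Fin d) := WithLp.toLp 2 fun c => b c + ℓ / 2
  have h1 : Tendsto (fun n : ℕ => x + (1 / ((n : ℝ) + 1)) • (z - x)) atTop (𝓝 x) := by
    have := (tendsto_one_div_add_atTop_nhds_zero_nat (𝕜 := ℝ)).smul_const (z - x)
    simpa using this.const_add x
  refine mem_closure_of_tendsto h1 (Eventually.of_forall fun n c => ?_)
  have hc := hx c
  set t : ℝ := 1 / ((n : ℝ) + 1)
  have ht : 0 < t := by positivity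
  have ht1 : t ≤ 1 := by
    rw [div_le_one (by positivity)]; linarith [Nat.cast_nonneg (α := ℝ) n]
  have : (x + t • (z - x)) c = (1 - t) * x c + t * (b c + ℓ / 2) := by
    simp [z]; ring
  rw [this]
  constructor
  · nlinarith [mul_le_mul_of_nonneg_left hc.1 (by linarith : 0 ≤ 1 - t), mul_pos ht hℓ]
  · nlinarith [mul_le_mul_of_nonneg_left hc.2 (by linarith : 0 ≤ 1 - t), mul_pos ht hℓ]

/-- All dyadic refinements of the lattice through `u`. -/
def dyadicLattice (u : EuclideanSpace ℝ (Fin d)) : Set (EuclideanSpace ℝ (Fin d)) :=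
  {x | ∃ (l : ℕ) (n : Fin d → ℤ), x = latticePoint u ((2⁻¹ : ℝ) ^ l) n}

lemma tendsto_latticePoint_floor (u x : EuclideanSpace ℝ (Fin d)) :
    Tendsto (fun l : ℕ => latticePoint u ((2⁻¹ : ℝ) ^ l)
      (fun c => ⌊(x c - u c) / (2⁻¹ : ℝ) ^ l⌋)) atTop (𝓝 x) := by
  have hp : Tendsto (fun l : ℕ => (2⁻¹ : ℝ) ^ l) atTop (𝓝 0) :=
    tendsto_pow_atTop_nhds_zero_of_lt_one (by norm_num) (by norm_num)
  have hcoord : ∀ c, Tendsto (fun l : ℕ => u c + (2⁻¹ : ℝ) ^ l *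
      (⌊(x c - u c) / (2⁻¹ : ℝ) ^ l⌋ : ℤ)) atTop (𝓝 (x c)) := by
    intro c
    refine tendsto_of_tendsto_of_tendsto_of_le_of_le (g := fun l : ℕ => x c - (2⁻¹ : ℝ) ^ l)
      (h := fun _ => x c) (by simpa using hp.const_sub (x c)) tendsto_const_nhds
      (fun l => ?_) (fun l => ?_)
    · have hδ : (0 : ℝ) < (2⁻¹ : ℝ) ^ l := by positivity
      have := Int.sub_one_lt_floor ((x c - u c) / (2⁻¹ : ℝ) ^ l)
      rw [div_sub_one hδ.ne', div_lt_iff₀ hδ] at this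
      dsimp only
      linarith
    · have hδ : (0 : ℝ) < (2⁻¹ : ℝ) ^ l := by positivity
      have := Int.floor_le ((x c - u c) / (2⁻¹ : ℝ) ^ l)
      rw [le_div_iff₀ hδ] at this
      dsimp only
      linarith
  have h2 : Tendsto (fun l : ℕ => (fun c => u c + (2⁻¹ : ℝ) ^ l *
      (⌊(x c - u c) / (2⁻¹ : ℝ) ^ l⌋ : ℤ) : Fin d → ℝ)) atTop (𝓝 x.ofLp) := tendsto_pi_nhds.2 hcoord
  exact (((PiLp.continuous_toLp 2 _).tendsto _).comp h2)

lemma dense_dyadicLattice (u : EuclideanSpace ℝ (Fin d)) : Dense (dyadicLattice u) := fun x =>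
  mem_closure_of_tendsto (tendsto_latticePoint_floor u x) (Eventually.of_forall fun l => ⟨l, _, rfl⟩)

lemma closedCube_subset_closure_inter_dyadicLattice (u b : EuclideanSpace ℝ (Fin d)) {ℓ : ℝ}
    (hℓ : 0 < ℓ) : closedCube b ℓ ⊆ closure (openCube b ℓ ∩ dyadicLattice u) :=
  (closedCube_subset_closure b hℓ).trans (closure_minimal
    ((dense_dyadicLattice u).open_subset_closure_inter (isOpen_openCube b ℓ)) isClosed_closure)

/-- Integer coordinates of lattice points of level `l` in the unit cube. -/
noncomputable def latticeBox (d l : ℕ) : Finset (Fin d → ℤ) :=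
  Fintype.piFinset fun _ => Finset.Ioo (-(2 ^ l : ℤ)) (2 ^ l)

lemma card_latticeBox_le (d l : ℕ) : (latticeBox d l).card ≤ (2 ^ (l + 1)) ^ d := by
  rw [latticeBox, Fintype.card_piFinset]
  simp only [Int.card_Ioo, Finset.prod_const, Finset.card_univ, Fintype.card_fin]
  refine Nat.pow_le_pow_left ?_ d
  have : ((2 : ℤ) ^ l) = ((2 ^ l : ℕ) : ℤ) := by push_cast; rfl
  rw [this, pow_succ]
  omega

lemma mem_latticeBox {u : EuclideanSpace ℝ (Fin d)} {l : ℕ} {n : Fin d → ℤ}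
    (hu : u ∈ openUnitCube d) (hy : latticePoint u ((2⁻¹ : ℝ) ^ l) n ∈ openUnitCube d) :
    n ∈ latticeBox d l := by
  refine Fintype.mem_piFinset.2 fun c => Finset.mem_Ioo.2 ?_
  have h1 := hu c
  have h2 := hy c
  rw [latticePoint_apply] at h2
  have h3 : (2 : ℝ) ^ l * (2⁻¹ : ℝ) ^ l = 1 := by rw [← mul_pow]; norm_num
  have h4 : (0 : ℝ) < 2 ^ l := by positivity
  have e : (2 : ℝ) ^ l * ((2⁻¹ : ℝ) ^ l * n c) = n c := by rw [← mul_assoc, h3, one_mul]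
  constructor
  · have : (2 : ℝ) ^ l * ((2⁻¹ : ℝ) ^ l * n c) > 2 ^ l * (-1) :=
      mul_lt_mul_of_pos_left (by linarith) h4
    rw [e] at this
    have h5 : (-(2 : ℝ) ^ l) < n c := by linarith
    exact_mod_cast h5
  · have : (2 : ℝ) ^ l * ((2⁻¹ : ℝ) ^ l * n c) < 2 ^ l * 1 :=
      mul_lt_mul_of_pos_left (by linarith) h4
    rw [e, mul_one] at this
    exact_mod_cast this

lemma measurable_latticePoint (δ : ℝ) (n : Fin d → ℤ) :
    Measurable fun u : EuclideanSpace ℝ (Fin d) => latticePoint u δ n :=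
  measurable_add_const _

/-- The expected sum of the samples on a random lattice is controlled by the integral. -/
lemma lintegral_sum_latticePoint_le {G : EuclideanSpace ℝ (Fin d) → ℝ≥0∞} (hG : Measurable G)
    (l : ℕ) :
    ∫⁻ u in openUnitCube d, ∑ n ∈ latticeBox d l, G (latticePoint u ((2⁻¹ : ℝ) ^ l) n) ≤
      ((2 : ℝ≥0∞) ^ (l + 1)) ^ d * ∫⁻ x, G x := by
  rw [lintegral_finsetSum (latticeBox d l) (f := fun n u => G (latticePoint u ((2⁻¹ : ℝ) ^ l) n))
    fun n _ => hG.comp (measurable_latticePoint _ n)]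
  refine (Finset.sum_le_card_nsmul _ _ (∫⁻ x, G x) fun n _ => ?_).trans ?_
  · refine (setLIntegral_le_lintegral _ _).trans (le_of_eq ?_)
    exact lintegral_add_right_eq_self G _
  · rw [nsmul_eq_mul]
    gcongr
    exact_mod_cast card_latticeBox_le d l

/-- Almost every lattice avoids a null set. -/
lemma ae_forall_latticePoint_notMem {Z : Set (EuclideanSpace ℝ (Fin d))} (hZ : volume Z = 0) :
    ∀ᵐ u : EuclideanSpace ℝ (Fin d), ∀ (l : ℕ) (n : Fin d → ℤ),
      latticePoint u ((2⁻¹ : ℝ) ^ l) n ∉ Z := by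
  refine ae_all_iff.2 fun l => ae_all_iff.2 fun n => ?_
  exact (measurePreserving_add_right volume _).quasiMeasurePreserving.ae
    (measure_eq_zero_iff_ae_notMem.1 hZ)

lemma volume_closedUnitCube_diff : volume (closedUnitCube d \ openUnitCube d) = 0 := by
  rw [measure_sdiff (by
    rw [openUnitCube_eq, closedUnitCube_eq]
    exact (openCube_subset_halfOpenCube _ _).trans (halfOpenCube_subset_closedCube _ _))
    isOpen_openUnitCube.measurableSet.nullMeasurableSet (by rw [volume_openUnitCube]; simp),
    volume_openUnitCube, closedUnitCube_eq, volume_closedCube]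
  simp

end sampling

/-! ### The continuous representative obtained from the samples -/

section representative
open Filter Topology
variable {d : ℕ}

/-- A cube of side `2^{-j}` inside the half-open unit cube that contains all points of the open unit
cube near a given point of the closed unit cube. -/
lemma exists_halfOpenCube_near {x : EuclideanSpace ℝ (Fin d)} (hx : x ∈ closedUnitCube d) (j : ℕ) :
    ∃ b : EuclideanSpace ℝ (Fin d),
      halfOpenCube b ((2⁻¹ : ℝ) ^ j) ⊆ halfOpenCube 0 ((2⁻¹ : ℝ) ^ 0) ∧
      ∀ y ∈ openUnitCube d, (∀ c, |y c - x c| < (2⁻¹ : ℝ) ^ j / 2) →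
        y ∈ halfOpenCube b ((2⁻¹ : ℝ) ^ j) := by
  set δ : ℝ := (2⁻¹ : ℝ) ^ j
  have hδ1 : δ ≤ 1 := pow_le_one₀ (by norm_num) (by norm_num)
  -- The cube centred at `x`, pushed back into the unit cube where it sticks out.
  refine ⟨WithLp.toLp 2 fun c => max 0 (min (x c - δ / 2) (1 - δ)), fun y hy c => ?_,
    fun y hy hyx c => ?_⟩
  · have h := hy c
    simp only [PiLp.zero_apply, pow_zero, zero_add] at h ⊢
    have h1 : max 0 (min (x c - δ / 2) (1 - δ)) ≤ 1 - δ :=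
      max_le (by linarith) (min_le_right _ _)
    exact ⟨(le_max_left _ _).trans h.1, by linarith⟩
  · have h := hy c
    have h2 := abs_lt.1 (hyx c)
    have h3 := hx c
    dsimp only
    rcases max_cases 0 (min (x c - δ / 2) (1 - δ)) with ⟨e, h4⟩ | ⟨e, h4⟩ <;>
    rcases min_cases (x c - δ / 2) (1 - δ) with ⟨e', h5⟩ | ⟨e', h5⟩ <;>
    rw [e] <;> (try rw [e']) <;> (try rw [e'] at h4) <;> constructor <;> linarith

/-- A function whose differences on the dyadic refinements of a lattice decay geometrically agrees
on the lattice with a continuous function on the closed cube. -/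
theorem exists_continuousOn_eq_on_dyadicLattice {N μ : ℕ}
    (hm : (N + 1) * (d * (N + 1) + (N + 1) + 1) ≤ 2 ^ μ) (hm2 : 2 * (N + 1) ≤ 2 ^ μ)
    {ρ : ℝ} (hρ : 0 < ρ) (hρ1 : ρ < 1) {f : EuclideanSpace ℝ (Fin d) → ℝ}
    {u : EuclideanSpace ℝ (Fin d)} {M : ℝ} (hM : 0 ≤ M)
    (hf : DyadicDiffBound N (2 ^ μ) f u (halfOpenCube 0 ((2⁻¹ : ℝ) ^ 0)) 0 M ρ) :
    ∃ g : EuclideanSpace ℝ (Fin d) → ℝ, ContinuousOn g (closedUnitCube d) ∧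
      ∀ y ∈ dyadicLattice u, y ∈ openUnitCube d → g y = f y := by
  obtain ⟨C, hC, hCf⟩ := exists_polyFun_near_on_lattices d N μ hm hm2 hρ hρ1
  set A := openUnitCube d ∩ dyadicLattice u with hA
  have hcl : closedUnitCube d ⊆ closure A := by
    rw [hA, openUnitCube_eq, closedUnitCube_eq]
    exact closedCube_subset_closure_inter_dyadicLattice u 0 one_pos
  -- The values of `f` on the lattice satisfy the Cauchy criterion at `x`: near `x` they are within
  -- `C M ρ^j` of a polynomial, which is continuous.
  have hlim : ∀ x ∈ closedUnitCube d, ∃ y, Tendsto f (𝓝[A] x) (𝓝 y) := by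
    intro x hx
    have : (𝓝[A] x).NeBot := mem_closure_iff_nhdsWithin_neBot.1 (hcl hx)
    rw [← cauchy_map_iff_exists_tendsto, Metric.cauchy_iff]
    refine ⟨inferInstance, fun ε hε => ?_⟩
    obtain ⟨j, hj⟩ : ∃ j : ℕ, C * (M * ρ ^ j) < ε / 4 := by
      have : Tendsto (fun j : ℕ => C * (M * ρ ^ j)) atTop (𝓝 (C * (M * 0))) :=
        ((tendsto_pow_atTop_nhds_zero_of_lt_one hρ.le hρ1).const_mul M).const_mul C
      rw [mul_zero, mul_zero] at this
      exact (this.eventually_lt_const (by positivity)).exists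
    obtain ⟨b, hb1, hb2⟩ := exists_halfOpenCube_near hx j
    obtain ⟨F, hF, hFf⟩ := hCf f u b j M hM (hf.mono hb1 (Nat.zero_le j))
    have hFc : ContinuousAt F x := (contDiff_of_mem_polyFun hF).continuous.continuousAt
    have hV1 : ∀ᶠ y in 𝓝[A] x, |F y - F x| < ε / 4 := by
      have := (Metric.tendsto_nhds.1 hFc.tendsto) (ε / 4) (by positivity)
      exact (this.filter_mono nhdsWithin_le_nhds)
    have hV2 : ∀ᶠ y in 𝓝[A] x, ∀ c, |y c - x c| < (2⁻¹ : ℝ) ^ j / 2 := by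
      refine Filter.Eventually.filter_mono nhdsWithin_le_nhds (eventually_all.2 fun c => ?_)
      have hc : Continuous fun x : EuclideanSpace ℝ (Fin d) => x c := by fun_prop
      exact (Metric.tendsto_nhds.1 hc.continuousAt.tendsto) ((2⁻¹ : ℝ) ^ j / 2) (by positivity)
    have hV : ∀ᶠ y in 𝓝[A] x, |f y - F x| < ε / 2 := by
      filter_upwards [hV1, hV2, self_mem_nhdsWithin] with y h1 h2 h3
      obtain ⟨hy, l, n, rfl⟩ := h3
      have h4 := hFf l n (hb2 _ hy h2)
      refine (abs_sub_le _ (F (latticePoint u ((2⁻¹ : ℝ) ^ l) n)) _).trans_lt ?_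
      linarith
    refine ⟨f '' {y | |f y - F x| < ε / 2}, image_mem_map hV, ?_⟩
    rintro _ ⟨y, hy, rfl⟩ _ ⟨z, hz, rfl⟩
    have hy' : |f y - F x| < ε / 2 := hy
    have hz' : |f z - F x| < ε / 2 := hz
    rw [Real.dist_eq]
    calc |f y - f z| ≤ |f y - F x| + |F x - f z| := abs_sub_le _ _ _
      _ < ε := by rw [abs_sub_comm (F x)]; linarith
  refine ⟨extendFrom A f, continuousOn_extendFrom hcl hlim, fun y hy hyΩ => ?_⟩
  have hyA : y ∈ A := ⟨hyΩ, hy⟩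
  obtain ⟨z, hz⟩ := hlim y (fun c => ⟨(hyΩ c).1.le, (hyΩ c).2.le⟩)
  have : (𝓝[A] y).NeBot := mem_closure_iff_nhdsWithin_neBot.1 (subset_closure hyA)
  rw [extendFrom_eq (subset_closure hyA) hz]
  exact (tendsto_nhds_unique ((tendsto_pure_nhds f y).mono_right le_rfl)
    (hz.mono_left (pure_le_nhdsWithin hyA))).symm

lemma ENNReal.enorm_add_add_rpow_le {p : ℝ} (hp : 0 < p) (a b c : ℝ≥0∞) :
    (a + b + c) ^ p ≤ 3 ^ p * (a ^ p + b ^ p + c ^ p) := by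
  have := ENNReal.sum_rpow_le_card_rpow_mul Finset.univ ![a, b, c] hp
  simpa [Fin.sum_univ_three] using this

/-- If on a sequence of lattices the samples of `f` and of continuous approximations of `f` are close
on average, then `f` agrees a.e. with any continuous function which has the same samples. -/
lemma ae_eq_of_sampling {p : ℝ} (hp : 0 < p) {f g : EuclideanSpace ℝ (Fin d) → ℝ}
    {φ : ℕ → EuclideanSpace ℝ (Fin d) → ℝ} {i : ℕ → ℕ}
    {u : EuclideanSpace ℝ (Fin d)} (hu : u ∈ openUnitCube d) (hf : Measurable f)
    (hφ : ∀ m, Measurable (φ m)) (hi : Tendsto i atTop atTop)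
    (hosc : ∀ m x y, (∀ c, |x c - y c| ≤ (2⁻¹ : ℝ) ^ i m) → |φ m x - φ m y| ≤ (2⁻¹ : ℝ) ^ m)
    (hint : Tendsto (fun m => ∫⁻ x in openUnitCube d, ‖f x - φ m x‖ₑ ^ p) atTop (𝓝 0))
    (hsamp : Tendsto (fun m => (ENNReal.ofReal ((2⁻¹ : ℝ) ^ i m)) ^ d * ∑ n ∈ latticeBox d (i m),
      (openUnitCube d).indicator (fun x => ‖f x - φ m x‖ₑ ^ p)
        (latticePoint u ((2⁻¹ : ℝ) ^ i m) n)) atTop (𝓝 0))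
    (hg : ContinuousOn g (closedUnitCube d))
    (hgf : ∀ y ∈ dyadicLattice u, y ∈ openUnitCube d → g y = f y) :
    f =ᵐ[volume.restrict (openUnitCube d)] g := by
  have hsubc : openUnitCube d ⊆ closedUnitCube d := fun x hx c => ⟨(hx c).1.le, (hx c).2.le⟩
  have hgu : UniformContinuousOn g (closedUnitCube d) := by
    refine IsCompact.uniformContinuousOn_of_continuous ?_ hg
    rw [closedUnitCube_eq]; exact isCompact_closedCube _ _
  have hgm : AEMeasurable g (volume.restrict (openUnitCube d)) :=
    (hg.mono hsubc).aemeasurable isOpen_openUnitCube.measurableSet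
  have hp2 : Tendsto (fun l : ℕ => (2⁻¹ : ℝ) ^ l) atTop (𝓝 0) :=
    tendsto_pow_atTop_nhds_zero_of_lt_one (by norm_num) (by norm_num)
  -- Below, `x` is rounded down to a lattice point. Its distance from the lower faces keeps that
  -- point in the open cube once the mesh is finer than `η`.
  have key : ∀ η : ℝ, 0 < η → ∀ᵐ x ∂(volume.restrict (openUnitCube d)),
      (∀ c, η < x c) → f x = g x := by
    intro η hη
    set S : Set (EuclideanSpace ℝ (Fin d)) := {x | ∀ c, η < x c}
    have hS : MeasurableSet S := by
      have : S = ⋂ c, {x | η < x c} := by ext; simp [S]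
      rw [this]
      refine MeasurableSet.iInter fun c => measurableSet_lt measurable_const ?_
      fun_prop
    have hzero : ∫⁻ x in openUnitCube d, S.indicator (fun x => ‖f x - g x‖ₑ ^ p) x = 0 := by
      refine le_antisymm (ENNReal.le_of_forall_pos_le_add fun ε hε _ => ?_) zero_le
      rw [zero_add]
      have hε' : (0 : ℝ≥0∞) < ε := by exact_mod_cast hε
      -- the three error terms
      have h3 : (3 : ℝ≥0∞) ^ p ≠ ⊤ := ENNReal.rpow_ne_top_of_nonneg hp.le (by simp)
      obtain ⟨e, he0, hee⟩ : ∃ e : ℝ, 0 < e ∧ (3 : ℝ≥0∞) ^ p * ENNReal.ofReal e ^ p < ε / 2 := by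
        have : Tendsto (fun e : ℝ => (3 : ℝ≥0∞) ^ p * ENNReal.ofReal e ^ p) (𝓝[>] 0) (𝓝 0) := by
          have h1 : Tendsto (fun e : ℝ => ENNReal.ofReal e ^ p) (𝓝[>] 0) (𝓝 0) := by
            have : Tendsto (fun e : ℝ => ENNReal.ofReal e) (𝓝[>] 0) (𝓝 0) := by
              rw [← ENNReal.ofReal_zero]
              exact (ENNReal.continuous_ofReal.tendsto 0).mono_left nhdsWithin_le_nhds
            have := this.ennrpow_const p
            rwa [ENNReal.zero_rpow_of_pos hp] at this
          have := ENNReal.Tendsto.const_mul h1 (Or.inr h3)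
          rwa [mul_zero] at this
        obtain ⟨e, h1, h2⟩ := ((this.eventually_lt_const
          (ENNReal.div_pos hε'.ne' (by simp : (2:ℝ≥0∞) ≠ ⊤))).and self_mem_nhdsWithin).exists
        exact ⟨e, h2, h1⟩
      obtain ⟨τ, hτ, hgτ⟩ := Metric.uniformContinuousOn_iff.1 hgu (e / 2) (by positivity)
      have hev1 : ∀ᶠ m in atTop, (2⁻¹ : ℝ) ^ m < e / 2 :=
        hp2.eventually_lt_const (by positivity)
      have hev2 : ∀ᶠ m in atTop, (2⁻¹ : ℝ) ^ i m < η := (hp2.comp hi).eventually_lt_const hη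
      have hev3 : ∀ᶠ m in atTop, (2⁻¹ : ℝ) ^ i m * √d < τ := by
        have := (hp2.comp hi).mul_const (√d)
        rw [zero_mul] at this
        exact this.eventually_lt_const hτ
      have hev4 : ∀ᶠ m in atTop, (3 : ℝ≥0∞) ^ p * ((∫⁻ x in openUnitCube d, ‖f x - φ m x‖ₑ ^ p) +
          (ENNReal.ofReal ((2⁻¹ : ℝ) ^ i m)) ^ d * ∑ n ∈ latticeBox d (i m),
      (openUnitCube d).indicator (fun x => ‖f x - φ m x‖ₑ ^ p)
        (latticePoint u ((2⁻¹ : ℝ) ^ i m) n)) < ε / 2 := by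
        have := ENNReal.Tendsto.const_mul (hint.add hsamp) (Or.inr h3)
        rw [add_zero, mul_zero] at this
        exact this.eventually_lt_const (ENNReal.div_pos hε'.ne' (by simp : (2:ℝ≥0∞) ≠ ⊤))
      obtain ⟨m, hm1, hm2, hm3, hm4⟩ := (hev1.and (hev2.and (hev3.and hev4))).exists
      set δ : ℝ := (2⁻¹ : ℝ) ^ i m with hδdef
      have hδ : 0 < δ := by positivity
      set H : EuclideanSpace ℝ (Fin d) → ℝ≥0∞ :=
        (openUnitCube d).indicator (fun x => ‖f x - φ m x‖ₑ ^ p)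
      -- Let `y` be the lattice point below `x`. As `g y = f y`, the error `f x - g x` is split into
      -- the errors of `φ` at `x` and at `y` and the oscillations of `φ` and `g` between them; both
      -- oscillations are at most `e / 2`.
      have hpt : ∀ x ∈ openUnitCube d, S.indicator (fun x => ‖f x - g x‖ₑ ^ p) x ≤
          3 ^ p * (‖f x - φ m x‖ₑ ^ p + (∑ n ∈ latticeBox d (i m),
            (halfOpenCube (latticePoint u δ n) δ).indicator
              (fun _ => H (latticePoint u δ n)) x) + ENNReal.ofReal e ^ p) := by
        intro x hx
        by_cases hxS : x ∈ S
        swap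
        · rw [indicator_of_notMem hxS]; exact zero_le
        rw [indicator_of_mem hxS]
        set n : Fin d → ℤ := fun c => ⌊(x c - u c) / δ⌋
        set y := latticePoint u δ n with hy
        have hyx : ∀ c, x c - δ < y c ∧ y c ≤ x c := by
          intro c
          have h1 := Int.sub_one_lt_floor ((x c - u c) / δ)
          have h2 := Int.floor_le ((x c - u c) / δ)
          rw [div_sub_one hδ.ne', div_lt_iff₀ hδ] at h1
          rw [le_div_iff₀ hδ] at h2
          simp only [hy, latticePoint_apply, n]
          constructor <;> linarith
        have hyΩ : y ∈ openUnitCube d := fun c => by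
          have h1 := hyx c
          have h2 := hxS c
          have h3 := hx c
          constructor <;> linarith
        have habs : ∀ c, |x c - y c| ≤ δ := fun c => by
          have h1 := hyx c
          rw [abs_le]; constructor <;> linarith
        have hn : n ∈ latticeBox d (i m) := mem_latticeBox hu hyΩ
        have hterm : ‖f y - φ m y‖ₑ ^ p ≤ ∑ n ∈ latticeBox d (i m),
            (halfOpenCube (latticePoint u δ n) δ).indicator
              (fun _ => H (latticePoint u δ n)) x := by
          refine le_trans ?_ (Finset.single_le_sum (f := fun n =>
            (halfOpenCube (latticePoint u δ n) δ).indicator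
              (fun _ => H (latticePoint u δ n)) x) (fun _ _ => zero_le) hn)
          rw [indicator_of_mem (show x ∈ halfOpenCube (latticePoint u δ n) δ from fun c => by
            have h1 := hyx c
            rw [hy] at h1
            constructor <;> linarith)]
          simp only [H]
          rw [← hy, indicator_of_mem hyΩ]
        have hgy : g y = f y := hgf y ⟨_, _, rfl⟩ hyΩ
        have hdist : dist x y < τ := by
          refine lt_of_le_of_lt ?_ hm3
          rw [EuclideanSpace.dist_eq]
          calc √(∑ c, dist (x c) (y c) ^ 2) ≤ √(∑ _c : Fin d, δ ^ 2) := by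
                refine Real.sqrt_le_sqrt (Finset.sum_le_sum fun c _ => ?_)
                exact pow_le_pow_left₀ dist_nonneg (habs c) 2
            _ = δ * √d := by
                rw [Finset.sum_const, Finset.card_univ, Fintype.card_fin, nsmul_eq_mul,
                  Real.sqrt_mul (Nat.cast_nonneg _), Real.sqrt_sq hδ.le, mul_comm]
        have hgxy : |g y - g x| < e / 2 := by
          have := hgτ x (hsubc hx) y (hsubc hyΩ) hdist
          rwa [dist_comm, Real.dist_eq] at this
        have hφxy : |φ m x - φ m y| < e / 2 := (hosc m x y habs).trans_lt hm1
        have hsplit : ‖f x - g x‖ₑ ≤ ‖f x - φ m x‖ₑ + ‖f y - φ m y‖ₑ + ENNReal.ofReal e := by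
          rw [Real.enorm_eq_ofReal_abs, Real.enorm_eq_ofReal_abs, Real.enorm_eq_ofReal_abs,
            ← ENNReal.ofReal_add (abs_nonneg _) (abs_nonneg _),
            ← ENNReal.ofReal_add (by positivity) he0.le]
          refine ENNReal.ofReal_le_ofReal ?_
          rw [hgy] at hgxy
          have e1 : f x - g x = (f x - φ m x) + (φ m x - φ m y) + (-(f y - φ m y)) + (f y - g x) := by
            ring
          rw [e1]
          refine (abs_add_le _ _).trans ?_
          have e2 := abs_add_three (f x - φ m x) (φ m x - φ m y) (-(f y - φ m y))
          rw [abs_neg] at e2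
          linarith
        refine (ENNReal.rpow_le_rpow hsplit hp.le).trans
          ((ENNReal.enorm_add_add_rpow_le hp _ _ _).trans ?_)
        gcongr
      have hmI : Measurable fun x => ∑ n ∈ latticeBox d (i m),
            (halfOpenCube (latticePoint u δ n) δ).indicator
              (fun _ => H (latticePoint u δ n)) x :=
        Finset.measurable_sum _ fun n _ =>
          measurable_const.indicator (measurableSet_halfOpenCube _ _)
      have hmf : Measurable fun x => ‖f x - φ m x‖ₑ ^ p :=
        ((hf.sub (hφ m)).enorm).pow_const p
      calc ∫⁻ x in openUnitCube d, S.indicator (fun x => ‖f x - g x‖ₑ ^ p) x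
          ≤ ∫⁻ x in openUnitCube d, 3 ^ p * (‖f x - φ m x‖ₑ ^ p + (∑ n ∈ latticeBox d (i m),
            (halfOpenCube (latticePoint u δ n) δ).indicator
              (fun _ => H (latticePoint u δ n)) x) + ENNReal.ofReal e ^ p) :=
            setLIntegral_mono' isOpen_openUnitCube.measurableSet hpt
        _ = 3 ^ p * ((∫⁻ x in openUnitCube d, ‖f x - φ m x‖ₑ ^ p) +
              (∫⁻ x in openUnitCube d, ∑ n ∈ latticeBox d (i m),
              (halfOpenCube (latticePoint u δ n) δ).indicator
              (fun _ => H (latticePoint u δ n)) x) + ENNReal.ofReal e ^ p) := by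
            have hmfI : Measurable fun x => ‖f x - φ m x‖ₑ ^ p + ∑ n ∈ latticeBox d (i m),
                (halfOpenCube (latticePoint u δ n) δ).indicator
                  (fun _ => H (latticePoint u δ n)) x := hmf.add hmI
            rw [lintegral_const_mul' _ _ h3, lintegral_add_left hmfI, lintegral_add_left hmf,
              lintegral_const, measure_univ, mul_one]
        _ ≤ 3 ^ p * ((∫⁻ x in openUnitCube d, ‖f x - φ m x‖ₑ ^ p) +
              ENNReal.ofReal δ ^ d * ∑ n ∈ latticeBox d (i m), H (latticePoint u δ n) +
              ENNReal.ofReal e ^ p) := by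
            gcongr
            rw [lintegral_finsetSum _ fun n _ =>
              measurable_const.indicator (measurableSet_halfOpenCube _ _), Finset.mul_sum]
            refine Finset.sum_le_sum fun n _ => ?_
            refine (setLIntegral_le_lintegral _ _).trans ?_
            rw [lintegral_indicator_const (measurableSet_halfOpenCube _ _), volume_halfOpenCube,
              mul_comm]
        _ ≤ ε / 2 + ε / 2 := by
            rw [mul_add]
            exact add_le_add hm4.le hee.le
        _ = ε := ENNReal.add_halves _
    have hae := (lintegral_eq_zero_iff' ?_).1 hzero
    · filter_upwards [hae] with x hx hxS
      rw [indicator_of_mem (show x ∈ S from hxS), Pi.zero_apply,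
        ENNReal.rpow_eq_zero_iff_of_pos hp, enorm_eq_zero, sub_eq_zero] at hx
      exact hx
    · exact ((hf.aemeasurable.sub hgm).enorm.pow_const p).indicator hS
  -- The countably many margins `1/(k+1)` exhaust the open cube.
  have hall := ae_all_iff.2 fun k : ℕ => key (1 / ((k : ℝ) + 1)) (by positivity)
  filter_upwards [hall, ae_restrict_mem isOpen_openUnitCube.measurableSet] with x hx hxΩ
  have : ∀ᶠ k : ℕ in atTop, ∀ c, 1 / ((k : ℝ) + 1) < x c := eventually_all.2 fun c =>
    (tendsto_one_div_add_atTop_nhds_zero_nat (𝕜 := ℝ)).eventually_lt_const (hxΩ c).1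
  obtain ⟨k, hk⟩ := this.exists
  exact hx k hk

/-- Almost every lattice samples well a suitable sequence of continuous approximations. -/
lemma exists_approximation_sampling {p : ℝ} (hp : 0 < p) {f : EuclideanSpace ℝ (Fin d) → ℝ}
    (hf : Measurable f) (hfp : MemLp f (ENNReal.ofReal p) (volume.restrict (openUnitCube d))) :
    ∃ (φ : ℕ → EuclideanSpace ℝ (Fin d) → ℝ) (i : ℕ → ℕ), (∀ m, Measurable (φ m)) ∧
      Tendsto i atTop atTop ∧
      (∀ m x y, (∀ c, |x c - y c| ≤ (2⁻¹ : ℝ) ^ i m) → |φ m x - φ m y| ≤ (2⁻¹ : ℝ) ^ m) ∧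
      Tendsto (fun m => ∫⁻ x in openUnitCube d, ‖f x - φ m x‖ₑ ^ p) atTop (𝓝 0) ∧
      ∀ᵐ u ∂(volume.restrict (openUnitCube d)),
        Tendsto (fun m => (ENNReal.ofReal ((2⁻¹ : ℝ) ^ i m)) ^ d * ∑ n ∈ latticeBox d (i m),
          (openUnitCube d).indicator (fun x => ‖f x - φ m x‖ₑ ^ p)
            (latticePoint u ((2⁻¹ : ℝ) ^ i m) n)) atTop (𝓝 0) := by
  have hex : ∀ m : ℕ, ∃ φ : EuclideanSpace ℝ (Fin d) → ℝ, HasCompactSupport φ ∧ Continuous φ ∧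
      ∫⁻ x in openUnitCube d, ‖f x - φ x‖ₑ ^ p ≤ 2⁻¹ ^ m := by
    intro m
    obtain ⟨φ, h1, h2, h3, -⟩ := hfp.exists_hasCompactSupport_eLpNorm_sub_le
      ENNReal.ofReal_ne_top (ε := ((2 : ℝ≥0∞)⁻¹ ^ m) ^ (1 / p)) (by simp)
    refine ⟨φ, h1, h3, ?_⟩
    rw [eLpNorm_eq_lintegral_rpow_enorm_toReal (by simpa using hp) ENNReal.ofReal_ne_top,
      ENNReal.toReal_ofReal hp.le, ENNReal.rpow_le_rpow_iff (by positivity)] at h2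
    exact h2
  choose φ hφ1 hφ2 hφ3 using hex
  have hosc : ∀ m, ∃ i : ℕ, m ≤ i ∧
      ∀ x y, (∀ c, |x c - y c| ≤ (2⁻¹ : ℝ) ^ i) → |φ m x - φ m y| ≤ (2⁻¹ : ℝ) ^ m := by
    intro m
    have huc := (hφ1 m).uniformContinuous_of_continuous (hφ2 m)
    obtain ⟨τ, hτ, h⟩ := Metric.uniformContinuous_iff.1 huc ((2⁻¹ : ℝ) ^ m) (by positivity)
    have h1 : Tendsto (fun i : ℕ => (2⁻¹ : ℝ) ^ i * √d) atTop (𝓝 0) := by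
      have := (tendsto_pow_atTop_nhds_zero_of_lt_one (r := (2⁻¹ : ℝ)) (by norm_num)
        (by norm_num)).mul_const (√d)
      rwa [zero_mul] at this
    obtain ⟨i, hi1, hi2⟩ := ((h1.eventually_lt_const hτ).and (eventually_ge_atTop m)).exists
    refine ⟨i, hi2, fun x y hxy => ?_⟩
    have := h (a := x) (b := y) (by
      refine lt_of_le_of_lt ?_ hi1
      rw [EuclideanSpace.dist_eq]
      calc √(∑ c, dist (x c) (y c) ^ 2) ≤ √(∑ _c : Fin d, ((2⁻¹ : ℝ) ^ i) ^ 2) := by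
            refine Real.sqrt_le_sqrt (Finset.sum_le_sum fun c _ => ?_)
            exact pow_le_pow_left₀ dist_nonneg (hxy c) 2
        _ = (2⁻¹ : ℝ) ^ i * √d := by
            rw [Finset.sum_const, Finset.card_univ, Fintype.card_fin, nsmul_eq_mul,
              Real.sqrt_mul (Nat.cast_nonneg _), Real.sqrt_sq (by positivity), mul_comm])
    rw [Real.dist_eq] at this
    exact this.le
  choose i hi1 hi2 using hosc
  have hhalf : Tendsto (fun m : ℕ => (2⁻¹ : ℝ≥0∞) ^ m) atTop (𝓝 0) :=
    ENNReal.tendsto_pow_atTop_nhds_zero_of_lt_one ENNReal.one_half_lt_one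
  refine ⟨φ, i, fun m => (hφ2 m).measurable, tendsto_atTop_mono hi1 tendsto_id, hi2,
    tendsto_of_tendsto_of_tendsto_of_le_of_le tendsto_const_nhds hhalf (fun _ => zero_le) hφ3, ?_⟩
  set Φ : ℕ → EuclideanSpace ℝ (Fin d) → ℝ≥0∞ := fun m u =>
    (ENNReal.ofReal ((2⁻¹ : ℝ) ^ i m)) ^ d * ∑ n ∈ latticeBox d (i m),
          (openUnitCube d).indicator (fun x => ‖f x - φ m x‖ₑ ^ p)
            (latticePoint u ((2⁻¹ : ℝ) ^ i m) n) with hΦ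
  have hG : ∀ m, Measurable ((openUnitCube d).indicator (fun x => ‖f x - φ m x‖ₑ ^ p)) := fun m =>
    (((hf.sub (hφ2 m).measurable).enorm).pow_const p).indicator isOpen_openUnitCube.measurableSet
  have hΦs : ∀ m, Measurable fun u => ∑ n ∈ latticeBox d (i m),
          (openUnitCube d).indicator (fun x => ‖f x - φ m x‖ₑ ^ p)
            (latticePoint u ((2⁻¹ : ℝ) ^ i m) n) := fun m =>
    Finset.measurable_sum _ fun n _ => (hG m).comp (measurable_latticePoint _ n)
  have hΦm : ∀ m, Measurable (Φ m) := fun m => (hΦs m).const_mul _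
  -- There are at most `2^{(i+1)d}` lattice indices and each carries the weight `2^{-id}`, so the
  -- mean sampling error is at most `2^d` times the integral error.
  have hΦi : ∀ m, ∫⁻ u in openUnitCube d, Φ m u ≤ 2 ^ d * 2⁻¹ ^ m := by
    intro m
    rw [lintegral_const_mul _ (hΦs m)]
    have h1 := lintegral_sum_latticePoint_le (hG m) (i m)
    rw [lintegral_indicator isOpen_openUnitCube.measurableSet] at h1
    refine (mul_le_mul_right h1 _).trans ?_
    rw [← mul_assoc, ← mul_pow]
    gcongr
    · rw [ENNReal.ofReal_pow (by norm_num), ENNReal.ofReal_inv_of_pos two_pos, pow_succ, ← mul_assoc,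
        ← mul_pow]
      norm_num
      rw [ENNReal.inv_mul_cancel (by simp) (by simp)]
      simp
    · exact hφ3 m
  -- Borel–Cantelli argument: the expectations are summable, so the series converges for almost
  -- every `u` and its terms tend to zero.
  have hsum : ∫⁻ u in openUnitCube d, ∑' m, Φ m u ≠ ⊤ := by
    rw [lintegral_tsum fun m => (hΦm m).aemeasurable]
    refine ne_top_of_le_ne_top ?_ (ENNReal.tsum_le_tsum hΦi)
    rw [ENNReal.tsum_mul_left, ENNReal.tsum_geometric]
    refine ENNReal.mul_ne_top (by simp) ?_
    rw [ENNReal.one_sub_inv_two, inv_inv]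
    simp
  filter_upwards [ae_lt_top (Measurable.tsum hΦm) hsum] with u hu
  exact ENNReal.tendsto_atTop_zero_of_tsum_ne_top hu.ne

end representative

/-! ### Energy of the differences on a random lattice -/

section energy
open Filter Topology
variable {d : ℕ}

/-- The step with integer coordinates `h` in units of `2^{-l}`. -/
noncomputable def dyadicStep (l : ℕ) (h : Fin d → ℕ) : EuclideanSpace ℝ (Fin d) :=
  (2⁻¹ : ℝ) ^ l • WithLp.toLp 2 fun c => (h c : ℝ)

/-- The `p`-th power of a difference of order `r`, where the step stays in the unit cube. -/
noncomputable def diffDensity (r : ℕ) (p : ℝ) (f : EuclideanSpace ℝ (Fin d) → ℝ)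
    (η : EuclideanSpace ℝ (Fin d)) : EuclideanSpace ℝ (Fin d) → ℝ≥0∞ :=
  (shiftDomain (openUnitCube d) ((r : ℝ) • η)).indicator fun x => ‖(fwdDiff η)^[r] f x‖ₑ ^ p

/-- The sum of the `p`-th powers of the differences of level `l` of the samples in `Q`. -/
noncomputable def levelEnergy (r m : ℕ) (p : ℝ) (f : EuclideanSpace ℝ (Fin d) → ℝ)
    (Q : Set (EuclideanSpace ℝ (Fin d))) (l : ℕ) (u : EuclideanSpace ℝ (Fin d)) : ℝ≥0∞ :=
  ∑ n ∈ latticeBox d l, ∑ h ∈ Fintype.piFinset fun _ : Fin d => Finset.range m,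
    Q.indicator (diffDensity r p f (dyadicStep l h)) (latticePoint u ((2⁻¹ : ℝ) ^ l) n)

/-- The weighted sum of the energies of all levels `l ≥ j`. -/
noncomputable def sampleEnergy (r m : ℕ) (p ρ : ℝ) (f : EuclideanSpace ℝ (Fin d) → ℝ)
    (Q : Set (EuclideanSpace ℝ (Fin d))) (j : ℕ) (u : EuclideanSpace ℝ (Fin d)) : ℝ≥0∞ :=
  ∑' i, ENNReal.ofReal ((ρ ^ (j + i)) ^ (-p)) * levelEnergy r m p f Q (j + i) u

lemma norm_dyadicStep_le {l m : ℕ} {h : Fin d → ℕ} (hh : ∀ c, h c < m) :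
    ‖dyadicStep l h‖ ≤ ((d * m : ℕ) : ℝ) * (2⁻¹ : ℝ) ^ l := by
  rw [dyadicStep, norm_smul, mul_comm, Real.norm_of_nonneg (by positivity)]
  gcongr
  rw [EuclideanSpace.norm_eq]
  refine Real.sqrt_le_iff.2 ⟨by positivity, ?_⟩
  calc ∑ c, ‖(h c : ℝ)‖ ^ 2 ≤ ∑ _c : Fin d, (m : ℝ) ^ 2 := by
        refine Finset.sum_le_sum fun c _ => ?_
        rw [Real.norm_of_nonneg (Nat.cast_nonneg _)]
        have : (h c : ℝ) ≤ m := by exact_mod_cast (hh c).le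
        gcongr
    _ = d * (m : ℝ) ^ 2 := by simp
    _ ≤ ((d * m : ℕ) : ℝ) ^ 2 := by
        push_cast
        rw [mul_pow]
        gcongr
        exact_mod_cast Nat.le_self_pow two_ne_zero d

lemma measurable_diffDensity (r : ℕ) (p : ℝ) {f : EuclideanSpace ℝ (Fin d) → ℝ}
    (hf : Measurable f) (η : EuclideanSpace ℝ (Fin d)) : Measurable (diffDensity r p f η) :=
  (((measurable_fwdDiff_iter hf η r).enorm).pow_const p).indicator (measurableSet_shiftDomain _)

lemma lintegral_diffDensity (r : ℕ) (p : ℝ) (f : EuclideanSpace ℝ (Fin d) → ℝ)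
    (η : EuclideanSpace ℝ (Fin d)) : ∫⁻ x, diffDensity r p f η x = diffInt r p f η := by
  rw [diffDensity, lintegral_indicator (measurableSet_shiftDomain _)]; rfl

lemma measurable_levelEnergy (r m : ℕ) (p : ℝ) {f : EuclideanSpace ℝ (Fin d) → ℝ}
    (hf : Measurable f) {Q : Set (EuclideanSpace ℝ (Fin d))} (hQ : MeasurableSet Q) (l : ℕ) :
    Measurable (levelEnergy r m p f Q l) :=
  Finset.measurable_sum _ fun n _ => Finset.measurable_sum _ fun _ _ =>
    ((measurable_diffDensity r p hf _).indicator hQ).comp (measurable_latticePoint _ n)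

lemma lintegral_levelEnergy_le (r m : ℕ) (p : ℝ) {f : EuclideanSpace ℝ (Fin d) → ℝ}
    (hf : Measurable f) (l : ℕ) {D : ℝ≥0∞}
    (hD : ∀ h : Fin d → ℕ, (∀ c, h c < m) → diffInt r p f (dyadicStep l h) ≤ D) :
    ∫⁻ u in openUnitCube d, levelEnergy r m p f univ l u ≤ m ^ d * (((2 : ℝ≥0∞) ^ (l + 1)) ^ d * D) := by
  have e : levelEnergy r m p f univ l = fun u =>
      ∑ h ∈ Fintype.piFinset fun _ : Fin d => Finset.range m, ∑ n ∈ latticeBox d l,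
        diffDensity r p f (dyadicStep l h) (latticePoint u ((2⁻¹ : ℝ) ^ l) n) := by
    ext u
    rw [levelEnergy, Finset.sum_comm]
    simp only [indicator_univ]
  have hm : ∀ h, Measurable fun u => ∑ n ∈ latticeBox d l,
      diffDensity r p f (dyadicStep l h) (latticePoint u ((2⁻¹ : ℝ) ^ l) n) := fun h =>
    Finset.measurable_sum _ fun n _ =>
      (measurable_diffDensity r p hf _).comp (measurable_latticePoint _ n)
  rw [e]
  dsimp only
  rw [lintegral_finsetSum _ fun h _ => hm h]
  refine (Finset.sum_le_card_nsmul _ _ (((2 : ℝ≥0∞) ^ (l + 1)) ^ d * D) fun h hh => ?_).trans ?_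
  · refine (lintegral_sum_latticePoint_le (measurable_diffDensity r p hf _) l).trans ?_
    rw [lintegral_diffDensity]
    gcongr
    exact hD h fun c => Finset.mem_range.1 (Fintype.mem_piFinset.1 hh c)
  · rw [nsmul_eq_mul, Fintype.card_piFinset]
    simp

/-- If the differences are summable along the lattice through `u`, then they decay. -/
lemma dyadicDiffBound_of_sampleEnergy {N m : ℕ} {p ρ : ℝ} (hp : 0 < p) (hρ : 0 < ρ)
    {f : EuclideanSpace ℝ (Fin d) → ℝ} {Q : Set (EuclideanSpace ℝ (Fin d))} {j : ℕ}
    {u : EuclideanSpace ℝ (Fin d)} (hu : u ∈ openUnitCube d) (hQ : Q ⊆ closedUnitCube d)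
    (hlat : ∀ l n, latticePoint u ((2⁻¹ : ℝ) ^ l) n ∉ closedUnitCube d \ openUnitCube d)
    (hE : sampleEnergy (N + 1) m p ρ f Q j u ≠ ⊤) :
    DyadicDiffBound N m f u Q j ((sampleEnergy (N + 1) m p ρ f Q j u).toReal ^ (1 / p)) ρ := by
  intro l hl n h hh hy hy2
  have hmem : ∀ l n, latticePoint u ((2⁻¹ : ℝ) ^ l) n ∈ Q →
      latticePoint u ((2⁻¹ : ℝ) ^ l) n ∈ openUnitCube d := fun l n hy => by
    by_contra hn
    exact hlat l n ⟨hQ hy, hn⟩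
  set E := sampleEnergy (N + 1) m p ρ f Q j u
  change |(fwdDiff (dyadicStep l h))^[N + 1] f _| ≤ _
  set y := latticePoint u ((2⁻¹ : ℝ) ^ l) n with hydef
  have hyΩ := hmem l n hy
  have hshift : y + ((N + 1 : ℕ) : ℝ) • dyadicStep l h =
      latticePoint u ((2⁻¹ : ℝ) ^ l) (fun c => n c + (N + 1) * h c) := by
    ext c
    simp only [hydef, dyadicStep, PiLp.add_apply, PiLp.smul_apply, latticePoint_apply, smul_eq_mul]
    push_cast
    ring
  have hy2Ω : y + ((N + 1 : ℕ) : ℝ) • dyadicStep l h ∈ openUnitCube d := by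
    change y + ((N + 1 : ℕ) : ℝ) • dyadicStep l h ∈ Q at hy2
    rw [hshift] at hy2 ⊢
    exact hmem _ _ hy2
  have hys : y ∈ shiftDomain (openUnitCube d) (((N + 1 : ℕ) : ℝ) • dyadicStep l h) :=
    mem_shiftDomain_openUnitCube.2 ⟨hyΩ, hy2Ω⟩
  -- A single weighted term is at most the whole energy; taking the root of order `1/p` removes the
  -- weight and gives the factor `ρ^l`.
  have h1 : ENNReal.ofReal ((ρ ^ l) ^ (-p)) * ‖(fwdDiff (dyadicStep l h))^[N + 1] f y‖ₑ ^ p ≤ E := by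
    obtain ⟨i, rfl⟩ := Nat.exists_eq_add_of_le hl
    refine le_trans ?_ (ENNReal.le_tsum i)
    gcongr
    refine le_trans ?_ (Finset.single_le_sum (f := fun n =>
      ∑ h ∈ Fintype.piFinset fun _ : Fin d => Finset.range m,
        Q.indicator (diffDensity (N + 1) p f (dyadicStep (j + i) h))
          (latticePoint u ((2⁻¹ : ℝ) ^ (j + i)) n)) (fun _ _ => zero_le) (mem_latticeBox hu hyΩ))
    refine le_trans ?_ (Finset.single_le_sum (f := fun h =>
        Q.indicator (diffDensity (N + 1) p f (dyadicStep (j + i) h))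
          (latticePoint u ((2⁻¹ : ℝ) ^ (j + i)) n)) (fun _ _ => zero_le)
          (Fintype.mem_piFinset.2 fun c => Finset.mem_range.2 (hh c)))
    rw [indicator_of_mem hy, diffDensity, indicator_of_mem hys]
  have hρl : 0 < ρ ^ l := by positivity
  rw [Real.enorm_eq_ofReal_abs, ENNReal.ofReal_rpow_of_nonneg (abs_nonneg _) hp.le,
    ← ENNReal.ofReal_mul (by positivity), ENNReal.ofReal_le_iff_le_toReal hE,
    Real.rpow_neg hρl.le, inv_mul_le_iff₀ (by positivity), mul_comm] at h1
  have h2 := Real.rpow_le_rpow (by positivity) h1 (by positivity : 0 ≤ 1 / p)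
  rwa [Real.mul_rpow ENNReal.toReal_nonneg (by positivity), ← Real.rpow_mul (abs_nonneg _),
    ← Real.rpow_mul hρl.le, mul_one_div_cancel hp.ne', Real.rpow_one, Real.rpow_one] at h2

/-- The expected energy of a random lattice. -/
lemma exists_lintegral_sampleEnergy_le (d r m L : ℕ) (hL : d * m ≤ 2 ^ L) {p s ε : ℝ} (hp : 0 < p)
    (hε : 0 < ε) (hs : s = d / p + 2 * ε) :
    ∃ C : ℝ, 0 < C ∧ ∀ (f : EuclideanSpace ℝ (Fin d) → ℝ) (B : ℝ≥0∞), Measurable f →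
      (∀ t : ℝ, 0 < t → t ≤ 2 ^ L →
        modulusOfSmoothness r (ENNReal.ofReal p) f t ≤ ENNReal.ofReal (t ^ s) * B) →
      ∀ j : ℕ, ∫⁻ u in openUnitCube d, sampleEnergy r m p ((2 : ℝ) ^ (-ε)) f univ j u ≤
        ENNReal.ofReal (C * (((2 : ℝ) ^ (-ε)) ^ p) ^ j) * B ^ p := by
  set ρ : ℝ := (2 : ℝ) ^ (-ε) with hρdef
  have hρ : 0 < ρ := by positivity
  set β := ρ ^ p with hβ
  have hβ0 : 0 < β := by positivity
  have hβ1 : β < 1 := by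
    rw [hβ, hρdef, ← Real.rpow_mul (by norm_num)]
    exact Real.rpow_lt_one_of_one_lt_of_neg (by norm_num) (by nlinarith)
  -- With `m + 1` in place of `m` the constant is positive also for `m = 0`.
  obtain ⟨K, hKdef⟩ : ∃ K : ℝ, K = (m + 1) ^ d * 2 ^ d * (2 : ℝ) ^ (L * s * p) := ⟨_, rfl⟩
  have hK : 0 < K := by rw [hKdef]; positivity
  refine ⟨K / (1 - β), div_pos hK (by linarith), fun f B hf hB j => ?_⟩
  have hlevel : ∀ l, ENNReal.ofReal ((ρ ^ l) ^ (-p)) *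
      ∫⁻ u in openUnitCube d, levelEnergy r m p f univ l u ≤ ENNReal.ofReal (K * β ^ l) * B ^ p := by
    intro l
    have hD : ∀ h : Fin d → ℕ, (∀ c, h c < m) → diffInt r p f (dyadicStep l h) ≤
        ENNReal.ofReal ((2 ^ L * (2⁻¹ : ℝ) ^ l) ^ (s * p)) * B ^ p := by
      intro h hh
      have ht : ‖dyadicStep l h‖ ≤ 2 ^ L * (2⁻¹ : ℝ) ^ l := by
        refine (norm_dyadicStep_le hh).trans ?_
        gcongr
        exact_mod_cast hL
      refine (diffInt_le_modulus hp f ht).trans ?_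
      refine (ENNReal.rpow_le_rpow (hB _ (by positivity)
        (mul_le_of_le_one_right (by positivity) (pow_le_one₀ (by norm_num) (by norm_num)))) hp.le).trans ?_
      rw [ENNReal.mul_rpow_of_nonneg _ _ hp.le, ENNReal.ofReal_rpow_of_nonneg (by positivity) hp.le,
        ← Real.rpow_mul (by positivity)]
    refine (mul_le_mul_right (lintegral_levelEnergy_le r m p hf l hD) _).trans ?_
    have e1 : (m : ℝ≥0∞) ^ d = ENNReal.ofReal ((m : ℝ) ^ d) := by
      rw [ENNReal.ofReal_pow (Nat.cast_nonneg _), ENNReal.ofReal_natCast]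
    have e2 : ((2 : ℝ≥0∞) ^ (l + 1)) ^ d = ENNReal.ofReal (((2 : ℝ) ^ (l + 1)) ^ d) := by
      rw [ENNReal.ofReal_pow (by positivity), ENNReal.ofReal_pow (by positivity)]
      simp
    rw [e1, e2, ← mul_assoc, ← mul_assoc, ← mul_assoc, ← ENNReal.ofReal_mul (by positivity),
      ← ENNReal.ofReal_mul (by positivity), ← ENNReal.ofReal_mul (by positivity)]
    refine mul_le_mul' (ENNReal.ofReal_le_ofReal ?_) le_rfl
    -- Balance of exponents: the weight `2^{lεp}`, the number of points `2^{ld}` and the modulus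
    -- `2^{-lsp}` combine, by `s p = d + 2εp`, to `2^{-lεp} = β^l` up to a constant.
    have hid : (ρ ^ l) ^ (-p) * ((2 : ℝ) ^ (l + 1)) ^ d * (2 ^ L * (2⁻¹ : ℝ) ^ l) ^ (s * p) =
        2 ^ d * (2 : ℝ) ^ (L * s * p) * β ^ l := by
      have h2 : (0 : ℝ) < 2 := by norm_num
      have hsp : s * p = d + 2 * ε * p := by rw [hs]; field_simp
      rw [hβ, hρdef, inv_pow]
      simp only [← Real.rpow_natCast, ← Real.rpow_mul h2.le, ← Real.rpow_neg h2.le,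
        ← Real.rpow_add h2]
      congr 1
      push_cast
      rw [mul_assoc (L : ℝ), hsp]
      ring
    calc (ρ ^ l) ^ (-p) * (m : ℝ) ^ d * ((2 : ℝ) ^ (l + 1)) ^ d * (2 ^ L * (2⁻¹ : ℝ) ^ l) ^ (s * p)
        = (m : ℝ) ^ d * ((ρ ^ l) ^ (-p) * ((2 : ℝ) ^ (l + 1)) ^ d *
            (2 ^ L * (2⁻¹ : ℝ) ^ l) ^ (s * p)) := by ring
      _ = (m : ℝ) ^ d * (2 ^ d * (2 : ℝ) ^ (L * s * p) * β ^ l) := by rw [hid]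
      _ ≤ (m + 1 : ℝ) ^ d * (2 ^ d * (2 : ℝ) ^ (L * s * p) * β ^ l) := by
          gcongr
          linarith
      _ = K * β ^ l := by rw [hKdef]; ring
  have hmeas := fun l => measurable_levelEnergy r m p hf MeasurableSet.univ l
  unfold sampleEnergy
  rw [lintegral_tsum fun i => ((hmeas _).const_mul _).aemeasurable]
  calc ∑' i, ∫⁻ u in openUnitCube d, ENNReal.ofReal ((ρ ^ (j + i)) ^ (-p)) *
          levelEnergy r m p f univ (j + i) u
      ≤ ∑' i, ENNReal.ofReal (K * β ^ j) * B ^ p * ENNReal.ofReal β ^ i := by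
        refine ENNReal.tsum_le_tsum fun i => ?_
        rw [lintegral_const_mul _ (hmeas _)]
        refine (hlevel _).trans (le_of_eq ?_)
        rw [← ENNReal.ofReal_pow hβ0.le, mul_right_comm, ← ENNReal.ofReal_mul (by positivity),
          pow_add, mul_assoc]
    _ = ENNReal.ofReal (K / (1 - β) * β ^ j) * B ^ p := by
        rw [ENNReal.tsum_mul_left, ENNReal.tsum_geometric, ← ENNReal.ofReal_one,
          ← ENNReal.ofReal_sub _ hβ0.le, ← ENNReal.ofReal_inv_of_pos (by linarith), mul_right_comm,
          ← ENNReal.ofReal_mul (by positivity)]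
        congr 2
        ring

end energy

/-! ### Polynomial approximation on the dyadic cubes -/

section approximation
open Filter Topology
variable {d : ℕ}

/-- The lower corner of a dyadic cube of the unit cube. -/
noncomputable def dyadicCorner (j : ℕ) (a : Fin d → Fin (2 ^ j)) : EuclideanSpace ℝ (Fin d) :=
  WithLp.toLp 2 fun c => (2⁻¹ : ℝ) ^ j * (a c : ℕ)

@[simp] lemma dyadicCorner_apply (j : ℕ) (a : Fin d → Fin (2 ^ j)) (c : Fin d) :
    dyadicCorner j a c = (2⁻¹ : ℝ) ^ j * (a c : ℕ) := rfl

lemma closedCube_dyadicCorner_subset (j : ℕ) (a : Fin d → Fin (2 ^ j)) :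
    closedCube (dyadicCorner j a) ((2⁻¹ : ℝ) ^ j) ⊆ closedUnitCube d := by
  intro x hx c
  have h := hx c
  rw [dyadicCorner_apply] at h
  have h0 : (0 : ℝ) < (2⁻¹ : ℝ) ^ j := by positivity
  refine ⟨le_trans (by positivity) h.1, h.2.trans ?_⟩
  have h1 : ((a c : ℕ) : ℝ) + 1 ≤ 2 ^ j := by exact_mod_cast (a c).2
  calc (2⁻¹ : ℝ) ^ j * (a c : ℕ) + (2⁻¹ : ℝ) ^ j = (2⁻¹ : ℝ) ^ j * ((a c : ℕ) + 1) := by ring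
    _ ≤ (2⁻¹ : ℝ) ^ j * 2 ^ j := by gcongr
    _ = 1 := by rw [← mul_pow]; norm_num

lemma eq_of_mem_halfOpenCube_dyadicCorner {j : ℕ} {a a' : Fin d → Fin (2 ^ j)}
    {x : EuclideanSpace ℝ (Fin d)} (hx : x ∈ halfOpenCube (dyadicCorner j a) ((2⁻¹ : ℝ) ^ j))
    (hx' : x ∈ halfOpenCube (dyadicCorner j a') ((2⁻¹ : ℝ) ^ j)) : a = a' := by
  have h0 : (0 : ℝ) < (2⁻¹ : ℝ) ^ j := by positivity
  have key : ∀ b b' : Fin d → Fin (2 ^ j), x ∈ halfOpenCube (dyadicCorner j b) ((2⁻¹ : ℝ) ^ j) →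
      x ∈ halfOpenCube (dyadicCorner j b') ((2⁻¹ : ℝ) ^ j) → ∀ c, (b c : ℕ) ≤ b' c := by
    intro b b' h h' c
    have h1 := (h c).1
    have h2 := (h' c).2
    rw [dyadicCorner_apply] at h1 h2
    have h3 : (2⁻¹ : ℝ) ^ j * (b c : ℕ) < (2⁻¹ : ℝ) ^ j * ((b' c : ℕ) + 1) := by linarith
    have h4 := lt_of_mul_lt_mul_left h3 h0.le
    exact Nat.lt_succ_iff.1 (by exact_mod_cast h4)
  ext c
  exact le_antisymm (key a a' hx hx' c) (key a' a hx' hx c)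

lemma sum_indicator_dyadicCube_le (j : ℕ) (F : EuclideanSpace ℝ (Fin d) → ℝ≥0∞)
    (x : EuclideanSpace ℝ (Fin d)) :
    ∑ a : Fin d → Fin (2 ^ j),
      (halfOpenCube (dyadicCorner j a) ((2⁻¹ : ℝ) ^ j)).indicator F x ≤ F x := by
  by_cases h : ∃ a : Fin d → Fin (2 ^ j), x ∈ halfOpenCube (dyadicCorner j a) ((2⁻¹ : ℝ) ^ j)
  · obtain ⟨a, ha⟩ := h
    rw [Finset.sum_eq_single a, indicator_of_mem ha]
    · exact fun b _ hb => indicator_of_notMem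
        (fun hxb => hb (eq_of_mem_halfOpenCube_dyadicCorner hxb ha)) _
    · simp
  · push Not at h
    rw [Finset.sum_eq_zero fun a _ => indicator_of_notMem (h a) _]
    exact zero_le

lemma sampleEnergy_le_univ (r m : ℕ) (p ρ : ℝ) (f : EuclideanSpace ℝ (Fin d) → ℝ)
    (Q : Set (EuclideanSpace ℝ (Fin d))) (j : ℕ) (u : EuclideanSpace ℝ (Fin d)) :
    sampleEnergy r m p ρ f Q j u ≤ sampleEnergy r m p ρ f univ j u := by
  refine ENNReal.tsum_le_tsum fun i => ?_
  gcongr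
  refine Finset.sum_le_sum fun n _ => Finset.sum_le_sum fun h _ => ?_
  exact indicator_le_indicator_of_subset (subset_univ _) (fun _ => zero_le) _

/-- The energy of a cube restricts only the base point of a difference. The half-open dyadic cubes
are disjoint, so each difference is counted at most once. -/
lemma sum_sampleEnergy_le (r m : ℕ) (p ρ : ℝ) (f : EuclideanSpace ℝ (Fin d) → ℝ)
    (j : ℕ) (u : EuclideanSpace ℝ (Fin d)) :
    ∑ a : Fin d → Fin (2 ^ j), sampleEnergy r m p ρ f
      (halfOpenCube (dyadicCorner j a) ((2⁻¹ : ℝ) ^ j)) j u ≤ sampleEnergy r m p ρ f univ j u := by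
  unfold sampleEnergy
  rw [← Summable.tsum_finsetSum fun _ _ => ENNReal.summable]
  refine ENNReal.tsum_le_tsum fun i => ?_
  rw [← Finset.mul_sum]
  gcongr
  unfold levelEnergy
  rw [Finset.sum_comm]
  refine Finset.sum_le_sum fun n _ => ?_
  rw [Finset.sum_comm]
  refine Finset.sum_le_sum fun h _ => ?_
  rw [indicator_univ]
  exact sum_indicator_dyadicCube_le j _ _

lemma ENNReal.sum_rpow_le_rpow_sum {ι : Type*} (s : Finset ι) (a : ι → ℝ≥0∞) {q : ℝ} (hq : 1 ≤ q) :
    ∑ i ∈ s, a i ^ q ≤ (∑ i ∈ s, a i) ^ q := by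
  classical
  induction s using Finset.induction_on with
  | empty => simp
  | insert i s hi ih =>
    rw [Finset.sum_insert hi, Finset.sum_insert hi]
    exact (add_le_add_right ih _).trans (ENNReal.add_rpow_le_rpow_add _ _ hq)

/-- A function whose modulus of smoothness is `O(t^s)` with `s > d / p` has a continuous
representative, and the errors of its local polynomial approximations on the dyadic cubes are square
summable. -/
theorem exists_continuousOn_and_polynomial_approximation (d N : ℕ) {p s : ℝ} (hp : 0 < p)
    (hp2 : p ≤ 2) (hs : d / p < s) :
    ∃ (L : ℕ) (C : ℝ), 0 ≤ C ∧ ∀ (f : EuclideanSpace ℝ (Fin d) → ℝ) (B : ℝ≥0∞), B ≠ ⊤ →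
      MemLp f (ENNReal.ofReal p) (volume.restrict (openUnitCube d)) →
      (∀ t : ℝ, 0 < t → t ≤ 2 ^ L →
        modulusOfSmoothness (N + 1) (ENNReal.ofReal p) f t ≤ ENNReal.ofReal (t ^ s) * B) →
      ∃ g : EuclideanSpace ℝ (Fin d) → ℝ, ContinuousOn g (closedUnitCube d) ∧
        f =ᵐ[volume.restrict (openUnitCube d)] g ∧
        ∀ j : ℕ, ∃ (P : (Fin d → Fin (2 ^ j)) → EuclideanSpace ℝ (Fin d) → ℝ)
          (e : (Fin d → Fin (2 ^ j)) → ℝ), (∀ a, P a ∈ polyFun d N) ∧ (∀ a, 0 ≤ e a) ∧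
          (∀ a, ∀ x ∈ closedCube (dyadicCorner j a) ((2⁻¹ : ℝ) ^ j), |g x - P a x| ≤ e a) ∧
          ∑ a, ENNReal.ofReal (e a) ^ 2 ≤
            (ENNReal.ofReal (C * ((2 : ℝ) ^ (-(s - d / p))) ^ j) * B) ^ 2 := by
  obtain ⟨μ, hm, hm2⟩ : ∃ μ : ℕ, (N + 1) * (d * (N + 1) + (N + 1) + 1) ≤ 2 ^ μ ∧
      2 * (N + 1) ≤ 2 ^ μ := by
    refine ⟨(N + 1) * (d * (N + 1) + (N + 1) + 1) + 2 * (N + 1), ?_, ?_⟩ <;>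
    refine le_trans ?_ Nat.lt_two_pow_self.le <;> omega
  set m := 2 ^ μ
  -- Half of the surplus of smoothness pays for the weights that control single differences; the
  -- other half makes the weighted energies decay.
  set ε : ℝ := (s - d / p) / 2 with hεdef
  have hε : 0 < ε := by rw [hεdef]; linarith
  have hsε : s = d / p + 2 * ε := by rw [hεdef]; ring
  set ρ : ℝ := (2 : ℝ) ^ (-ε) with hρdef
  have hρ : 0 < ρ := by positivity
  have hρ1 : ρ < 1 := Real.rpow_lt_one_of_one_lt_of_neg (by norm_num) (by linarith)
  obtain ⟨C₀, hC₀, h₀⟩ := exists_polyFun_near_on_lattices d N μ hm hm2 hρ hρ1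
  obtain ⟨C₁, hC₁, h₁⟩ := exists_lintegral_sampleEnergy_le d (N + 1) m (d * m)
    Nat.lt_two_pow_self.le hp hε hsε
  refine ⟨d * m, C₀ * C₁ ^ (1 / p), by positivity, fun f B hB hf hfB => ?_⟩
  -- a measurable representative
  set f₀ := hf.1.mk f with hf₀def
  have hff₀ : f =ᵐ[volume.restrict (openUnitCube d)] f₀ := hf.1.ae_eq_mk
  have hf₀m : Measurable f₀ := hf.1.stronglyMeasurable_mk.measurable
  have hf₀p : MemLp f₀ (ENNReal.ofReal p) (volume.restrict (openUnitCube d)) :=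
    (memLp_congr_ae hff₀).1 hf
  have hI := h₁ f₀ B hf₀m (fun t ht ht' => by
    rw [← modulusOfSmoothness_congr hff₀]; exact hfB t ht ht')
  have hBp : B ^ p ≠ ⊤ := ENNReal.rpow_ne_top_of_nonneg hp.le hB
  have hItop : ∀ j, ENNReal.ofReal (C₁ * (ρ ^ p) ^ j) * B ^ p ≠ ⊤ := fun j =>
    ENNReal.mul_ne_top ENNReal.ofReal_ne_top hBp
  have hmeas : ∀ j, Measurable (sampleEnergy (N + 1) m p ρ f₀ univ j) := fun j =>
    Measurable.tsum fun i => (measurable_levelEnergy _ _ _ hf₀m MeasurableSet.univ _).const_mul _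
  have hbd : ∀ᵐ u ∂(volume.restrict (openUnitCube d)), u ∈ openUnitCube d ∧
      ∀ l n, latticePoint u ((2⁻¹ : ℝ) ^ l) n ∉ closedUnitCube d \ openUnitCube d :=
    (ae_restrict_mem isOpen_openUnitCube.measurableSet).and
      (ae_restrict_of_ae (ae_forall_latticePoint_notMem volume_closedUnitCube_diff))
  have hcube0 : halfOpenCube (0 : EuclideanSpace ℝ (Fin d)) ((2⁻¹ : ℝ) ^ 0) ⊆ closedUnitCube d := by
    rw [closedUnitCube_eq, pow_zero]; exact halfOpenCube_subset_closedCube _ _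
  -- the continuous representative
  obtain ⟨φ, i, hφ, hi, hosc, hint, hsamp⟩ := exists_approximation_sampling hp hf₀m hf₀p
  obtain ⟨g, hg, hf₀g⟩ : ∃ g : EuclideanSpace ℝ (Fin d) → ℝ, ContinuousOn g (closedUnitCube d) ∧
      f₀ =ᵐ[volume.restrict (openUnitCube d)] g := by
    -- For the representative any lattice of finite energy at level zero that samples well will do.
    have hfin := ae_lt_top (hmeas 0) (ne_top_of_le_ne_top (hItop 0) (hI 0))
    obtain ⟨u, ⟨hu, hlat⟩, hfu, hsu⟩ := (hbd.and (hfin.and hsamp)).exists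
    have hdd := dyadicDiffBound_of_sampleEnergy (N := N) (m := m) (f := f₀) (j := 0) hp hρ hu hcube0
      hlat (ne_top_of_le_ne_top hfu.ne (sampleEnergy_le_univ _ _ _ _ _ _ _ _))
    obtain ⟨g, hg, hgf⟩ := exists_continuousOn_eq_on_dyadicLattice hm hm2 hρ hρ1
      (by positivity) hdd
    exact ⟨g, hg, ae_eq_of_sampling hp hu hf₀m hφ hi hosc hint hsu hg hgf⟩
  refine ⟨g, hg, hff₀.trans hf₀g, fun j => ?_⟩
  set Q : (Fin d → Fin (2 ^ j)) → Set (EuclideanSpace ℝ (Fin d)) := fun a =>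
    halfOpenCube (dyadicCorner j a) ((2⁻¹ : ℝ) ^ j) with hQ
  have hQc : ∀ a, Q a ⊆ closedUnitCube d := fun a =>
    (halfOpenCube_subset_closedCube _ _).trans (closedCube_dyadicCorner_subset j a)
  -- a good lattice
  obtain ⟨u, hu, hlat, hlat2, hEu⟩ : ∃ u ∈ openUnitCube d,
      (∀ l n, latticePoint u ((2⁻¹ : ℝ) ^ l) n ∉ closedUnitCube d \ openUnitCube d) ∧
      (∀ l n, latticePoint u ((2⁻¹ : ℝ) ^ l) n ∈ openUnitCube d →
        f₀ (latticePoint u ((2⁻¹ : ℝ) ^ l) n) = g (latticePoint u ((2⁻¹ : ℝ) ^ l) n)) ∧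
      sampleEnergy (N + 1) m p ρ f₀ univ j u ≤ ENNReal.ofReal (C₁ * (ρ ^ p) ^ j) * B ^ p := by
    have hZ := ae_iff.1 ((ae_restrict_iff' isOpen_openUnitCube.measurableSet).1 hf₀g)
    have hgood := hbd.and (ae_restrict_of_ae (s := openUnitCube d) (ae_forall_latticePoint_notMem hZ))
    obtain ⟨u, hu1, hu2⟩ := exists_notMem_null_le_lintegral (hmeas j).aemeasurable (ae_iff.1 hgood)
    simp only [mem_ofPred_eq, not_not] at hu1
    exact ⟨u, hu1.1.1, hu1.1.2, hu1.2, hu2.trans (hI j)⟩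
  set E : (Fin d → Fin (2 ^ j)) → ℝ≥0∞ := fun a => sampleEnergy (N + 1) m p ρ f₀ (Q a) j u with hE
  have hEsum : ∑ a, E a ≤ ENNReal.ofReal (C₁ * (ρ ^ p) ^ j) * B ^ p :=
    (sum_sampleEnergy_le _ _ _ _ _ _ _).trans hEu
  have hEtop : ∀ a, E a ≠ ⊤ := fun a => ne_top_of_le_ne_top (hItop j)
    ((Finset.single_le_sum (fun _ _ => zero_le) (Finset.mem_univ a)).trans hEsum)
  have hex : ∀ a, ∃ F ∈ polyFun d N, ∀ (l : ℕ) (n : Fin d → ℤ),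
      latticePoint u ((2⁻¹ : ℝ) ^ l) n ∈ Q a →
      |f₀ (latticePoint u ((2⁻¹ : ℝ) ^ l) n) - F (latticePoint u ((2⁻¹ : ℝ) ^ l) n)| ≤
          C₀ * ((E a).toReal ^ (1 / p) * ρ ^ j) := fun a =>
    h₀ f₀ u _ j _ (by positivity)
      (dyadicDiffBound_of_sampleEnergy hp hρ hu (hQc a) hlat (hEtop a))
  choose P hP hPf using hex
  refine ⟨P, fun a => C₀ * ((E a).toReal ^ (1 / p) * ρ ^ j), hP, fun a => by positivity,
    fun a x hx => ?_, ?_⟩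
  -- The lattice is dense in the cube, so the estimate at its points extends to the closed cube by
  -- continuity.
  · have hcl := closedCube_subset_closure_inter_dyadicLattice u (dyadicCorner j a)
      (ℓ := (2⁻¹ : ℝ) ^ j) (by positivity)
    have hsub : openCube (dyadicCorner j a) ((2⁻¹ : ℝ) ^ j) ∩ dyadicLattice u ⊆ closedUnitCube d :=
      inter_subset_left.trans ((openCube_subset_halfOpenCube _ _).trans (hQc a))
    have hgw := (hg x (closedCube_dyadicCorner_subset j a hx)).mono hsub
    have hPw := (contDiff_of_mem_polyFun (hP a)).continuous.continuousWithinAt (x := x)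
      (s := openCube (dyadicCorner j a) ((2⁻¹ : ℝ) ^ j) ∩ dyadicLattice u)
    refine ContinuousWithinAt.closure_le (f := fun x => |g x - P a x|) (g := fun _ => _) (hcl hx)
      (hgw.sub hPw).abs continuousWithinAt_const ?_
    rintro y ⟨hy, l, n, rfl⟩
    have hyQ := openCube_subset_halfOpenCube _ _ hy
    have hyΩ : latticePoint u ((2⁻¹ : ℝ) ^ l) n ∈ openUnitCube d := by
      by_contra hn
      exact hlat l n ⟨hQc a hyQ, hn⟩
    rw [← hlat2 l n hyΩ]
    exact hPf a l n hyQ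
  · have hterm : ∀ a, ENNReal.ofReal (C₀ * ((E a).toReal ^ (1 / p) * ρ ^ j)) ^ 2 =
        ENNReal.ofReal (C₀ * ρ ^ j) ^ 2 * E a ^ (2 / p) := by
      intro a
      have e1 : C₀ * ((E a).toReal ^ (1 / p) * ρ ^ j) = (C₀ * ρ ^ j) * (E a).toReal ^ (1 / p) := by
        ring
      rw [e1, ENNReal.ofReal_mul (by positivity), mul_pow,
        ← ENNReal.ofReal_rpow_of_nonneg ENNReal.toReal_nonneg (by positivity),
        ENNReal.ofReal_toReal (hEtop a), ← ENNReal.rpow_natCast (E a ^ (1 / p)), ← ENNReal.rpow_mul]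
      congr 2
      push_cast; ring
    rw [Finset.sum_congr rfl fun a _ => hterm a, ← Finset.mul_sum]
    -- The condition `p ≤ 2` is used here: the powers `2/p ≥ 1` of the energies sum to at most the
    -- power of their sum.
    have h2p : 1 ≤ 2 / p := by rw [le_div_iff₀ hp]; linarith
    -- One factor `ρ^j` comes from the local approximation, the other from the root of the mean
    -- energy; together they give the full rate `2^{-j(s-d/p)}`.
    have hρ2 : ρ ^ 2 = (2 : ℝ) ^ (-(s - d / p)) := by
      rw [hρdef, ← Real.rpow_natCast, ← Real.rpow_mul (by norm_num)]
      congr 1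
      rw [hεdef]; push_cast; ring
    calc ENNReal.ofReal (C₀ * ρ ^ j) ^ 2 * ∑ a, E a ^ (2 / p)
        ≤ ENNReal.ofReal (C₀ * ρ ^ j) ^ 2 *
            (ENNReal.ofReal (C₁ * (ρ ^ p) ^ j) * B ^ p) ^ (2 / p) := by
          gcongr
          exact (ENNReal.sum_rpow_le_rpow_sum _ _ h2p).trans
            (ENNReal.rpow_le_rpow hEsum (by positivity))
      _ = (ENNReal.ofReal (C₀ * ρ ^ j) * (ENNReal.ofReal ((C₁ * (ρ ^ p) ^ j) ^ (1 / p)) * B)) ^ 2 := by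
          have e2 : 2 / p = 1 / p * (2 : ℕ) := by push_cast; ring
          rw [mul_pow, e2, ENNReal.rpow_mul, ENNReal.rpow_natCast,
            ENNReal.mul_rpow_of_nonneg _ _ (by positivity : 0 ≤ 1 / p), ← ENNReal.rpow_mul,
            mul_one_div_cancel hp.ne', ENNReal.rpow_one,
            ENNReal.ofReal_rpow_of_nonneg (by positivity) (by positivity)]
      _ = _ := by
          rw [← mul_assoc, ← ENNReal.ofReal_mul (by positivity)]
          congr 3
          rw [Real.mul_rpow hC₁.le (by positivity), ← Real.rpow_natCast, ← Real.rpow_natCast,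
            ← Real.rpow_mul hρ.le, ← Real.rpow_mul hρ.le]
          have e3 : p * (j : ℝ) * (1 / p) = j := by field_simp
          rw [e3, ← hρ2, ← pow_mul, two_mul, pow_add, Real.rpow_natCast]
          ring

end approximation

/-! ### The simplicial interpolant -/

section kuhn
open MvPolynomial
variable {d : ℕ}

lemma localInterpolant_spec {r : ℕ} (hr : 2 ≤ r) (k : ℕ) (a : Fin d → Fin (2 ^ k))
    (σ : Equiv.Perm (Fin d)) (f : EuclideanSpace ℝ (Fin d) → ℝ) :
    IsLocalInterpolant r k a σ f (localInterpolant r k a σ f) := by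
  have h := (existsUnique_localInterpolant hr k a σ f).exists
  rw [localInterpolant, dif_pos h]
  exact h.choose_spec

lemma eval_kuhnCoord_fin (k : ℕ) (a : Fin d → Fin (2 ^ k)) (σ : Equiv.Perm (Fin d)) (i : Fin d)
    (x : EuclideanSpace ℝ (Fin d)) :
    eval (fun i => x i) (kuhnCoord k a σ i) = 2 ^ k * x (σ i) - (a (σ i) : ℕ) := by
  simp [kuhnCoord]

lemma eval_kuhnCoord_of_le (k : ℕ) (a : Fin d → Fin (2 ^ k)) (σ : Equiv.Perm (Fin d)) {i : ℕ}
    (hi : d ≤ i) (x : EuclideanSpace ℝ (Fin d)) :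
    eval (fun i => x i) (kuhnCoord k a σ i) = 0 := by
  simp [kuhnCoord, hi.not_gt]

lemma antitone_eval_kuhnCoord {k : ℕ} {a : Fin d → Fin (2 ^ k)} {σ : Equiv.Perm (Fin d)}
    {x : EuclideanSpace ℝ (Fin d)} (hx : x ∈ kuhnSimplex k a σ) :
    Antitone fun i => eval (fun i => x i) (kuhnCoord k a σ i) := by
  intro i j hij
  dsimp only
  by_cases hj : j < d
  · have := hx.2 (show (⟨i, hij.trans_lt hj⟩ : Fin d) ≤ ⟨j, hj⟩ from hij)
    dsimp only at this
    rwa [← eval_kuhnCoord_fin, ← eval_kuhnCoord_fin] at this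
  · rw [eval_kuhnCoord_of_le k a σ (not_lt.1 hj)]
    by_cases hi : i < d
    · have := eval_kuhnCoord_fin k a σ ⟨i, hi⟩ x
      dsimp only at this
      rw [this]
      exact (hx.1 _).1
    · rw [eval_kuhnCoord_of_le k a σ (not_lt.1 hi)]

/-- A basis polynomial of the interpolation on a Kuhn simplex vanishes on the faces that do not
contain its node. -/
lemma exists_localBasis_vanishing {r k : ℕ} (hr : 2 ≤ r) {a : Fin d → Fin (2 ^ k)}
    {σ : Equiv.Perm (Fin d)} {y : EuclideanSpace ℝ (Fin d)}
    (hy : y ∈ interpGrid d r k ∩ kuhnSimplex k a σ) :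
    ∃ P : MvPolynomial (Fin d) ℝ, P.totalDegree < r ∧ eval (fun i => y i) P = 1 ∧
      (∀ z ∈ interpGrid d r k ∩ kuhnSimplex k a σ, z ≠ y → eval (fun i => z i) P = 0) ∧
      ∀ x : EuclideanSpace ℝ (Fin d), eval (fun i => x i) P ≠ 0 →
        ∀ m ∈ Finset.range (d + 1), eval (fun i => x i) (kuhnBary r k a σ m) = 0 →
          eval (fun i => y i) (kuhnBary r k a σ m) = 0 := by
  obtain ⟨κ, hsum, hκ⟩ := grid_bary hr hy
  let Q : MvPolynomial (Fin d) ℝ := ∏ m ∈ Finset.range (d + 1), ∏ l ∈ Finset.range (κ m),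
    (kuhnBary r k a σ m - C (l : ℝ))
  have hQdeg : Q.totalDegree ≤ r - 1 := by
    refine (totalDegree_finsetProd _ _).trans ?_
    rw [← hsum]
    refine Finset.sum_le_sum fun m _ => (totalDegree_finsetProd _ _).trans ?_
    refine (Finset.sum_le_card_nsmul _ _ 1 fun l _ => ?_).trans (by simp)
    exact (totalDegree_sub _ _).trans (max_le (kuhnBary_totalDegree r k a σ m)
      (by rw [totalDegree_C]; exact Nat.zero_le 1))
  have hQ : ∀ z : EuclideanSpace ℝ (Fin d), eval (fun i => z i) Q =
      ∏ m ∈ Finset.range (d + 1), ∏ l ∈ Finset.range (κ m),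
        (eval (fun i => z i) (kuhnBary r k a σ m) - l) := by
    intro z; simp [Q, map_prod]
  have hne : ∀ z : EuclideanSpace ℝ (Fin d), eval (fun i => z i) Q ≠ 0 →
      ∀ m ∈ Finset.range (d + 1), ∀ l < κ m, eval (fun i => z i) (kuhnBary r k a σ m) ≠ l := by
    intro z hz m hm l hl
    rw [hQ] at hz
    exact sub_ne_zero.1 (Finset.prod_ne_zero_iff.1 (Finset.prod_ne_zero_iff.1 hz m hm) l
      (Finset.mem_range.2 hl))
  have hQy : eval (fun i => y i) Q ≠ 0 := by
    rw [hQ]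
    refine Finset.prod_ne_zero_iff.2 fun m _ => Finset.prod_ne_zero_iff.2 fun l hl => ?_
    rw [hκ m, sub_ne_zero]
    have := Finset.mem_range.1 hl
    exact_mod_cast (by omega : κ m ≠ l)
  refine ⟨C (eval (fun i => y i) Q)⁻¹ * Q, ?_, ?_, ?_, ?_⟩
  · have := totalDegree_mul (C (eval (fun i => y i) Q)⁻¹) Q
    rw [totalDegree_C] at this
    omega
  · rw [map_mul, eval_C, inv_mul_cancel₀ hQy]
  · intro z hz hzy
    rw [map_mul, eval_C]
    suffices h : eval (fun i => z i) Q = 0 by rw [h, mul_zero]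
    by_contra hzQ
    obtain ⟨κ', hsum', hκ'⟩ := grid_bary hr hz
    have hle : ∀ m ∈ Finset.range (d + 1), κ m ≤ κ' m := by
      intro m hm
      by_contra hlt
      exact hne z hzQ m hm (κ' m) (by omega) (hκ' m)
    have heq := (Finset.sum_eq_sum_iff_of_le hle).1 (by rw [hsum, hsum'])
    refine hzy (eq_of_bary hr (a := a) (σ := σ) fun m hm => ?_)
    rw [hκ, hκ', heq m hm]
  -- If `κ m ≠ 0`, the product contains the factor with `l = 0`, namely the barycentric coordinate
  -- itself, and would vanish at `x`.
  · intro x hx m hm hxm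
    rw [map_mul] at hx
    have hx' := hne x (right_ne_zero_of_mul hx) m hm
    rw [hκ m]
    by_contra h0
    have : κ m ≠ 0 := fun h => h0 (by rw [h]; simp)
    exact hx' 0 (by omega) (by rw [hxm]; simp)

/-- If a point of a Kuhn simplex lies in another Kuhn simplex, then so does its smallest face. -/
lemma mem_kuhnSimplex_of_bary {r k : ℕ} (hr : 2 ≤ r) {a a' : Fin d → Fin (2 ^ k)}
    {σ σ' : Equiv.Perm (Fin d)} {x y : EuclideanSpace ℝ (Fin d)} (hx : x ∈ kuhnSimplex k a σ)
    (hx' : x ∈ kuhnSimplex k a' σ') (hy : y ∈ kuhnSimplex k a σ)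
    (h : ∀ m ∈ Finset.range (d + 1), eval (fun i => x i) (kuhnBary r k a σ m) = 0 →
      eval (fun i => y i) (kuhnBary r k a σ m) = 0) : y ∈ kuhnSimplex k a' σ' := by
  have hn : ((r - 1 : ℕ) : ℝ) ≠ 0 := by exact_mod_cast (by omega : r - 1 ≠ 0)
  set X : ℕ → ℝ := fun i => eval (fun i => x i) (kuhnCoord k a σ i) with hX
  set Y : ℕ → ℝ := fun i => eval (fun i => y i) (kuhnCoord k a σ i) with hY
  have hXa : Antitone X := antitone_eval_kuhnCoord hx
  have hYa : Antitone Y := antitone_eval_kuhnCoord hy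
  have h0 : X 0 = 1 → Y 0 = 1 := by
    intro h1
    have h2 := h 0 (by simp)
    simp only [kuhnBary, map_mul, map_sub, eval_C, map_one, mul_eq_zero, hn, false_or,
      sub_eq_zero] at h2
    exact (h2 h1.symm).symm
  have hstep : ∀ m < d, X m = X (m + 1) → Y m = Y (m + 1) := by
    intro m hm h1
    have h2 := h (m + 1) (by simp; omega)
    simp only [kuhnBary, map_mul, map_sub, eval_C, mul_eq_zero, hn, false_or, sub_eq_zero] at h2
    exact h2 h1
  -- Vanishing barycentric coordinates are equalities in the chain `1 ≥ X 0 ≥ ⋯ ≥ X d = 0`. By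
  -- monotonicity, equality of two distant members forces all equalities in between, and these pass
  -- to `y`.
  have heq : ∀ i j, i ≤ j → j ≤ d → X i = X j → Y i = Y j := by
    intro i j hij
    induction j, hij using Nat.le_induction with
    | base => simp
    | succ j hij ih =>
      intro hj hXX
      have h1 : X i = X j := le_antisymm (hXX ▸ hXa (Nat.le_succ j)) (hXa hij)
      rw [ih (by omega) h1]
      exact hstep j (by omega) (h1 ▸ hXX)
  set X' : Fin d → ℝ := fun c => 2 ^ k * x c - (a c : ℕ) with hX'
  set Y' : Fin d → ℝ := fun c => 2 ^ k * y c - (a c : ℕ) with hY'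
  have eX : ∀ c, X' c = X (σ.symm c) := fun c => by
    rw [hX, hX']; dsimp only; rw [eval_kuhnCoord_fin]; simp
  have eY : ∀ c, Y' c = Y (σ.symm c) := fun c => by
    rw [hY, hY']; dsimp only; rw [eval_kuhnCoord_fin]; simp
  have hone : ∀ c, X' c = 1 → Y' c = 1 := by
    intro c hc
    rw [eX] at hc
    have hd : 0 < d := c.pos
    have h1 : X 0 ≤ 1 := by
      have := (hx.1 (σ ⟨0, hd⟩)).2
      rwa [← eval_kuhnCoord_fin] at this
    have h2 : X 0 = X (σ.symm c) := le_antisymm (hc ▸ h1) (hXa (Nat.zero_le _))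
    rw [eY, ← heq 0 _ (Nat.zero_le _) (σ.symm c).2.le h2]
    exact h0 (h2.trans hc)
  have hzero : ∀ c, X' c = 0 → Y' c = 0 := by
    intro c hc
    rw [eX] at hc
    have hXd : X d = 0 := eval_kuhnCoord_of_le k a σ le_rfl x
    have hYd : Y d = 0 := eval_kuhnCoord_of_le k a σ le_rfl y
    rw [eY, heq _ d (σ.symm c).2.le le_rfl (hc.trans hXd.symm), hYd]
  have hord : ∀ c c', X' c' ≤ X' c → Y' c' ≤ Y' c := by
    intro c c' hcc
    rw [eX, eX] at hcc
    rw [eY, eY]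
    rcases le_total (σ.symm c : ℕ) (σ.symm c') with hle | hle
    · exact hYa hle
    · exact (heq _ _ hle (σ.symm c).2.le (le_antisymm hcc (hXa hle))).le
  -- the offset of the two cubes
  have hoff : ∀ c, ((a' c : ℕ) = (a c : ℕ)) ∨ ((a' c : ℕ) = (a c : ℕ) + 1 ∧ X' c = 1) ∨
      ((a c : ℕ) = (a' c : ℕ) + 1 ∧ X' c = 0) := by
    intro c
    have h1 := hx.1 c
    have h2 := hx'.1 c
    have h3 : ((a c : ℕ) : ℝ) ≤ (a' c : ℕ) + 1 := by linarith
    have h4 : ((a' c : ℕ) : ℝ) ≤ (a c : ℕ) + 1 := by linarith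
    have h3' : (a c : ℕ) ≤ (a' c : ℕ) + 1 := by exact_mod_cast h3
    have h4' : (a' c : ℕ) ≤ (a c : ℕ) + 1 := by exact_mod_cast h4
    rcases (by omega : ((a' c : ℕ) = (a c : ℕ)) ∨ ((a' c : ℕ) = (a c : ℕ) + 1) ∨
      ((a c : ℕ) = (a' c : ℕ) + 1)) with h5 | h5 | h5
    · exact Or.inl h5
    · refine Or.inr (Or.inl ⟨h5, ?_⟩)
      have h6 : ((a' c : ℕ) : ℝ) = (a c : ℕ) + 1 := by exact_mod_cast h5
      simp only [hX']
      linarith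
    · refine Or.inr (Or.inr ⟨h5, ?_⟩)
      have h6 : ((a c : ℕ) : ℝ) = (a' c : ℕ) + 1 := by exact_mod_cast h5
      simp only [hX']
      linarith
  have hY01 : ∀ c, 0 ≤ Y' c ∧ Y' c ≤ 1 := hy.1
  have hX01 : ∀ c, 0 ≤ X' c ∧ X' c ≤ 1 := hx.1
  have hXd : ∀ c, 2 ^ k * x c - ((a' c : ℕ) : ℝ) = X' c + (a c : ℕ) - (a' c : ℕ) := fun c => by
    simp only [hX']; ring
  have hYd : ∀ c, 2 ^ k * y c - ((a' c : ℕ) : ℝ) = Y' c + (a c : ℕ) - (a' c : ℕ) := fun c => by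
    simp only [hY']; ring
  refine ⟨fun c => ?_, fun i j hij => ?_⟩
  · rw [hYd]
    have h1 := hY01 c
    rcases hoff c with h5 | ⟨h5, h6⟩ | ⟨h5, h6⟩
    · rw [h5]; constructor <;> linarith
    · have h7 := hone c h6
      rw [h5]; push_cast; constructor <;> linarith
    · have h7 := hzero c h6
      rw [h5]; push_cast; constructor <;> linarith
  · have hle := hx'.2 hij
    dsimp only at hle ⊢
    rw [hXd, hXd] at hle
    rw [hYd, hYd]
    generalize σ' i = c at *
    generalize σ' j = c' at *
    have h1 := hY01 c
    have h1' := hY01 c'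
    have h2 := hX01 c
    have h2' := hX01 c'
    -- The order of two local coordinates in the second cube is checked for each pair of offsets. It
    -- follows from the order in the first cube, or from values that `y` shares with `x` on a common
    -- face.
    rcases hoff c with h5 | ⟨h5, h6⟩ | ⟨h5, h6⟩ <;>
    rcases hoff c' with h5' | ⟨h5', h6'⟩ | ⟨h5', h6'⟩ <;>
    rw [h5, h5'] at hle ⊢ <;> push_cast at hle ⊢
    · have := hord c c' (by linarith); linarith
    · have := hone c' h6'; linarith
    · have := hone c (by linarith); have := hzero c' h6'; linarith
    · have := hone c h6; have := hzero c' (by linarith); linarith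
    · have := hord c c' (by linarith); linarith
    · linarith
    · have := hzero c h6; linarith
    · have := hzero c h6; have := hone c' h6'; linarith
    · have := hord c c' (by linarith); linarith

/-- The local interpolants on two Kuhn simplices agree on the intersection. -/
theorem eval_localInterpolant_eq {r k : ℕ} (hr : 2 ≤ r) {a a' : Fin d → Fin (2 ^ k)}
    {σ σ' : Equiv.Perm (Fin d)} {x : EuclideanSpace ℝ (Fin d)} (hx : x ∈ kuhnSimplex k a σ)
    (hx' : x ∈ kuhnSimplex k a' σ') (g : EuclideanSpace ℝ (Fin d) → ℝ) :
    eval (fun i => x i) (localInterpolant r k a σ g) =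
      eval (fun i => x i) (localInterpolant r k a' σ' g) := by
  classical
  obtain ⟨hL1, hL2⟩ := localInterpolant_spec hr k a σ g
  obtain ⟨hL1', hL2'⟩ := localInterpolant_spec hr k a' σ' g
  set D := localInterpolant r k a σ g - localInterpolant r k a' σ' g with hD
  have hDdeg : D.totalDegree < r := (totalDegree_sub _ _).trans_lt (max_lt hL1 hL1')
  have hfin : (interpGrid d r k ∩ kuhnSimplex k a σ).Finite :=
    (interpGrid_finite d r k).inter_of_left _
  choose! φ h1 h2 h3 h4 using
    fun y (hy : y ∈ interpGrid d r k ∩ kuhnSimplex k a σ) => exists_localBasis_vanishing hr hy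
  -- The difference of the interpolants is expanded in the nodal basis of the first simplex.
  have hrep : D = ∑ y ∈ hfin.toFinset, C (eval (fun i => y i) D) * φ y := by
    refine (existsUnique_localInterpolant hr k a σ (fun y => eval (fun i => y i) D)).unique
      ⟨hDdeg, fun _ _ => rfl⟩ ⟨?_, fun z hz => ?_⟩
    · refine (totalDegree_finsetSum_le (d := r - 1) fun y hy => ?_).trans_lt (by omega)
      refine (totalDegree_mul _ _).trans ?_
      rw [totalDegree_C]
      have := h1 y (hfin.mem_toFinset.1 hy)
      omega
    · rw [map_sum, Finset.sum_eq_single z]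
      · rw [map_mul, eval_C, h2 z hz, mul_one]
      · intro y hy hyz
        rw [map_mul, h3 y (hfin.mem_toFinset.1 hy) z hz (Ne.symm hyz), mul_zero]
      · exact fun h => absurd (hfin.mem_toFinset.2 hz) h
  have hzero : eval (fun i => x i) D = 0 := by
    rw [hrep, map_sum]
    refine Finset.sum_eq_zero fun y hy => ?_
    rw [map_mul, eval_C]
    have hyS := hfin.mem_toFinset.1 hy
    by_cases hφ : eval (fun i => x i) (φ y) = 0
    · rw [hφ, mul_zero]
    -- A basis polynomial that does not vanish at `x` has its node on the smallest face containing
    -- `x`, hence in both simplices, where both interpolants equal `g`.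
    · have hyT := mem_kuhnSimplex_of_bary hr hx hx' hyS.2 (h4 y hyS x hφ)
      have : eval (fun i => y i) D = 0 := by
        rw [hD, map_sub, hL2 y hyS, hL2' y ⟨hyS.1, hyT⟩, sub_self]
      rw [this, zero_mul]
  rw [hD, map_sub, sub_eq_zero] at hzero
  exact hzero

/-- Agreement on overlaps makes the choice of a simplex in the definition irrelevant. -/
theorem simplicialInterpolant_eq {r k : ℕ} (hr : 2 ≤ r) {a : Fin d → Fin (2 ^ k)}
    {σ : Equiv.Perm (Fin d)} {x : EuclideanSpace ℝ (Fin d)} (hx : x ∈ kuhnSimplex k a σ)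
    (g : EuclideanSpace ℝ (Fin d) → ℝ) :
    simplicialInterpolant r k g x = eval (fun i => x i) (localInterpolant r k a σ g) := by
  have h : ∃ T : (Fin d → Fin (2 ^ k)) × Equiv.Perm (Fin d), x ∈ kuhnSimplex k T.1 T.2 :=
    ⟨(a, σ), hx⟩
  rw [simplicialInterpolant, dif_pos h]
  exact eval_localInterpolant_eq hr h.choose_spec hx g

lemma mem_closedCube_dyadicCorner_iff {k : ℕ} {a : Fin d → Fin (2 ^ k)}
    {x : EuclideanSpace ℝ (Fin d)} : x ∈ closedCube (dyadicCorner k a) ((2⁻¹ : ℝ) ^ k) ↔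
      ∀ i, 0 ≤ 2 ^ k * x i - (a i : ℕ) ∧ 2 ^ k * x i - (a i : ℕ) ≤ (1 : ℝ) := by
  refine forall_congr' fun c => ?_
  have h2 : (0 : ℝ) < 2 ^ k := by positivity
  have e : (2⁻¹ : ℝ) ^ k = (2 ^ k)⁻¹ := inv_pow _ _
  rw [dyadicCorner_apply, e, ← mul_add_one, inv_mul_le_iff₀ h2, le_inv_mul_iff₀ h2]
  constructor <;> rintro ⟨h1, h2⟩ <;> constructor <;> linarith

lemma kuhnSimplex_subset_closedCube (k : ℕ) (a : Fin d → Fin (2 ^ k)) (σ : Equiv.Perm (Fin d)) :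
    kuhnSimplex k a σ ⊆ closedCube (dyadicCorner k a) ((2⁻¹ : ℝ) ^ k) := fun _ hx =>
  mem_closedCube_dyadicCorner_iff.2 hx.1

/-- Sorting the local coordinates in decreasing order gives the permutation. -/
lemma exists_mem_kuhnSimplex {k : ℕ} {a : Fin d → Fin (2 ^ k)} {x : EuclideanSpace ℝ (Fin d)}
    (hx : x ∈ closedCube (dyadicCorner k a) ((2⁻¹ : ℝ) ^ k)) : ∃ σ, x ∈ kuhnSimplex k a σ := by
  refine ⟨Tuple.sort fun i => -((2 : ℝ) ^ k * x i - (a i : ℕ)),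
    mem_closedCube_dyadicCorner_iff.1 hx, fun i j hij => ?_⟩
  have := Tuple.monotone_sort (fun i => -((2 : ℝ) ^ k * x i - (a i : ℕ))) hij
  simp only [Function.comp_apply, neg_le_neg_iff] at this
  exact this

lemma exists_mem_closedCube_dyadicCorner (k : ℕ) {x : EuclideanSpace ℝ (Fin d)}
    (hx : x ∈ closedUnitCube d) :
    ∃ a : Fin d → Fin (2 ^ k), x ∈ closedCube (dyadicCorner k a) ((2⁻¹ : ℝ) ^ k) := by
  have h2 : (0 : ℝ) < 2 ^ k := by positivity
  -- The cap `2^k - 1` matters only on the face where a coordinate equals one; such points belong to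
  -- the last cube.
  refine ⟨fun c => ⟨min ⌊(2 : ℝ) ^ k * x c⌋₊ (2 ^ k - 1), ?_⟩,
    mem_closedCube_dyadicCorner_iff.2 fun c => ?_⟩
  · have : 0 < 2 ^ k := by positivity
    omega
  · dsimp only
    have hx0 : 0 ≤ 2 ^ k * x c := mul_nonneg h2.le (hx c).1
    have hx1 : 2 ^ k * x c ≤ 2 ^ k := mul_le_of_le_one_right h2.le (hx c).2
    have hf1 := Nat.floor_le hx0
    have hf2 := Nat.lt_floor_add_one (2 ^ k * x c)
    rcases min_cases ⌊(2 : ℝ) ^ k * x c⌋₊ (2 ^ k - 1) with ⟨h, -⟩ | ⟨h, h'⟩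
    · rw [h]; constructor <;> linarith
    · rw [h, Nat.cast_sub Nat.one_le_two_pow]
      have : ((2 ^ k - 1 + 1 : ℕ) : ℝ) ≤ ⌊(2 : ℝ) ^ k * x c⌋₊ := by exact_mod_cast h'
      rw [Nat.sub_add_cancel Nat.one_le_two_pow] at this
      push_cast at this ⊢
      constructor <;> linarith

/-- Values and gradients of a polynomial on a dyadic cube are controlled by its values at the nodes of
any Kuhn simplex of the cube. -/
theorem exists_kuhn_bound (d : ℕ) {N : ℕ} (hN : 1 ≤ N) :
    ∃ Λ : ℝ, 0 ≤ Λ ∧ ∀ (k : ℕ) (a : Fin d → Fin (2 ^ k)) (σ : Equiv.Perm (Fin d)),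
      ∀ F ∈ polyFun d N, ∀ e, 0 ≤ e →
      (∀ y ∈ interpGrid d (N + 1) k ∩ kuhnSimplex k a σ, |F y| ≤ e) →
      ∀ x ∈ closedCube (dyadicCorner k a) ((2⁻¹ : ℝ) ^ k),
        |F x| ≤ Λ * e ∧ ‖fderiv ℝ F x‖ ≤ Λ * 2 ^ k * e := by
  have hr : 2 ≤ N + 1 := by omega
  have hun : ∀ σ : Equiv.Perm (Fin d), ∀ F ∈ polyFun d N,
      (∀ y ∈ interpGrid d (N + 1) 0 ∩ kuhnSimplex 0 (0 : Fin d → Fin (2 ^ 0)) σ, F y = 0) →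
      F = 0 := by
    rintro σ F ⟨P, hP, hF⟩ h
    have h1 : P = 0 := by
      refine (existsUnique_localInterpolant hr 0 (0 : Fin d → Fin (2 ^ 0)) σ 0).unique
        ⟨by omega, fun y hy => ?_⟩ ⟨by simp, fun y _ => by simp⟩
      rw [← hF, h y hy]; rfl
    ext x
    rw [hF, h1]; simp
  -- The constants come from the unit cube, `k = 0`, one for each of the finitely many permutations;
  -- the other cubes are affine images with nodes mapped to nodes.
  choose Λ hΛ hb using fun σ => exists_bound_of_unisolvent ((interpGrid_finite d (N + 1) 0).inter_of_left _)
    (hun σ) (isCompact_closedCube (0 : EuclideanSpace ℝ (Fin d)) 1)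
  refine ⟨∑ σ, Λ σ, Finset.sum_nonneg fun σ _ => hΛ σ, fun k a σ F hF e he hFe x hx => ?_⟩
  set δ : ℝ := (2⁻¹ : ℝ) ^ k with hδ
  have hδ0 : 0 < δ := by positivity
  have h2δ : (2 : ℝ) ^ k * δ = 1 := by rw [hδ, ← mul_pow]; norm_num
  set b := dyadicCorner k a with hbdef
  have hcoord : ∀ (z : EuclideanSpace ℝ (Fin d)) c,
      2 ^ k * (b + δ • z) c - ((a c : ℕ) : ℝ) = z c := by
    intro z c
    have : (b + δ • z) c = δ * (a c : ℕ) + δ * z c := by simp [hbdef, hδ]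
    rw [this, mul_add, ← mul_assoc, ← mul_assoc, h2δ]; ring
  have hnode : ∀ z ∈ interpGrid d (N + 1) 0 ∩ kuhnSimplex 0 (0 : Fin d → Fin (2 ^ 0)) σ,
      b + δ • z ∈ interpGrid d (N + 1) k ∩ kuhnSimplex k a σ := by
    rintro z ⟨⟨j, hj⟩, hz1, hz2⟩
    have hN0 : (N : ℝ) ≠ 0 := by exact_mod_cast (by omega : N ≠ 0)
    refine ⟨⟨fun c => N * (a c : ℕ) + j c, fun c => ⟨?_, ?_⟩⟩, fun c => ?_, ?_⟩
    · have h1 := (hj c).1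
      have h2 : (a c : ℕ) + 1 ≤ 2 ^ k := (a c).2
      simp only [Nat.add_sub_cancel, pow_zero, mul_one] at h1 ⊢
      calc N * (a c : ℕ) + j c ≤ N * ((a c : ℕ) + 1) := by rw [mul_add_one]; omega
        _ ≤ N * 2 ^ k := Nat.mul_le_mul_left _ h2
    · have h1 := (hj c).2
      have h3 := hcoord z c
      simp only [Nat.add_sub_cancel, pow_zero, mul_one] at h1 ⊢
      rw [h1] at h3
      have h2 : (0 : ℝ) < 2 ^ k := by positivity
      rw [eq_div_iff (by positivity)]
      have h4 : 2 ^ k * (b + δ • z) c = (a c : ℕ) + j c / N := by linarith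
      calc (b + δ • z) c * ((N : ℝ) * 2 ^ k) = N * (2 ^ k * (b + δ • z) c) := by ring
        _ = _ := by rw [h4]; push_cast; field_simp
    · rw [hcoord]
      simpa using hz1 c
    · simp only [hcoord]
      simpa using hz2
  have hFb := comp_affine_mem_polyFun hF b δ
  have key := hb σ _ hFb e he fun z hz => hFe _ (hnode z hz)
  set z : EuclideanSpace ℝ (Fin d) := (2 : ℝ) ^ k • (x - b) with hz
  have hxz : b + δ • z = x := by
    rw [hz, smul_smul, mul_comm, h2δ, one_smul, add_sub_cancel]
  have hzK : z ∈ closedCube (0 : EuclideanSpace ℝ (Fin d)) 1 := by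
    intro c
    have h1 := mem_closedCube_dyadicCorner_iff.1 hx c
    rw [← hxz, hcoord] at h1
    simpa using h1
  obtain ⟨k1, k2⟩ := key z hzK
  have hsum : Λ σ ≤ ∑ σ, Λ σ := Finset.single_le_sum (fun σ _ => hΛ σ) (Finset.mem_univ σ)
  rw [hxz] at k1
  refine ⟨k1.trans (by gcongr), ?_⟩
  -- The chain rule with `δ = 2^{-k}` produces the factor `2^k` in the gradient bound.
  have hder : fderiv ℝ (fun x => F (b + δ • x)) z = δ • fderiv ℝ F x := by
    have hF' : HasFDerivAt F (fderiv ℝ F x) (b + δ • z) := by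
      rw [hxz]
      exact ((contDiff_of_mem_polyFun hF).differentiable (by simp) x).hasFDerivAt
    have hA : HasFDerivAt (fun z : EuclideanSpace ℝ (Fin d) => b + δ • z)
        (δ • ContinuousLinearMap.id ℝ _) z := ((hasFDerivAt_id z).const_smul δ).const_add b
    refine (hF'.comp z hA).fderiv.trans ?_
    ext v; simp
  rw [hder, norm_smul, Real.norm_of_nonneg hδ0.le] at k2
  calc ‖fderiv ℝ F x‖ = 2 ^ k * (δ * ‖fderiv ℝ F x‖) := by rw [← mul_assoc, h2δ, one_mul]
    _ ≤ 2 ^ k * (Λ σ * e) := by gcongr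
    _ ≤ 2 ^ k * ((∑ σ, Λ σ) * e) := by gcongr
    _ = _ := by ring

end kuhn

/-! ### Weak derivatives of piecewise smooth functions -/

section weakDeriv
open Filter Topology
open scoped NNReal

/-- A function on a convex set that is Lipschitz on each of finitely many closed sets that cover it
is Lipschitz. -/
lemma lipschitzOnWith_of_finite_closed_cover {E : Type*} [NormedAddCommGroup E] [NormedSpace ℝ E]
    {ι : Type*} [Finite ι] {T : ι → Set E} (hT : ∀ i, IsClosed (T i)) (hconv : Convex ℝ (⋃ i, T i))
    {f : E → ℝ} {K : ℝ≥0} (hf : ∀ i, LipschitzOnWith K f (T i)) : LipschitzOnWith K f (⋃ i, T i) := by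
  have hcont : ContinuousOn f (⋃ i, T i) :=
    (locallyFinite_of_finite T).continuousOn_iUnion hT fun i => (hf i).continuousOn
  refine LipschitzOnWith.of_dist_le_mul fun x hx y hy => ?_
  set γ : ℝ → E := fun t => AffineMap.lineMap x y t with hγ
  have hγc : Continuous γ := AffineMap.lineMap_continuous
  have hγd : ∀ t t', dist (γ t) (γ t') = |t - t'| * dist x y := fun t t' => by
    rw [hγ, dist_lineMap_lineMap, Real.dist_eq]
  have hγm : ∀ t ∈ Icc (0 : ℝ) 1, γ t ∈ ⋃ i, T i := fun t ht =>
    hconv.segment_subset hx hy (by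
      rw [segment_eq_image_lineMap]; exact mem_image_of_mem _ ht)
  -- Continuous induction along the segment from `x` to `y`: the set of times at which the estimate
  -- holds is closed and can be advanced from each of its points before time one.
  set A : Set ℝ := {t | dist (f (γ t)) (f x) ≤ K * (t * dist x y)} with hA
  have hsub : Icc (0 : ℝ) 1 ⊆ A := by
    have hcomp : ContinuousOn (fun t => f (γ t)) (Icc (0 : ℝ) 1) :=
      hcont.comp hγc.continuousOn hγm
    refine IsClosed.Icc_subset_of_forall_exists_gt ?_ ?_ ?_
    · have h1 : ContinuousOn (fun t => |f (γ t) - f x| - K * (t * dist x y)) (Icc (0 : ℝ) 1) :=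
        (hcomp.sub continuousOn_const).abs.sub (by fun_prop)
      have h2 := h1.preimage_isClosed_of_isClosed isClosed_Icc (isClosed_Iic (a := (0 : ℝ)))
      convert h2 using 1
      ext t
      simp [hA, Real.dist_eq, and_comm]
    · simp [hA, hγ]
    · rintro t ⟨htA, ht0, ht1⟩ z hz
      have hev : ∀ᶠ t' in 𝓝[>] t, ∃ i, γ t' ∈ T i := by
        filter_upwards [Ioo_mem_nhdsGT ht1] with t' ht'
        exact mem_iUnion.1 (hγm t' ⟨ht0.trans ht'.1.le, ht'.2.le⟩)
      -- Finitely many sets cover the segment, so one of them is met at times arbitrarily close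
      -- after `t`; being closed, it also contains the point at time `t`.
      obtain ⟨i, hi⟩ : ∃ i, ∃ᶠ t' in 𝓝[>] t, γ t' ∈ T i := by
        by_contra! h
        have h2 := eventually_all.2 h
        obtain ⟨t', ⟨i, h3⟩, h4⟩ := (hev.and h2).exists
        exact h4 i h3
      have hti : γ t ∈ T i := by
        have hcl : IsClosed (γ ⁻¹' T i) := (hT i).preimage hγc
        exact hcl.mem_of_frequently_of_tendsto hi (tendsto_id.mono_right nhdsWithin_le_nhds)
      obtain ⟨t', ht', ht'z⟩ := (hi.and_eventually (Ioc_mem_nhdsGT hz)).exists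
      refine ⟨t', ?_, ht'z⟩
      have h1 := (hf i).dist_le_mul _ ht' _ hti
      rw [hγd, abs_of_pos (sub_pos.2 ht'z.1)] at h1
      have h2 : dist (f (γ t)) (f x) ≤ K * (t * dist x y) := htA
      calc dist (f (γ t')) (f x) ≤ dist (f (γ t')) (f (γ t)) + dist (f (γ t)) (f x) :=
            dist_triangle _ _ _
        _ ≤ K * ((t' - t) * dist x y) + K * (t * dist x y) := add_le_add h1 h2
        _ = K * (t' * dist x y) := by ring
  have h1 : dist (f (γ 1)) (f x) ≤ K * (1 * dist x y) := hsub (by simp : (1 : ℝ) ∈ Icc (0 : ℝ) 1)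
  have e : γ 1 = y := AffineMap.lineMap_apply_one x y
  rwa [one_mul, e, dist_comm] at h1

variable {d : ℕ}

/-- Lipschitz functions have weak partial derivatives. -/
lemma hasWeakPartialDeriv_of_lipschitzWith {Ω : Set (EuclideanSpace ℝ (Fin d))}
    {K : ℝ≥0} {u : EuclideanSpace ℝ (Fin d) → ℝ} (hu : LipschitzWith K u)
    (i : Fin d) :
    HasWeakPartialDeriv Ω i u fun x => lineDeriv ℝ u x (EuclideanSpace.single i 1) := by
  intro φ hφ hφc hφΩ
  obtain ⟨D, hD⟩ := hφ.lipschitzWith_of_hasCompactSupport hφc (by simp)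
  set e : EuclideanSpace ℝ (Fin d) := EuclideanSpace.single i 1
  have h := hu.integral_lineDeriv_mul_eq (μ := volume) hD hφc e
  have hd : ∀ x, lineDeriv ℝ φ x (-e) = -fderiv ℝ φ x e := fun x => by
    rw [(hφ.differentiable (by simp) x).lineDeriv_eq_fderiv, map_neg]
  have hout : ∀ x, x ∉ Ω → x ∉ tsupport φ := fun x hx hxs => hx (hφΩ hxs)
  rw [setIntegral_eq_integral_of_forall_compl_eq_zero (fun x hx => by
      rw [fderiv_of_notMem_tsupport ℝ (hout x hx)]; simp),
    setIntegral_eq_integral_of_forall_compl_eq_zero (fun x hx => by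
      rw [image_eq_zero_of_notMem_tsupport (hout x hx), mul_zero]), h, ← integral_neg]
  refine integral_congr_ae (Eventually.of_forall fun x => ?_)
  dsimp only
  rw [hd]; ring

lemma HasWeakPartialDeriv.sub {Ω : Set (EuclideanSpace ℝ (Fin d))} {i : Fin d}
    {u u' v v' : EuclideanSpace ℝ (Fin d) → ℝ} (h : HasWeakPartialDeriv Ω i u v)
    (h' : HasWeakPartialDeriv Ω i u' v')
    (hu : MemLp u 2 (volume.restrict Ω)) (hv : MemLp v 2 (volume.restrict Ω))
    (hu' : MemLp u' 2 (volume.restrict Ω)) (hv' : MemLp v' 2 (volume.restrict Ω)) :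
    HasWeakPartialDeriv Ω i (fun x => u x - u' x) (fun x => v x - v' x) := by
  intro φ hφ hφc hφΩ
  have hφ2 : MemLp φ 2 (volume.restrict Ω) :=
    (hφ.continuous.memLp_of_hasCompactSupport hφc).restrict Ω
  have hdφ2 : MemLp (fun x => fderiv ℝ φ x (EuclideanSpace.single i 1)) 2 (volume.restrict Ω) :=
    (((hφ.continuous_fderiv (by simp)).clm_apply continuous_const).memLp_of_hasCompactSupport
      (hφc.fderiv_apply ℝ _)).restrict Ω
  have e1 := h φ hφ hφc hφΩ
  have e2 := h' φ hφ hφc hφΩ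
  have i1 : ∀ {w ψ : EuclideanSpace ℝ (Fin d) → ℝ}, MemLp w 2 (volume.restrict Ω) →
      MemLp ψ 2 (volume.restrict Ω) → Integrable (fun x => w x * ψ x) (volume.restrict Ω) :=
    fun hw hψ => hw.integrable_mul hψ
  simp only [sub_mul]
  rw [integral_sub (i1 hu hdφ2) (i1 hu' hdφ2), integral_sub (i1 hv hφ2) (i1 hv' hφ2), e1, e2]
  ring

/-- Hölder's inequality; this makes both sides of the defining identity of weak derivatives
continuous under `L_2` limits. -/
lemma tendsto_integral_mul_of_tendsto_eLpNorm {α : Type*} [MeasurableSpace α] {μ : Measure α}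
    {u : ℕ → α → ℝ} {w ψ : α → ℝ} (hu : ∀ n, MemLp (u n) 2 μ) (hw : MemLp w 2 μ) (hψ : MemLp ψ 2 μ)
    (h : Tendsto (fun n => eLpNorm (u n - w) 2 μ) atTop (𝓝 0)) :
    Tendsto (fun n => ∫ x, u n x * ψ x ∂μ) atTop (𝓝 (∫ x, w x * ψ x ∂μ)) := by
  refine tendsto_integral_of_L1' _ (hw.integrable_mul hψ).aestronglyMeasurable
    (Eventually.of_forall fun n => (hu n).integrable_mul hψ) ?_
  have hle : ∀ n, eLpNorm ((fun x => u n x * ψ x) - fun x => w x * ψ x) 1 μ ≤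
      eLpNorm (u n - w) 2 μ * eLpNorm ψ 2 μ := by
    intro n
    have e : ((fun x => u n x * ψ x) - fun x => w x * ψ x) = (u n - w) • ψ := by
      ext x; simp [sub_mul]
    rw [e]
    exact eLpNorm_smul_le_mul_eLpNorm hψ.1 ((hu n).sub hw).1
  have h0 : Tendsto (fun n => eLpNorm (u n - w) 2 μ * eLpNorm ψ 2 μ) atTop (𝓝 0) := by
    have := ENNReal.Tendsto.mul_const h (Or.inr hψ.2.ne)
    rwa [zero_mul] at this
  exact tendsto_of_tendsto_of_tendsto_of_le_of_le tendsto_const_nhds h0 (fun _ => zero_le) hle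

lemma hasWeakPartialDeriv_of_tendsto {Ω : Set (EuclideanSpace ℝ (Fin d))} {i : Fin d}
    {u v : ℕ → EuclideanSpace ℝ (Fin d) → ℝ} {w z : EuclideanSpace ℝ (Fin d) → ℝ}
    (h : ∀ n, HasWeakPartialDeriv Ω i (u n) (v n))
    (hu : ∀ n, MemLp (u n) 2 (volume.restrict Ω)) (hv : ∀ n, MemLp (v n) 2 (volume.restrict Ω))
    (hw : MemLp w 2 (volume.restrict Ω)) (hz : MemLp z 2 (volume.restrict Ω))
    (huw : Tendsto (fun n => eLpNorm (u n - w) 2 (volume.restrict Ω)) atTop (𝓝 0))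
    (hvz : Tendsto (fun n => eLpNorm (v n - z) 2 (volume.restrict Ω)) atTop (𝓝 0)) :
    HasWeakPartialDeriv Ω i w z := by
  intro φ hφ hφc hφΩ
  have hφ2 : MemLp φ 2 (volume.restrict Ω) :=
    (hφ.continuous.memLp_of_hasCompactSupport hφc).restrict Ω
  have hdφ2 : MemLp (fun x => fderiv ℝ φ x (EuclideanSpace.single i 1)) 2 (volume.restrict Ω) :=
    (((hφ.continuous_fderiv (by simp)).clm_apply continuous_const).memLp_of_hasCompactSupport
      (hφc.fderiv_apply ℝ _)).restrict Ω
  have h1 := tendsto_integral_mul_of_tendsto_eLpNorm hu hw hdφ2 huw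
  have h2 := (tendsto_integral_mul_of_tendsto_eLpNorm hv hz hφ2 hvz).neg
  refine tendsto_nhds_unique h1 (h2.congr fun n => ?_)
  exact (h n φ hφ hφc hφΩ).symm

lemma HasWeakPartialDeriv.congr_ae {Ω : Set (EuclideanSpace ℝ (Fin d))} {i : Fin d}
    {u u' v : EuclideanSpace ℝ (Fin d) → ℝ} (h : HasWeakPartialDeriv Ω i u v)
    (hu : u =ᵐ[volume.restrict Ω] u') : HasWeakPartialDeriv Ω i u' v := by
  intro φ hφ hφc hφΩ
  rw [← h φ hφ hφc hφΩ]
  refine integral_congr_ae ?_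
  filter_upwards [hu] with x hx
  rw [hx]

end weakDeriv

/-! ### Weak gradient of the simplicial interpolant -/

section simplicialDeriv
open Filter Topology MvPolynomial
open scoped NNReal
variable {d : ℕ}

lemma isClosed_kuhnSimplex (k : ℕ) (a : Fin d → Fin (2 ^ k)) (σ : Equiv.Perm (Fin d)) :
    IsClosed (kuhnSimplex k a σ) := by
  have e : kuhnSimplex k a σ = closedCube (dyadicCorner k a) ((2⁻¹ : ℝ) ^ k) ∩
      ⋂ (i : Fin d) (j : Fin d) (_ : i ≤ j), {x | (2 : ℝ) ^ k * x (σ j) - (a (σ j) : ℕ) ≤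
        (2 : ℝ) ^ k * x (σ i) - (a (σ i) : ℕ)} := by
    ext x
    rw [mem_inter_iff, mem_closedCube_dyadicCorner_iff]
    simp [kuhnSimplex, Antitone]
  rw [e]
  refine (isClosed_closedCube _ _).inter (isClosed_iInter fun i => isClosed_iInter fun j =>
    isClosed_iInter fun _ => isClosed_le ?_ ?_) <;> fun_prop

lemma convex_kuhnSimplex (k : ℕ) (a : Fin d → Fin (2 ^ k)) (σ : Equiv.Perm (Fin d)) :
    Convex ℝ (kuhnSimplex k a σ) := by
  intro x hx y hy s t hs ht hst
  have e : ∀ c, (2 : ℝ) ^ k * (s • x + t • y) c - (a c : ℕ) =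
      s * (2 ^ k * x c - (a c : ℕ)) + t * (2 ^ k * y c - (a c : ℕ)) := by
    intro c
    simp only [PiLp.add_apply, PiLp.smul_apply, smul_eq_mul]
    linear_combination (((a c : ℕ) : ℝ)) * hst
  refine ⟨fun c => ?_, fun i j hij => ?_⟩
  · rw [e]
    have h1 := hx.1 c
    have h2 := hy.1 c
    refine ⟨add_nonneg (mul_nonneg hs h1.1) (mul_nonneg ht h2.1), ?_⟩
    calc _ ≤ s * 1 + t * 1 :=
          add_le_add (mul_le_mul_of_nonneg_left h1.2 hs) (mul_le_mul_of_nonneg_left h2.2 ht)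
      _ = 1 := by rw [mul_one, mul_one, hst]
  · dsimp only
    rw [e, e]
    exact add_le_add (mul_le_mul_of_nonneg_left (hx.2 hij) hs)
      (mul_le_mul_of_nonneg_left (hy.2 hij) ht)

lemma iUnion_kuhnSimplex (d k : ℕ) :
    ⋃ T : (Fin d → Fin (2 ^ k)) × Equiv.Perm (Fin d), kuhnSimplex k T.1 T.2 = closedUnitCube d := by
  ext x
  rw [mem_iUnion]
  constructor
  · rintro ⟨T, hT⟩
    exact closedCube_dyadicCorner_subset k T.1 (kuhnSimplex_subset_closedCube k T.1 T.2 hT)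
  · intro hx
    obtain ⟨a, ha⟩ := exists_mem_closedCube_dyadicCorner k hx
    obtain ⟨σ, hσ⟩ := exists_mem_kuhnSimplex ha
    exact ⟨(a, σ), hσ⟩

/-- The local interpolant as a function. -/
noncomputable def localFun (r k : ℕ) (a : Fin d → Fin (2 ^ k)) (σ : Equiv.Perm (Fin d))
    (g : EuclideanSpace ℝ (Fin d) → ℝ) : EuclideanSpace ℝ (Fin d) → ℝ :=
  fun x => eval (fun i => x i) (localInterpolant r k a σ g)

lemma localFun_mem_polyFun {N : ℕ} (hN : 1 ≤ N) (k : ℕ) (a : Fin d → Fin (2 ^ k))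
    (σ : Equiv.Perm (Fin d)) (g : EuclideanSpace ℝ (Fin d) → ℝ) :
    localFun (N + 1) k a σ g ∈ polyFun d N :=
  eval_mem_polyFun (Nat.lt_succ_iff.1 (localInterpolant_spec (by omega) k a σ g).1)

/-- On each closed simplex the interpolant is a polynomial, hence Lipschitz; finitely many such
pieces glue over the convex cube. -/
lemma exists_lipschitzOnWith_simplicialInterpolant {N : ℕ} (hN : 1 ≤ N) (k : ℕ)
    (g : EuclideanSpace ℝ (Fin d) → ℝ) :
    ∃ K : ℝ≥0, LipschitzOnWith K (simplicialInterpolant (N + 1) k g) (closedUnitCube d) := by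
  have hconv : Convex ℝ (closedUnitCube d) := by
    intro x hx y hy s t hs ht hst c
    have h1 := hx c
    have h2 := hy c
    simp only [PiLp.add_apply, PiLp.smul_apply, smul_eq_mul]
    refine ⟨add_nonneg (mul_nonneg hs h1.1) (mul_nonneg ht h2.1), ?_⟩
    calc _ ≤ s * 1 + t * 1 :=
          add_le_add (mul_le_mul_of_nonneg_left h1.2 hs) (mul_le_mul_of_nonneg_left h2.2 ht)
      _ = 1 := by rw [mul_one, mul_one, hst]
  have hcpt : IsCompact (closedUnitCube d) := by
    rw [closedUnitCube_eq]; exact isCompact_closedCube _ _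
  have hloc : ∀ T : (Fin d → Fin (2 ^ k)) × Equiv.Perm (Fin d), ∃ K : ℝ≥0,
      LipschitzOnWith K (simplicialInterpolant (N + 1) k g) (kuhnSimplex k T.1 T.2) := by
    intro T
    have hC := contDiff_of_mem_polyFun (localFun_mem_polyFun hN k T.1 T.2 g)
    obtain ⟨M, hM⟩ := hcpt.exists_bound_of_continuousOn
      (hC.continuous_fderiv (by simp)).continuousOn
    refine ⟨M.toNNReal, ?_⟩
    have h1 : LipschitzOnWith M.toNNReal (localFun (N + 1) k T.1 T.2 g) (closedUnitCube d) := by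
      refine Convex.lipschitzOnWith_of_nnnorm_fderiv_le (𝕜 := ℝ)
        (fun x _ => hC.differentiable (by simp) x) (fun x hx => ?_) hconv
      rw [← NNReal.coe_le_coe, coe_nnnorm]
      exact (hM x hx).trans (Real.le_coe_toNNReal M)
    have hsub : kuhnSimplex k T.1 T.2 ⊆ closedUnitCube d :=
      (kuhnSimplex_subset_closedCube k T.1 T.2).trans (closedCube_dyadicCorner_subset k T.1)
    intro x hx y hy
    rw [simplicialInterpolant_eq (by omega) hx, simplicialInterpolant_eq (by omega) hy]
    exact h1 (hsub hx) (hsub hy)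
  choose K hK using hloc
  obtain ⟨M, hM⟩ := (finite_range K).bddAbove
  refine ⟨M, ?_⟩
  have hcov := iUnion_kuhnSimplex d k
  rw [← hcov] at hconv ⊢
  have hcl : ∀ T : (Fin d → Fin (2 ^ k)) × Equiv.Perm (Fin d), IsClosed (kuhnSimplex k T.1 T.2) :=
    fun T => isClosed_kuhnSimplex k T.1 T.2
  have hKM : ∀ T : (Fin d → Fin (2 ^ k)) × Equiv.Perm (Fin d),
      LipschitzOnWith M (simplicialInterpolant (N + 1) k g) (kuhnSimplex k T.1 T.2) :=
    fun T => (hK T).weaken (hM (mem_range_self T))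
  exact lipschitzOnWith_of_finite_closed_cover hcl hconv hKM

/-- The simplicial interpolant has bounded weak partial derivatives, which are the derivatives of the
local interpolants almost everywhere. -/
theorem exists_weakPartialDeriv_simplicialInterpolant {N : ℕ} (hN : 1 ≤ N) (k : ℕ)
    (g : EuclideanSpace ℝ (Fin d) → ℝ) :
    MemLp (simplicialInterpolant (N + 1) k g) 2 (volume.restrict (openUnitCube d)) ∧
    ∃ v : Fin d → EuclideanSpace ℝ (Fin d) → ℝ, ∀ i,
      HasWeakPartialDeriv (openUnitCube d) i (simplicialInterpolant (N + 1) k g) (v i) ∧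
      MemLp (v i) 2 (volume.restrict (openUnitCube d)) ∧
      ∀ᵐ x ∂(volume.restrict (openUnitCube d)), ∀ a σ, x ∈ kuhnSimplex k a σ →
        v i x = fderiv ℝ (localFun (N + 1) k a σ g) x (EuclideanSpace.single i 1) := by
  obtain ⟨K, hK⟩ := exists_lipschitzOnWith_simplicialInterpolant hN k g
  -- A Lipschitz extension to the whole space has bounded line derivatives that integrate by parts,
  -- and it coincides with the interpolant on the cube.
  obtain ⟨u, hu, hug⟩ := hK.extend_real
  have hsubc : openUnitCube d ⊆ closedUnitCube d := fun x hx c => ⟨(hx c).1.le, (hx c).2.le⟩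
  have hae : u =ᵐ[volume.restrict (openUnitCube d)] simplicialInterpolant (N + 1) k g := by
    filter_upwards [ae_restrict_mem isOpen_openUnitCube.measurableSet] with x hx
    exact (hug (hsubc hx)).symm
  have hcpt : IsCompact (closedUnitCube d) := by
    rw [closedUnitCube_eq]; exact isCompact_closedCube _ _
  refine ⟨?_, fun i x => lineDeriv ℝ u x (EuclideanSpace.single i 1), fun i => ⟨?_, ?_, ?_⟩⟩
  · obtain ⟨M, hM⟩ := hcpt.exists_bound_of_continuousOn hu.continuous.continuousOn
    refine (memLp_congr_ae hae).1 (MemLp.of_bound hu.continuous.aestronglyMeasurable M ?_)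
    filter_upwards [ae_restrict_mem isOpen_openUnitCube.measurableSet] with x hx
    exact hM x (hsubc hx)
  · exact (hasWeakPartialDeriv_of_lipschitzWith hu i).congr_ae hae
  · exact MemLp.of_bound (measurable_lineDeriv hu.continuous).aestronglyMeasurable _
      (Eventually.of_forall fun x => norm_lineDeriv_le_of_lipschitz ℝ hu)
  -- The simplices are convex, so their boundaries are null sets; at an interior point the extension
  -- agrees locally with a polynomial.
  · have hfr : ∀ᵐ x : EuclideanSpace ℝ (Fin d), ∀ T : (Fin d → Fin (2 ^ k)) × Equiv.Perm (Fin d),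
        x ∉ frontier (kuhnSimplex k T.1 T.2) :=
      ae_all_iff.2 fun T => measure_eq_zero_iff_ae_notMem.1
        ((convex_kuhnSimplex k T.1 T.2).addHaar_frontier volume)
    filter_upwards [ae_restrict_of_ae hfr] with x hx a σ hxT
    have hint : x ∈ interior (kuhnSimplex k a σ) := by
      by_contra h
      exact hx (a, σ) ⟨subset_closure hxT, h⟩
    have hev : u =ᶠ[𝓝 x] localFun (N + 1) k a σ g := by
      filter_upwards [isOpen_interior.mem_nhds hint] with y hy
      have hyT := interior_subset hy
      rw [← hug (closedCube_dyadicCorner_subset k a (kuhnSimplex_subset_closedCube k a σ hyT)),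
        simplicialInterpolant_eq (by omega) hyT, localFun]
    rw [hev.lineDeriv_eq, DifferentiableAt.lineDeriv_eq_fderiv]
    exact (contDiff_of_mem_polyFun (localFun_mem_polyFun hN k a σ g)).differentiable (by simp) x

end simplicialDeriv

/-! ### The error of interpolation in the norm of `H^1` -/

section errorEstimate
open Filter Topology
variable {d : ℕ}

/-- An `L_2` estimate from pointwise estimates on the dyadic cubes. -/
lemma eLpNorm_two_le_of_dyadicCubes (j : ℕ) {w : EuclideanSpace ℝ (Fin d) → ℝ}
    {e : (Fin d → Fin (2 ^ j)) → ℝ} {c : ℝ} (hc : 0 ≤ c) {D : ℝ≥0∞}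
    (h : ∀ᵐ x ∂(volume.restrict (openUnitCube d)), ∀ a,
      x ∈ closedCube (dyadicCorner j a) ((2⁻¹ : ℝ) ^ j) → |w x| ≤ c * e a)
    (hD : ∑ a, ENNReal.ofReal (e a) ^ 2 ≤ D ^ 2) :
    eLpNorm w 2 (volume.restrict (openUnitCube d)) ≤
      ENNReal.ofReal (c * ((2 : ℝ) ^ (-((d : ℝ) / 2))) ^ j) * D := by
  set b : ℝ := (2 : ℝ) ^ (-((d : ℝ) / 2)) with hb
  have hb0 : 0 < b := by positivity
  -- The square of `b^j` is the volume of a dyadic cube of level `j`.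
  have hbd : (b ^ j) ^ 2 = ((2⁻¹ : ℝ) ^ j) ^ d := by
    have h2 : (0 : ℝ) < 2 := by norm_num
    rw [hb, inv_pow]
    simp only [← Real.rpow_natCast, ← Real.rpow_mul h2.le, ← Real.rpow_neg h2.le]
    congr 1
    push_cast; ring
  have hm : ∀ a, MeasurableSet (closedCube (dyadicCorner (d := d) j a) ((2⁻¹ : ℝ) ^ j)) := fun a =>
    (isClosed_closedCube _ _).measurableSet
  have hint : ∫⁻ x in openUnitCube d, ‖w x‖ₑ ^ (2 : ℝ) ≤ (ENNReal.ofReal (c * b ^ j) * D) ^ (2 : ℝ) := by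
    calc ∫⁻ x in openUnitCube d, ‖w x‖ₑ ^ (2 : ℝ)
        ≤ ∫⁻ x in openUnitCube d, ∑ a, (closedCube (dyadicCorner j a) ((2⁻¹ : ℝ) ^ j)).indicator
            (fun _ => ENNReal.ofReal c ^ 2 * ENNReal.ofReal (e a) ^ 2) x := by
          refine lintegral_mono_ae ?_
          filter_upwards [h, ae_restrict_mem isOpen_openUnitCube.measurableSet] with x hx hxΩ
          obtain ⟨a, ha⟩ := exists_mem_closedCube_dyadicCorner j
            (show x ∈ closedUnitCube d from fun c => ⟨(hxΩ c).1.le, (hxΩ c).2.le⟩)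
          refine le_trans ?_ (Finset.single_le_sum (f := fun a =>
            (closedCube (dyadicCorner j a) ((2⁻¹ : ℝ) ^ j)).indicator
            (fun _ => ENNReal.ofReal c ^ 2 * ENNReal.ofReal (e a) ^ 2) x) (fun _ _ => zero_le)
            (Finset.mem_univ a))
          rw [indicator_of_mem ha, ← mul_pow, ← ENNReal.ofReal_mul hc, Real.enorm_eq_ofReal_abs,
            ENNReal.rpow_two]
          gcongr
          exact hx a ha
      _ ≤ ∑ a, ENNReal.ofReal c ^ 2 * ENNReal.ofReal (e a) ^ 2 * ENNReal.ofReal ((2⁻¹ : ℝ) ^ j) ^ d := by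
          rw [lintegral_finsetSum _ fun a _ => measurable_const.indicator (hm a)]
          refine Finset.sum_le_sum fun a _ => (setLIntegral_le_lintegral _ _).trans ?_
          rw [lintegral_indicator_const (hm a), volume_closedCube]
      _ ≤ ENNReal.ofReal c ^ 2 * D ^ 2 * ENNReal.ofReal ((2⁻¹ : ℝ) ^ j) ^ d := by
          rw [← Finset.sum_mul, ← Finset.mul_sum]
          gcongr
      _ = (ENNReal.ofReal (c * b ^ j) * D) ^ (2 : ℝ) := by
          rw [ENNReal.rpow_two, mul_pow, ENNReal.ofReal_mul hc, mul_pow,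
            ← ENNReal.ofReal_pow (by positivity : 0 ≤ b ^ j), hbd,
            ENNReal.ofReal_pow (by positivity) d]
          ring
  rw [eLpNorm_eq_lintegral_rpow_enorm_toReal (by simp) (by simp)]
  have := ENNReal.rpow_le_rpow hint (by norm_num : (0 : ℝ) ≤ 1 / 2)
  rw [← ENNReal.rpow_mul, mul_one_div_cancel (by norm_num), ENNReal.rpow_one] at this
  simpa using this

/-- A sequence with geometrically decaying increments converges in `L_2`. -/
lemma exists_eLpNorm_limit {α : Type*} [MeasurableSpace α] {μ : Measure α} {v : ℕ → α → ℝ}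
    (hv : ∀ n, MemLp (v n) 2 μ) {D q : ℝ≥0∞} (hD : D ≠ ⊤) (hq : q < 1)
    (hstep : ∀ j, eLpNorm (v (j + 1) - v j) 2 μ ≤ D * q ^ j) :
    ∃ V, MemLp V 2 μ ∧ Tendsto (fun n => eLpNorm (v n - V) 2 μ) atTop (𝓝 0) ∧
      ∀ k, eLpNorm (V - v k) 2 μ ≤ D * (1 - q)⁻¹ * q ^ k := by
  have h1q : (1 - q)⁻¹ ≠ ⊤ := ENNReal.inv_ne_top.2 (tsub_pos_of_lt hq).ne'
  set T := D * (1 - q)⁻¹ with hTdef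
  have hT : T ≠ ⊤ := ENNReal.mul_ne_top hD h1q
  have hsum : ∀ k i, eLpNorm (v (k + i) - v k) 2 μ ≤ ∑ l ∈ Finset.range i, D * q ^ (k + l) := by
    intro k i
    induction i with
    | zero => simp
    | succ i ih =>
      rw [Finset.sum_range_succ]
      have e : v (k + (i + 1)) - v k = (v (k + i) - v k) + (v (k + i + 1) - v (k + i)) := by
        rw [← add_assoc]; abel
      rw [e]
      refine (eLpNorm_add_le ((hv _).sub (hv _)).1 ((hv _).sub (hv _)).1 (by norm_num)).trans ?_
      exact add_le_add ih (hstep _)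
  have hgeo : ∀ k i, eLpNorm (v (k + i) - v k) 2 μ ≤ T * q ^ k := by
    intro k i
    refine (hsum k i).trans ((ENNReal.sum_le_tsum _).trans (le_of_eq ?_))
    simp_rw [pow_add, ← mul_assoc]
    rw [ENNReal.tsum_mul_left, ENNReal.tsum_geometric, hTdef]
    ring
  have hgeo' : ∀ k n, k ≤ n → eLpNorm (v n - v k) 2 μ ≤ T * q ^ k := fun k n hkn => by
    obtain ⟨i, rfl⟩ := Nat.exists_eq_add_of_le hkn
    exact hgeo k i
  obtain ⟨V, hV, hlim⟩ := Lp.cauchy_complete_eLpNorm (by norm_num) hv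
    -- Two distances to `v k`; the summable term `2^{-k}` makes the inequality strict, also when `T`
    -- vanishes.
    (B := fun k => 2 * (T * q ^ k) + 2⁻¹ ^ k) (by
      rw [ENNReal.tsum_add, ENNReal.tsum_mul_left, ENNReal.tsum_mul_left, ENNReal.tsum_geometric,
        ENNReal.tsum_geometric, ENNReal.one_sub_inv_two, inv_inv]
      exact ENNReal.add_ne_top.2 ⟨ENNReal.mul_ne_top (by simp) (ENNReal.mul_ne_top hT h1q), by simp⟩)
    (fun k n m hn hm => by
      have hqk : T * q ^ k ≠ ⊤ := ENNReal.mul_ne_top hT (ENNReal.pow_ne_top hq.ne_top)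
      refine lt_of_le_of_lt ?_ (ENNReal.lt_add_right (ENNReal.mul_ne_top (by simp) hqk) (by simp))
      have e : v n - v m = (v n - v k) + (v k - v m) := by abel
      rw [e, two_mul]
      refine (eLpNorm_add_le ((hv _).sub (hv _)).1 ((hv _).sub (hv _)).1 (by norm_num)).trans ?_
      refine add_le_add (hgeo' k n hn) ?_
      rw [← neg_sub, eLpNorm_neg]
      exact hgeo' k m hm)
  refine ⟨V, hV, hlim, fun k => ?_⟩
  have h1 : Tendsto (fun n => eLpNorm (v n - V) 2 μ + T * q ^ k) atTop (𝓝 (0 + T * q ^ k)) :=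
    hlim.add_const _
  rw [zero_add] at h1
  refine ge_of_tendsto h1 ?_
  filter_upwards [eventually_ge_atTop k] with n hn
  have e : V - v k = (V - v n) + (v n - v k) := by abel
  rw [e]
  refine (eLpNorm_add_le (hV.sub (hv _)).1 ((hv _).sub (hv _)).1 (by norm_num)).trans ?_
  refine add_le_add ?_ (hgeo' k n hn)
  rw [← neg_sub, eLpNorm_neg]

lemma exists_child_dyadicCube {j : ℕ} {a : Fin d → Fin (2 ^ j)} {x : EuclideanSpace ℝ (Fin d)}
    (hx : x ∈ closedCube (dyadicCorner j a) ((2⁻¹ : ℝ) ^ j)) :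
    ∃ a' : Fin d → Fin (2 ^ (j + 1)),
      x ∈ closedCube (dyadicCorner (j + 1) a') ((2⁻¹ : ℝ) ^ (j + 1)) ∧
      closedCube (dyadicCorner (j + 1) a') ((2⁻¹ : ℝ) ^ (j + 1)) ⊆
        closedCube (dyadicCorner j a) ((2⁻¹ : ℝ) ^ j) := by
  classical
  rw [mem_closedCube_dyadicCorner_iff] at hx
  have key : ∀ c, ∃ b : Fin (2 ^ (j + 1)), ((b : ℕ) = 2 * (a c : ℕ) ∨ (b : ℕ) = 2 * (a c : ℕ) + 1) ∧
      0 ≤ 2 ^ (j + 1) * x c - ((b : ℕ) : ℝ) ∧ 2 ^ (j + 1) * x c - ((b : ℕ) : ℝ) ≤ 1 := by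
    intro c
    have h1 := hx c
    have h2 := (a c).2
    have e : (2 : ℝ) ^ (j + 1) * x c = 2 * (2 ^ j * x c) := by ring
    by_cases h : 2 ^ (j + 1) * x c ≤ 2 * (a c : ℕ) + 1
    · refine ⟨⟨2 * (a c : ℕ), by rw [pow_succ]; omega⟩, Or.inl rfl, ?_, ?_⟩ <;> push_cast <;>
        rw [e] at * <;> linarith
    · push Not at h
      refine ⟨⟨2 * (a c : ℕ) + 1, by rw [pow_succ]; omega⟩, Or.inr rfl, ?_, ?_⟩ <;> push_cast <;>
        rw [e] at * <;> linarith
  choose b hb hb1 hb2 using key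
  refine ⟨b, mem_closedCube_dyadicCorner_iff.2 fun c => ⟨hb1 c, hb2 c⟩, fun y hy => ?_⟩
  rw [mem_closedCube_dyadicCorner_iff] at hy ⊢
  intro c
  have h1 := hy c
  have e : (2 : ℝ) ^ (j + 1) * y c = 2 * (2 ^ j * y c) := by ring
  rw [e] at h1
  rcases hb c with h | h <;> rw [h] at h1 <;> push_cast at h1 <;> constructor <;> linarith

/-- Comparison of the local interpolant with a polynomial on a dyadic cube. -/
lemma localFun_sub_bound {N : ℕ} (hN : 1 ≤ N) {Λ : ℝ}
    (hΛ : ∀ (k : ℕ) (a : Fin d → Fin (2 ^ k)) (σ : Equiv.Perm (Fin d)),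
      ∀ F ∈ polyFun d N, ∀ e, 0 ≤ e →
      (∀ y ∈ interpGrid d (N + 1) k ∩ kuhnSimplex k a σ, |F y| ≤ e) →
      ∀ x ∈ closedCube (dyadicCorner k a) ((2⁻¹ : ℝ) ^ k),
        |F x| ≤ Λ * e ∧ ‖fderiv ℝ F x‖ ≤ Λ * 2 ^ k * e)
    {k : ℕ} {a : Fin d → Fin (2 ^ k)} (σ : Equiv.Perm (Fin d))
    {g P : EuclideanSpace ℝ (Fin d) → ℝ} (hP : P ∈ polyFun d N) {e : ℝ} (he : 0 ≤ e)
    (hgP : ∀ y ∈ closedCube (dyadicCorner k a) ((2⁻¹ : ℝ) ^ k), |g y - P y| ≤ e)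
    {x : EuclideanSpace ℝ (Fin d)} (hx : x ∈ closedCube (dyadicCorner k a) ((2⁻¹ : ℝ) ^ k)) :
    |localFun (N + 1) k a σ g x - P x| ≤ Λ * e ∧
      ∀ i, |fderiv ℝ (localFun (N + 1) k a σ g) x (EuclideanSpace.single i 1) -
        fderiv ℝ P x (EuclideanSpace.single i 1)| ≤ Λ * 2 ^ k * e := by
  have hL := localFun_mem_polyFun hN k a σ g
  obtain ⟨h1, h2⟩ := hΛ k a σ _ ((polyFun d N).sub_mem hL hP) e he (fun y hy => by
    have := (localInterpolant_spec (by omega) k a σ g).2 y hy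
    rw [Pi.sub_apply, localFun, this]
    exact hgP y (kuhnSimplex_subset_closedCube k a σ hy.2)) x hx
  refine ⟨h1, fun i => ?_⟩
  have hd : fderiv ℝ (localFun (N + 1) k a σ g - P) x =
      fderiv ℝ (localFun (N + 1) k a σ g) x - fderiv ℝ P x :=
    fderiv_sub ((contDiff_of_mem_polyFun hL).differentiable (by simp) x)
      ((contDiff_of_mem_polyFun hP).differentiable (by simp) x)
  rw [hd] at h2
  have h3 := (fderiv ℝ (localFun (N + 1) k a σ g) x - fderiv ℝ P x).le_opNorm
    (EuclideanSpace.single i (1 : ℝ))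
  rw [PiLp.norm_single, norm_one, mul_one, Real.norm_eq_abs,
    _root_.sub_apply] at h3
  exact h3.trans h2

/-- The error of the simplicial interpolation in `H^1`, for a function whose errors of local
polynomial approximation on the dyadic cubes are square summable. -/
theorem exists_h1Norm_sub_simplicialInterpolant_le (d : ℕ) {N : ℕ} (hN : 1 ≤ N) {C θ : ℝ}
    (hC : 0 ≤ C) (hθ : 0 < θ) (hθ1 : 2 * (2 : ℝ) ^ (-((d : ℝ) / 2)) * θ < 1) :
    ∃ K : ℝ, 0 < K ∧ ∀ (f g : EuclideanSpace ℝ (Fin d) → ℝ) (B : ℝ≥0∞), B ≠ ⊤ →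
      ContinuousOn g (closedUnitCube d) → f =ᵐ[volume.restrict (openUnitCube d)] g →
      (∀ j : ℕ, ∃ (P : (Fin d → Fin (2 ^ j)) → EuclideanSpace ℝ (Fin d) → ℝ)
          (e : (Fin d → Fin (2 ^ j)) → ℝ), (∀ a, P a ∈ polyFun d N) ∧ (∀ a, 0 ≤ e a) ∧
          (∀ a, ∀ x ∈ closedCube (dyadicCorner j a) ((2⁻¹ : ℝ) ^ j), |g x - P a x| ≤ e a) ∧
          ∑ a, ENNReal.ofReal (e a) ^ 2 ≤ (ENNReal.ofReal (C * θ ^ j) * B) ^ 2) →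
      ∀ k : ℕ, h1Norm (openUnitCube d) (fun x => f x - simplicialInterpolant (N + 1) k g x) ≤
        ENNReal.ofReal (K * (2 * (2 : ℝ) ^ (-((d : ℝ) / 2)) * θ) ^ k) * B := by
  obtain ⟨Λ, hΛ0, hΛ⟩ := exists_kuhn_bound d hN
  set b : ℝ := (2 : ℝ) ^ (-((d : ℝ) / 2)) with hb
  have hb0 : 0 < b := by positivity
  set lam : ℝ := 2 * b * θ with hlam
  have hlam0 : 0 < lam := by positivity
  obtain ⟨K₁, hK₁⟩ : ∃ K₁ : ℝ, K₁ = (1 + Λ) * C := ⟨_, rfl⟩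
  obtain ⟨K₂, hK₂⟩ : ∃ K₂ : ℝ, K₂ = 3 * Λ * C / (1 - lam) := ⟨_, rfl⟩
  have h1lam : 0 < 1 - lam := by linarith
  have hK₁0 : 0 ≤ K₁ := by rw [hK₁]; positivity
  have hK₂0 : 0 ≤ K₂ := by rw [hK₂]; exact div_nonneg (by positivity) h1lam.le
  refine ⟨√(d + 1) * (K₁ + K₂ + 1), by positivity, fun f g B hB hg hfg happ k => ?_⟩
  set μ := volume.restrict (openUnitCube d) with hμ
  set S : ℕ → EuclideanSpace ℝ (Fin d) → ℝ := fun j => simplicialInterpolant (N + 1) j g with hS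
  have hsubc : openUnitCube d ⊆ closedUnitCube d := fun x hx c => ⟨(hx c).1.le, (hx c).2.le⟩
  choose hSL v hv using fun j => exists_weakPartialDeriv_simplicialInterpolant hN j g
  have hgL : MemLp g 2 μ := by
    have hcpt : IsCompact (closedUnitCube d) := by
      rw [closedUnitCube_eq]; exact isCompact_closedCube _ _
    obtain ⟨M, hM⟩ := hcpt.exists_bound_of_continuousOn hg
    refine MemLp.of_bound ((hg.mono hsubc).aestronglyMeasurable
      isOpen_openUnitCube.measurableSet) M ?_
    filter_upwards [ae_restrict_mem isOpen_openUnitCube.measurableSet] with x hx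
    exact hM x (hsubc hx)
  -- the error in `L_2`
  have hval : ∀ j, eLpNorm (g - S j) 2 μ ≤ ENNReal.ofReal (K₁ * lam ^ j) * B := by
    intro j
    obtain ⟨P, e, hP, he, hgP, hsum⟩ := happ j
    refine (eLpNorm_two_le_of_dyadicCubes j (c := 1 + Λ) (by positivity) (Eventually.of_forall
      fun x a hx => ?_) hsum).trans ?_
    · obtain ⟨σ, hσ⟩ := exists_mem_kuhnSimplex hx
      have h1 := (localFun_sub_bound hN hΛ σ (hP a) (he a) (hgP a) hx).1
      have h2 := hgP a x hx
      rw [Pi.sub_apply, hS]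
      dsimp only
      rw [simplicialInterpolant_eq (by omega) hσ]
      change |g x - localFun (N + 1) j a σ g x| ≤ _
      rw [abs_sub_comm] at h1
      calc |g x - localFun (N + 1) j a σ g x|
          ≤ |g x - P a x| + |P a x - localFun (N + 1) j a σ g x| := abs_sub_le _ _ _
        _ ≤ e a + Λ * e a := add_le_add h2 h1
        _ = (1 + Λ) * e a := by ring
    · rw [← mul_assoc, ← ENNReal.ofReal_mul (by positivity)]
      refine mul_le_mul' (ENNReal.ofReal_le_ofReal ?_) le_rfl
      -- The function values converge faster by a factor `2^{-j}`; this surplus is given away to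
      -- have the same rate `lam` as for the gradients.
      have h1 : (1 : ℝ) ≤ 2 ^ j := one_le_pow₀ (by norm_num)
      calc (1 + Λ) * b ^ j * (C * θ ^ j) = K₁ * (1 * (b * θ) ^ j) := by rw [hK₁, mul_pow]; ring
        _ ≤ K₁ * (2 ^ j * (b * θ) ^ j) := by gcongr
        _ = K₁ * lam ^ j := by rw [← mul_pow, hlam, mul_assoc]
  -- the increments of the gradients
  have hder : ∀ i j, eLpNorm (v (j + 1) i - v j i) 2 μ ≤
      ENNReal.ofReal (3 * Λ * C) * B * ENNReal.ofReal lam ^ j := by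
    intro i j
    obtain ⟨P, e, hP, he, hgP, hsum⟩ := happ j
    refine (eLpNorm_two_le_of_dyadicCubes j (c := 3 * Λ * 2 ^ j) (by positivity) ?_ hsum).trans ?_
    · filter_upwards [(hv j i).2.2, (hv (j + 1) i).2.2] with x h1 h2 a hx
      obtain ⟨σ, hσ⟩ := exists_mem_kuhnSimplex hx
      obtain ⟨a', hx', hsub⟩ := exists_child_dyadicCube hx
      obtain ⟨σ', hσ'⟩ := exists_mem_kuhnSimplex hx'
      have h3 := (localFun_sub_bound hN hΛ σ (hP a) (he a) (hgP a) hx).2 i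
      have h4 := (localFun_sub_bound hN hΛ σ' (hP a) (he a)
        (fun y hy => hgP a y (hsub hy)) hx').2 i
      rw [Pi.sub_apply, h1 a σ hσ, h2 a' σ' hσ']
      rw [abs_sub_comm] at h3
      refine (abs_sub_le _ (fderiv ℝ (P a) x (EuclideanSpace.single i 1)) _).trans
        ((add_le_add h4 h3).trans (le_of_eq ?_))
      ring
    · rw [← mul_assoc, ← ENNReal.ofReal_mul (by positivity), ← ENNReal.ofReal_pow hlam0.le,
        mul_right_comm _ B, ← ENNReal.ofReal_mul (by positivity)]
      refine mul_le_mul' (ENNReal.ofReal_le_ofReal (le_of_eq ?_)) le_rfl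
      rw [hlam, mul_pow, mul_pow]; ring
  have hq : ENNReal.ofReal lam < 1 := by
    rw [← ENNReal.ofReal_one]; exact (ENNReal.ofReal_lt_ofReal_iff one_pos).2 hθ1
  -- No derivative of `g` is known in advance; the limits of the gradients of the interpolants are
  -- the candidates.
  choose V hV hVlim hVk using fun i => exists_eLpNorm_limit (fun j => (hv j i).2.1)
    (ENNReal.mul_ne_top ENNReal.ofReal_ne_top hB) hq (hder i)
  have hSlim : Tendsto (fun n => eLpNorm (S n - g) 2 μ) atTop (𝓝 0) := by
    have h0 : Tendsto (fun n : ℕ => ENNReal.ofReal (K₁ * lam ^ n) * B) atTop (𝓝 0) := by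
      have h1 : Tendsto (fun n : ℕ => K₁ * lam ^ n) atTop (𝓝 (K₁ * 0)) :=
        (tendsto_pow_atTop_nhds_zero_of_lt_one hlam0.le hθ1).const_mul K₁
      have h2 := ENNReal.Tendsto.mul_const (ENNReal.tendsto_ofReal h1) (Or.inr hB)
      simpa using h2
    refine tendsto_of_tendsto_of_tendsto_of_le_of_le tendsto_const_nhds h0 (fun _ => zero_le)
      fun n => ?_
    dsimp only
    rw [← neg_sub, eLpNorm_neg]
    exact hval n
  -- the gradient of the error
  have hae : (fun x => f x - S k x) =ᵐ[μ] g - S k := by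
    filter_upwards [hfg] with x hx
    rw [Pi.sub_apply, hx]
  -- With `k` fixed, the functions `S n - S k` and their gradients converge in `L_2`, so the limits
  -- form a function and its weak gradient.
  have hH : IsH1Gradient (openUnitCube d) (fun x => f x - S k x) fun i => V i - v k i := by
    refine ⟨(memLp_congr_ae hae).2 (hgL.sub (hSL k)), fun i => ⟨(hV i).sub (hv k i).2.1, ?_⟩⟩
    refine HasWeakPartialDeriv.congr_ae ?_ hae.symm
    refine hasWeakPartialDeriv_of_tendsto (u := fun n => S n - S k) (v := fun n => v n i - v k i)
      (fun n => (hv n i).1.sub (hv k i).1 (hSL n) (hv n i).2.1 (hSL k) (hv k i).2.1)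
      (fun n => (hSL n).sub (hSL k)) (fun n => (hv n i).2.1.sub (hv k i).2.1)
      (hgL.sub (hSL k)) ((hV i).sub (hv k i).2.1) ?_ ?_
    · simpa only [sub_sub_sub_cancel_right] using hSlim
    · simpa only [sub_sub_sub_cancel_right] using hVlim i
  set X : ℝ≥0∞ := ENNReal.ofReal ((K₁ + K₂ + 1) * lam ^ k) * B with hX
  have hX1 : eLpNorm (fun x => f x - S k x) 2 μ ≤ X := by
    rw [eLpNorm_congr_ae hae]
    refine (hval k).trans ?_
    refine mul_le_mul' (ENNReal.ofReal_le_ofReal ?_) le_rfl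
    gcongr
    linarith
  have hX2 : ∀ i, eLpNorm (V i - v k i) 2 μ ≤ X := by
    intro i
    refine (hVk i k).trans ?_
    rw [← ENNReal.ofReal_one, ← ENNReal.ofReal_sub _ hlam0.le, ← ENNReal.ofReal_inv_of_pos h1lam,
      ← ENNReal.ofReal_pow hlam0.le, mul_right_comm _ B, ← ENNReal.ofReal_mul (by positivity),
      mul_right_comm _ B, ← ENNReal.ofReal_mul (by positivity)]
    refine mul_le_mul' (ENNReal.ofReal_le_ofReal ?_) le_rfl
    rw [← div_eq_mul_inv, ← hK₂]
    gcongr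
    linarith
  refine (iInf₂_le (fun i => V i - v k i) hH).trans ?_
  calc (eLpNorm (fun x => f x - S k x) 2 μ ^ 2 + ∑ i, eLpNorm (V i - v k i) 2 μ ^ 2) ^ (1 / 2 : ℝ)
      ≤ (X ^ 2 + ∑ _i : Fin d, X ^ 2) ^ (1 / 2 : ℝ) := by
        gcongr with i
        exact hX2 i
    _ = ENNReal.ofReal (√(d + 1)) * X := by
        have e1 : X ^ 2 + ∑ _i : Fin d, X ^ 2 = ENNReal.ofReal (d + 1) * X ^ 2 := by
          rw [Finset.sum_const, Finset.card_univ, Fintype.card_fin, nsmul_eq_mul,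
            ENNReal.ofReal_add (by positivity) (by norm_num), ENNReal.ofReal_natCast,
            ENNReal.ofReal_one]
          ring
        rw [e1, ENNReal.mul_rpow_of_nonneg _ _ (by norm_num), ← ENNReal.rpow_natCast X 2,
          ← ENNReal.rpow_mul, ENNReal.ofReal_rpow_of_nonneg (by positivity) (by norm_num),
          Real.sqrt_eq_rpow]
        norm_num
    _ = ENNReal.ofReal (√(d + 1) * (K₁ + K₂ + 1) * lam ^ k) * B := by
        rw [hX, ← mul_assoc, ← ENNReal.ofReal_mul (by positivity), mul_assoc (√_)]

end errorEstimate

/-! ### Proof of the theorem -/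

theorem theorem2p2 (d : ℕ) (hd : 2 ≤ d) (p s : ℝ) (hp0 : 0 < p) (hp2 : p ≤ 2)
    (hs : (d : ℝ) / p < s) :
    ∃ C : ℝ, 0 < C ∧ ∀ q : ℝ≥0∞, 0 < q → ∀ f : EuclideanSpace ℝ (Fin d) → ℝ,
      MemBesov s (ENNReal.ofReal p) q f →
        ∃ g : EuclideanSpace ℝ (Fin d) → ℝ,
          ContinuousOn g (closedUnitCube d) ∧
          f =ᵐ[volume.restrict (openUnitCube d)] g ∧
          ∀ k : ℕ,
            h1Norm (openUnitCube d)
                (fun x => f x - simplicialInterpolant (smoothnessOrder s) k g x) ≤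
              ENNReal.ofReal C * besovSeminorm s (ENNReal.ofReal p) q f *
                ENNReal.ofReal ((2 : ℝ) ^ (-(k : ℝ) * (s - 1 - (d : ℝ) / p + (d : ℝ) / 2))) := by
  have hs0 : 0 < s := lt_of_le_of_lt (by positivity) hs
  -- The maximum with one ensures `r ≥ 2`, as the interpolation grid requires.
  have hN : 1 ≤ ⌊max s 1⌋₊ := Nat.le_floor (by simp)
  have hr : smoothnessOrder s = ⌊max s 1⌋₊ + 1 := rfl
  set N := ⌊max s 1⌋₊
  obtain ⟨L, C₁, hC₁, h₁⟩ := exists_continuousOn_and_polynomial_approximation d N hp0 hp2 hs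
  set θ : ℝ := (2 : ℝ) ^ (-(s - d / p)) with hθdef
  have hlam : 2 * (2 : ℝ) ^ (-((d : ℝ) / 2)) * θ = (2 : ℝ) ^ (-(s - 1 - (d : ℝ) / p + (d : ℝ) / 2)) := by
    rw [hθdef]
    nth_rewrite 1 [← Real.rpow_one 2]
    rw [← Real.rpow_add two_pos, ← Real.rpow_add two_pos]
    congr 1
    ring
  have hd' : (2 : ℝ) ≤ d := by exact_mod_cast hd
  -- As `d / 2 ≥ 1` and `s > d / p`, the exponent is negative; this is the only use of `d ≥ 2`.
  have hlam1 : 2 * (2 : ℝ) ^ (-((d : ℝ) / 2)) * θ < 1 := by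
    rw [hlam]
    exact Real.rpow_lt_one_of_one_lt_of_neg (by norm_num) (by linarith)
  obtain ⟨K, hK, h₂⟩ := exists_h1Norm_sub_simplicialInterpolant_le d hN hC₁ (by positivity) hlam1
  obtain ⟨C₂, hC₂, h₃⟩ := exists_modulus_le_besovSeminorm d hs0 hp0 L
  refine ⟨K * C₂, by positivity, fun q hq f hf => ?_⟩
  set A := besovSeminorm s (ENNReal.ofReal p) q f
  have hB : ENNReal.ofReal C₂ * A ≠ ⊤ := ENNReal.mul_ne_top ENNReal.ofReal_ne_top hf.2.ne
  obtain ⟨g, hg, hfg, happ⟩ := h₁ f (ENNReal.ofReal C₂ * A) hB hf.1 (fun t ht htL => by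
    refine (h₃ q hq f hf.1.1 t ht htL).trans (le_of_eq ?_)
    rw [mul_comm C₂, ENNReal.ofReal_mul (by positivity), mul_assoc])
  refine ⟨g, hg, hfg, fun k => ?_⟩
  rw [hr]
  refine (h₂ f g _ hB hg hfg happ k).trans (le_of_eq ?_)
  rw [hlam, ← Real.rpow_mul_natCast two_pos.le, ENNReal.ofReal_mul hK.le, ENNReal.ofReal_mul hK.le,
    neg_mul_comm, mul_comm (-(k : ℝ))]
  ring
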